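/- **Theorem 4.3 (Weierstraß type representation).** *Setting.* Let $G=\mathrm{SL}(2,\mathbb R)$, $\mathfrak g=\mathfrak{sl}(2,\mathbb R)$, with $\langle X,Y\rangle=\tfrac12\operatorname{tr}(XY)$, and $$\mathbf i=\begin{pmatrix}0&-1\\1&0\end{pmatrix},\quad \mathbf j'=\begin{pmatrix}0&1\\1&0\end{pmatrix},\quad \mathbf k'=\begin{pmatrix}-1&0\\0&1\end{pmatrix}.$$ Put $S^2_1=\{X\in\mathfrak g:\langle X,X\rangle=1\}$, $\mathfrak k=\mathbb R\mathbf k'$, $\mathfrak m=\mathbb R\mathbf i\oplus\mathbb R\mathbf j'$ and $\sigma=\mathrm{Ad}(\mathbf k')$. Let $\Lambda\mathfrak g_\sigma$ be the Banach space of loops $\xi(\lambda)=\sum_{k\in\mathbb Z}\xi_k\lambda^k$, $\xi_k\in\mathfrak g$, with $\sum_k|\xi_k|<\infty$ and $\sigma(\xi(\lambda))=\xi(-\lambda)$. Let $\Lambda G_\sigma$ be the group of loops $\gamma=\sum_k\gamma_k\lambda^k$ with real $2\times2$ matrix coefficients, $\sum_k|\gamma_k|<\infty$, $\det\gamma(\lambda)=1$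 for $|\lambda|=1$ and $\sigma(\gamma(\lambda))=\gamma(-\lambda)$. The analytic twisted loop group $\tilde\Lambda G_\sigma$ consists of those $\gamma\in\Lambda G_\sigma$ that extend holomorphically to $\mathbb C^*$. Let $\Lambda^+G_\sigma$ be the subgroup of loops in $\Lambda G_\sigma$ with powers $k\ge0$ only, $\Lambda^-_*G_\sigma$ the subgroup of those with powers $k\le0$ only and $\gamma_0=\mathbf 1$, and let $\tilde\Lambda^+G_\sigma,\tilde\Lambda^-_*G_\sigma$ be their intersections with $\tilde\Lambda G_\sigma$. Smoothness of loop-valued maps refers to the norm $\sum_k|\gamma_k|$. Let $\mathbb D$ be a simply connected open subset of the Minkowski plane $(\mathbb R^2(x,y),dx\,dy)$ with $(0,0)\in\mathbb D$. For an open $U\subseteq\mathbb D$ containing the origin, an *extended framing* on $U$ is a smooth map $\Psi$ on $U$ with values in $\tilde\Lambda G_\sigma$, $\Psi(0,0)=\mathbf 1$, such that $$\Psi^{-1}d\Psi=(A+\lambda B)\,dx+(C+\lambda^{-1}E)\,dy$$ with smooth $A,C:U\to\mathfrak k$ and $B,E:U\to\mathfrak m$. A smooth map $\psi:U\to S^2_1$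 is *Lorentzian harmonic* if its tension field with respect to $dx\,dy$ and $\langle\cdot,\cdot\rangle$ vanishes. *Theorem.* Let $\xi'=\xi'_x\,dx$ be a smooth Lorentz-holomorphic 1-form on $\mathbb D$ (that is, $\partial_y\xi'_x=0$) with values in the loops of $\Lambda\mathfrak g_\sigma$ having powers $\lambda^k$, $k\le1$, only. Let $\xi''=\xi''_y\,dy$ be a smooth Lorentz-antiholomorphic 1-form on $\mathbb D$ ($\partial_x\xi''_y=0$) with values in the loops of $\Lambda\mathfrak g_\sigma$ having powers $k\ge-1$ only. 1. The problems $d\Psi'=\Psi'\xi'$, $\Psi'(0,0)=\mathbf 1$ and $d\Psi''=\Psi''\xi''$, $\Psi''(0,0)=\mathbf 1$ have unique solutions on $\mathbb D$. These are smooth with values in $\Lambda G_\sigma$. If the loops $\xi'_x(p)$ extend holomorphically to $\lambda\in\mathbb C^*$, jointly continuously in $(p,\lambda)$, then $\Psi'$ takes values in $\tilde\Lambda G_\sigma$; likewise for $\xi''$ and $\Psi''$. 2. There is a connected open neighbourhood $U\subseteq\mathbb D$ of the origin such that at each point of $U$ there is exactly one Iwasawa splitting $$(\Psi',\Psi'')=(\Psi,\Psi)\cdot(L_-^{-1},L_+^{-1}),\qquad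 \Psi\in\Lambda G_\sigma,\ L_-^{-1}\in\Lambda^-_*G_\sigma,\ L_+^{-1}\in\Lambda^+G_\sigma.$$ 3. On every connected open $U\subseteq\mathbb D$ which contains the origin and at each point of which such a splitting holds, $L_-^{-1}$ and $L_+^{-1}$ are smooth and $\Psi$ is an extended framing; in particular $\Psi$ takes values in $\tilde\Lambda G_\sigma$. For every $\lambda\in\mathbb R^+$, $\psi_\lambda=\mathrm{Ad}(\Psi_\lambda)\mathbf k'$ is a Lorentzian harmonic map from $U$ into $S^2_1$. At each point of $U$ where $\Psi'\in\tilde\Lambda G_\sigma$ one has $L_-^{-1}\in\tilde\Lambda^-_*G_\sigma$, and where $\Psi''\in\tilde\Lambda G_\sigma$ one has $L_+^{-1}\in\tilde\Lambda^+G_\sigma$; so if both hold, the splitting takes place in the analytic twisted loop group. -/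

import Mathlib

open scoped ContDiff Matrix.Norms.Operator

noncomputable section

namespace Timelike

/-! ### Minkowski three-space as `sl(2, ℝ)` and the pseudosphere -/

/-- Real `2 × 2` matrices; a point of Minkowski space is a trace-free matrix. -/
abbrev M2 := Matrix (Fin 2) (Fin 2) ℝ

def matI : M2 := !![0, -1; 1, 0]
def matJ : M2 := !![0, 1; 1, 0]
def matK : M2 := !![-1, 0; 0, 1]

/-- The Lorentzian scalar product `⟨X, Y⟩ = tr (X Y) / 2`; in the basis `matI, matJ, matK` of
`sl(2, ℝ)` it is `- u₁ v₁ + u₂ v₂ + u₃ v₃`. -/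
def scal (X Y : M2) : ℝ := (1 / 2) * (X * Y).trace

/-- The adjoint action `X ↦ g X g⁻¹`. -/
def Ad (g X : M2) : M2 := g * X * g⁻¹

/-- The unit pseudosphere of the Minkowski space `sl(2, ℝ)`. -/
def S21 : Set M2 := {X | X.trace = 0 ∧ scal X X = 1}

/-- `𝔨`, the Lie algebra of the isotropy group of `matK`. -/
def kPart : Submodule ℝ M2 := Submodule.span ℝ {matK}

/-- `𝔪`, the tangent space of the pseudosphere at `matK`. -/
def mPart : Submodule ℝ M2 := Submodule.span ℝ {matI, matJ}

/-- The involution `σ = Ad matK`, equal to `1` on `𝔨` and to `-1` on `𝔪`. -/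
def sigma (X : M2) : M2 := Ad matK X

/-! ### Lorentzian harmonic maps into the pseudosphere

The source is an open set of the Minkowski plane with null coordinates `(x, y)`. -/

/-- The coordinate vector fields `∂/∂x` and `∂/∂y`. -/
def coordVec : Fin 2 → ℝ × ℝ := ![(1, 0), (0, 1)]

/-- The Gram matrix of the metric `dx dy` in the coordinates `(x, y)`. -/
def planeMetric : Matrix (Fin 2) (Fin 2) ℝ := !![0, 1 / 2; 1 / 2, 0]

/-- Orthogonal projection of `X` to the tangent space of the pseudosphere at `N`. -/
def tangential (N X : M2) : M2 := X - scal X N • N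

/-- The second fundamental form `(∇dψ)(v, w)` of a map into the pseudosphere, for constant vector
fields `v, w`, which are parallel in the flat source. The Levi-Civita connection of the
pseudosphere is the tangential part of the flat derivative of the ambient space. -/
def hessian (ψ : ℝ × ℝ → M2) (p v w : ℝ × ℝ) : M2 :=
  tangential (ψ p) (fderiv ℝ (fun q => fderiv ℝ ψ q w) p v)

/-- The tension field, the trace of `∇dψ` with respect to the metric `dx dy`. -/
def tension (ψ : ℝ × ℝ → M2) (p : ℝ × ℝ) : M2 :=
  ∑ a, ∑ b, planeMetric⁻¹ a b • hessian ψ p (coordVec a) (coordVec b)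

/-- Smooth maps from the open set `U` to the pseudosphere with vanishing tension field. -/
structure IsHarmonicMap (U : Set (ℝ × ℝ)) (ψ : ℝ × ℝ → M2) : Prop where
  smooth : ContDiffOn ℝ ∞ ψ U
  mem_S21 : ∀ p ∈ U, ψ p ∈ S21
  tension_eq_zero : ∀ p ∈ U, tension ψ p = 0

/-! ### Loops -/

/-- Absolutely convergent loops `∑ ξ_k λ^k` with real matrix coefficients: the completion of the
Laurent polynomials under `∑ ‖ξ_k‖`. The matrix norm is the maximal absolute row sum; any other
one gives the same loops and an equivalent norm. -/
abbrev Loop : Type := lp (fun _ : ℤ => M2) 1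

theorem Loop.summable_norm (ξ : Loop) : Summable fun k : ℤ => ‖ξ k‖ := by
  have h := (memℓp_gen_iff (p := 1) (by simp)).1 (lp.memℓp ξ)
  simpa using h

theorem summable_shear {f g : ℤ → ℝ} (hf : Summable f) (hg : Summable g) (hf0 : ∀ k, 0 ≤ f k)
    (hg0 : ∀ k, 0 ≤ g k) : Summable fun q : ℤ × ℤ => f q.2 * g (q.1 - q.2) := by
  have h1 : Summable fun q : ℤ × ℤ => f q.1 * g q.2 := hf.mul_of_nonneg hg hf0 hg0
  have hi : Function.Injective fun q : ℤ × ℤ => (q.2, q.1 - q.2) := by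
    rintro ⟨a, b⟩ ⟨c, d⟩ h
    simp only [Prod.mk.injEq] at h ⊢
    omega
  exact h1.comp_injective hi

theorem summable_norm_rows {f : ℤ × ℤ → M2} (h : Summable fun q => ‖f q‖) :
    Summable fun n : ℤ => ‖∑' k : ℤ, f (n, k)‖ := by
  have h4 : Summable fun n : ℤ => ∑' k : ℤ, ‖f (n, k)‖ := h.prod
  refine h4.of_nonneg_of_le (fun _ => norm_nonneg _) (fun n => ?_)
  have h5 := h.prod_factor n
  exact norm_tsum_le_tsum_norm h5

theorem Loop.memℓp_conv (ξ η : Loop) :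
    Memℓp (fun n : ℤ => ∑' k : ℤ, ξ k * η (n - k)) 1 := by
  have h0 : Summable fun q : ℤ × ℤ => ‖ξ q.2 * η (q.1 - q.2)‖ :=
    (summable_shear ξ.summable_norm η.summable_norm (fun _ => norm_nonneg _)
      (fun _ => norm_nonneg _)).of_nonneg_of_le (fun _ => norm_nonneg _) (fun _ => norm_mul_le _ _)
  have h := summable_norm_rows h0
  refine memℓp_gen ?_
  simpa only [ENNReal.toReal_one, Real.rpow_one] using h

/-- The pointwise product of loops; on coefficients it is the convolution. -/
def Loop.mul (ξ η : Loop) : Loop :=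
  ⟨fun n : ℤ => ∑' k : ℤ, ξ k * η (n - k), Loop.memℓp_conv ξ η⟩

/-- The loop `X λ^k`. -/
def Loop.monomial (k : ℤ) (X : M2) : Loop := lp.single 1 k X

/-- The constant loop `1`. -/
def Loop.one : Loop := Loop.monomial 0 1

/-- The value of a loop at a point of the unit circle. -/
def Loop.eval (ξ : Loop) (z : ℂ) : Matrix (Fin 2) (Fin 2) ℂ :=
  ∑' k : ℤ, z ^ k • (ξ k).map (fun a : ℝ => (a : ℂ))

/-- The value `∑ ξ_k λ^k` at a real `λ ≠ 0`. It is used for loops which extend analytically to the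
punctured plane; there the Laurent series converges absolutely to the extension. -/
def Loop.evalReal (ξ : Loop) (t : ℝ) : M2 := ∑' k : ℤ, t ^ k • ξ k

/-- `σ(ξ(λ)) = ξ(-λ)`, in terms of coefficients. -/
def IsTwisted (ξ : Loop) : Prop := ∀ k : ℤ, sigma (ξ k) = (-1 : ℝ) ^ k • ξ k

/-- The twisted loop algebra of `sl(2, ℝ)`. -/
def loopAlg : Set Loop := {ξ | (∀ k : ℤ, (ξ k).trace = 0) ∧ IsTwisted ξ}

/-- The twisted loop group of `SL(2, ℝ)`. -/
def loopGroup : Set Loop := {γ | (∀ z : ℂ, ‖z‖ = 1 → (γ.eval z).det = 1) ∧ IsTwisted γ}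

/-- The loop extends to a holomorphic function on the punctured plane. -/
def ExtendsAnalytically (γ : Loop) : Prop :=
  ∃ F : ℂ → Matrix (Fin 2) (Fin 2) ℂ,
    (∀ i j, DifferentiableOn ℂ (fun z => F z i j) {0}ᶜ) ∧ ∀ z : ℂ, ‖z‖ = 1 → F z = γ.eval z

/-- The analytic twisted loop group. -/
def loopGroupAn : Set Loop := {γ | γ ∈ loopGroup ∧ ExtendsAnalytically γ}

/-- Twisted group loops with powers `k ≥ 0` only. -/
def loopGroupPlus : Set Loop := {γ | γ ∈ loopGroup ∧ ∀ k : ℤ, k < 0 → γ k = 0}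

/-- Twisted group loops with powers `k ≤ 0` only and constant term `1`. -/
def loopGroupMinusStar : Set Loop := {γ | γ ∈ loopGroup ∧ (∀ k : ℤ, 0 < k → γ k = 0) ∧ γ 0 = 1}

/-- `(g, h) = (Ψ, Ψ) (M, N)` with `M` in the normalized minus group and `N` in the plus group. -/
structure IsIwasawa (g h Ψ M N : Loop) : Prop where
  mem : Ψ ∈ loopGroup
  minus : M ∈ loopGroupMinusStar
  plus : N ∈ loopGroupPlus
  fst_eq : g = Ψ.mul M
  snd_eq : h = Ψ.mul N

/-! ### Potentials and framings -/

/-- `dΨ = Ψ (a dx + b dy)` on the open set `U`. -/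
def SolvesFrame (U : Set (ℝ × ℝ)) (Ψ a b : ℝ × ℝ → Loop) : Prop :=
  DifferentiableOn ℝ Ψ U ∧
    ∀ p ∈ U, fderiv ℝ Ψ p (1, 0) = (Ψ p).mul (a p) ∧ fderiv ℝ Ψ p (0, 1) = (Ψ p).mul (b p)

/-- `ξ dx` is a Lorentz-holomorphic `1`-form on `D` whose values are twisted loops with powers
`k ≤ 1`. -/
structure IsPotentialX (D : Set (ℝ × ℝ)) (ξ : ℝ × ℝ → Loop) : Prop where
  smooth : ContDiffOn ℝ ∞ ξ D
  mem : ∀ p ∈ D, ξ p ∈ loopAlg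
  powers : ∀ p ∈ D, ∀ k : ℤ, 1 < k → ξ p k = 0
  holomorphic : ∀ p ∈ D, fderiv ℝ ξ p (0, 1) = 0

/-- `ξ dy` is a Lorentz-antiholomorphic `1`-form on `D` whose values are twisted loops with powers
`k ≥ -1`. -/
structure IsPotentialY (D : Set (ℝ × ℝ)) (ξ : ℝ × ℝ → Loop) : Prop where
  smooth : ContDiffOn ℝ ∞ ξ D
  mem : ∀ p ∈ D, ξ p ∈ loopAlg
  powers : ∀ p ∈ D, ∀ k : ℤ, k < -1 → ξ p k = 0
  antiholomorphic : ∀ p ∈ D, fderiv ℝ ξ p (1, 0) = 0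

/-- The loops `ξ p` extend holomorphically to the punctured plane, continuously in `p`. -/
def AnalyticLoops (D : Set (ℝ × ℝ)) (ξ : ℝ × ℝ → Loop) : Prop :=
  ∃ F : ℝ × ℝ → ℂ → Matrix (Fin 2) (Fin 2) ℂ,
    ContinuousOn (fun q : (ℝ × ℝ) × ℂ => F q.1 q.2) (D ×ˢ {0}ᶜ) ∧
    (∀ p ∈ D, ∀ i j, DifferentiableOn ℂ (fun z => F p z i j) {0}ᶜ) ∧
    ∀ p ∈ D, ∀ z : ℂ, ‖z‖ = 1 → F p z = (ξ p).eval z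

/-- Extended framings: smooth `Ψ` with values in the analytic twisted loop group, equal to `1` at
the origin, with `Ψ⁻¹ dΨ = (A + λ B) dx + (C + λ⁻¹ E) dy`, where `A, C` are `𝔨`-valued and `B, E`
are `𝔪`-valued. -/
def IsExtendedFraming (U : Set (ℝ × ℝ)) (Ψ : ℝ × ℝ → Loop) : Prop :=
  ContDiffOn ℝ ∞ Ψ U ∧ (∀ p ∈ U, Ψ p ∈ loopGroupAn) ∧ Ψ (0, 0) = Loop.one ∧
    ∃ A B C E : ℝ × ℝ → M2,
      ContDiffOn ℝ ∞ A U ∧ ContDiffOn ℝ ∞ B U ∧ ContDiffOn ℝ ∞ C U ∧ ContDiffOn ℝ ∞ E U ∧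
      (∀ p ∈ U, A p ∈ kPart ∧ B p ∈ mPart ∧ C p ∈ kPart ∧ E p ∈ mPart) ∧
      SolvesFrame U Ψ (fun p => Loop.monomial 0 (A p) + Loop.monomial 1 (B p))
        (fun p => Loop.monomial 0 (C p) + Loop.monomial (-1) (E p))

/-- The solution of `dΨ = Ψ (a dx + b dy)`, `Ψ(0, 0) = 1` on `D`: it is smooth, takes values in the
twisted loop group, and every other solution agrees with it on `D`. -/
structure IsTheSolution (D : Set (ℝ × ℝ)) (Ψ a b : ℝ × ℝ → Loop) : Prop where
  smooth : ContDiffOn ℝ ∞ Ψ D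
  mem : ∀ p ∈ D, Ψ p ∈ loopGroup
  solves : SolvesFrame D Ψ a b
  init : Ψ (0, 0) = Loop.one
  unique : ∀ Φ : ℝ × ℝ → Loop, SolvesFrame D Φ a b → Φ (0, 0) = Loop.one → Set.EqOn Φ Ψ D

end Timelike

end

noncomputable section

namespace Timelike

/-! Absolutely convergent loops form a Banach algebra under convolution. Membership in the twisted
group is the pair of equations `γ * Loop.adj γ = 1` and `Loop.twist γ = γ`, where `Loop.adj` is a
bounded anti-automorphism and `Loop.twist` a bounded automorphism. Linear differential equations and
unique factorizations therefore preserve it.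

The potential ξ' depends locally on x alone, so dΨ' = Ψ'ξ' is locally an ordinary differential
equation. Two local solutions differ by a constant left factor, and over a simply connected domain
they can be glued (`exists_frame`). The same holds for ξ'' and y.

Near a pair that splits, splitting amounts to a Birkhoff factorization of one loop K near 1: find Q
= 1 + (negative powers) such that KQ has no negative powers. This is a linear equation for Q - 1,
solvable by a Neumann series and smoothly in K (`minusFactor`). A splitting is unique because powers
≤ 0 with constant term 1 and powers ≥ 0 meet only in the loop 1 (`IsIwasawa.unique`). Existence
nearby and uniqueness together make the factors of any given splitting smooth
(`IsIwasawa.contDiffOn`).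

Let M and N be the minus and plus factors. Then Ψ⁻¹dΨ = Mξ'M⁻¹ - dM M⁻¹ = Nξ''N⁻¹ - dN N⁻¹. The
first expression bounds the powers from above, by 1 in dx and by -1 in dy; the second bounds them
from below, by 0 in dx and by -1 in dy. What remains is (A + λB) dx + λ⁻¹E dy, where B is the
λ-coefficient of ξ', so ∂B/∂y = 0. With k' = `matK`, the mixed derivative of ψ_λ is Ad(Ψ_λ)[E, [B,
k']], a multiple of ψ_λ and hence normal to the pseudosphere: ψ_λ is harmonic.

Analyticity of Ψ requires none of the potentials. The substitution λ ↦ sλ is bounded on loops with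
powers ≤ 1 if s ≥ 1, and on loops with powers ≥ -1 if 0 < s ≤ 1. A dilated potential integrates to a
dilated frame (`exists_dil_frame`), so Ψ = Ψ'M⁻¹ can be dilated by s ≥ 1 and Ψ = Ψ''N⁻¹ by s ≤ 1
(`IsSplitPair.exists_smooth_dil`). A loop with absolutely convergent dilations by all s > 0 extends
to the punctured plane. -/

/-- Complex `2 × 2` matrices. -/
abbrev C2 := Matrix (Fin 2) (Fin 2) ℂ

/-! On matrices the topology of the operator norm is preferred to the entrywise one, to which it is
definitionally equal only after unfolding. -/

local instance (priority := 2000) uniformM2 : UniformSpace M2 :=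
  (inferInstance : PseudoMetricSpace M2).toUniformSpace

local instance (priority := 2000) topM2 : TopologicalSpace M2 :=
  (inferInstance : PseudoMetricSpace M2).toUniformSpace.toTopologicalSpace

local instance (priority := 2000) uniformC2 : UniformSpace C2 :=
  (inferInstance : PseudoMetricSpace C2).toUniformSpace

local instance (priority := 2000) topC2 : TopologicalSpace C2 :=
  (inferInstance : PseudoMetricSpace C2).toUniformSpace.toTopologicalSpace

/-! ### The Banach algebra of absolutely convergent loops -/

theorem Loop.norm_eq_tsum (ξ : Loop) : ‖ξ‖ = ∑' k : ℤ, ‖ξ k‖ := by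
  simpa using lp.norm_eq_tsum_rpow (p := 1) (by simp) ξ

theorem Loop.mul_coeff (ξ η : Loop) (n : ℤ) : (ξ.mul η) n = ∑' k : ℤ, ξ k * η (n - k) := rfl

theorem Loop.summable_norm_conv (ξ η : Loop) :
    Summable fun q : ℤ × ℤ => ‖ξ q.2 * η (q.1 - q.2)‖ :=
  (summable_shear ξ.summable_norm η.summable_norm (fun _ => norm_nonneg _)
    (fun _ => norm_nonneg _)).of_nonneg_of_le (fun _ => norm_nonneg _) (fun _ => norm_mul_le _ _)

theorem Loop.summable_conv (ξ η : Loop) (n : ℤ) : Summable fun k : ℤ => ξ k * η (n - k) :=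
  ((ξ.summable_norm_conv η).prod_factor n).of_norm

def shearEquiv : ℤ × ℤ ≃ ℤ × ℤ where
  toFun q := (q.2, q.1 - q.2)
  invFun q := (q.1 + q.2, q.1)
  left_inv q := by ext <;> simp
  right_inv q := by ext <;> simp

theorem Loop.summable_graded {R : Type*} [NormedRing R] [NormedAlgebra ℝ R]
    (φ : ℤ → M2 →L[ℝ] R) (C : ℝ) (hC : ∀ k X, ‖φ k X‖ ≤ C * ‖X‖) (ξ : Loop) :
    Summable fun k => ‖φ k (ξ k)‖ :=
  (ξ.summable_norm.mul_left C).of_nonneg_of_le (fun _ => norm_nonneg _) (fun k => hC k _)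

/-- A bounded graded homomorphism turns the convolution of loops into a product. -/
theorem Loop.tsum_graded_mul {R : Type*} [NormedRing R] [NormedAlgebra ℝ R] [CompleteSpace R]
    (φ : ℤ → M2 →L[ℝ] R) (C : ℝ) (hC : ∀ k X, ‖φ k X‖ ≤ C * ‖X‖)
    (hmul : ∀ k l X Y, φ k X * φ l Y = φ (k + l) (X * Y)) (ξ η : Loop) :
    ∑' n, φ n ((ξ.mul η) n) = (∑' k, φ k (ξ k)) * ∑' k, φ k (η k) := by
  have h1 := Loop.summable_graded φ C hC ξ
  have h2 := Loop.summable_graded φ C hC η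
  have h3 : Summable fun q : ℤ × ℤ => φ q.1 (ξ q.1) * φ q.2 (η q.2) :=
    summable_mul_of_summable_norm (f := fun k => φ k (ξ k)) (g := fun k => φ k (η k)) h1 h2
  have e0 : (∑' k, φ k (ξ k)) * ∑' k, φ k (η k) = ∑' q : ℤ × ℤ, φ q.1 (ξ q.1) * φ q.2 (η q.2) :=
    tsum_mul_tsum_of_summable_norm h1 h2
  have e1 : ∑' q : ℤ × ℤ, φ q.1 (ξ q.1) * φ q.2 (η q.2) = ∑' q : ℤ × ℤ, φ q.2 (ξ q.2) * φ (q.1 - q.2) (η (q.1 - q.2)) :=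
    (shearEquiv.tsum_eq (fun q : ℤ × ℤ => φ q.1 (ξ q.1) * φ q.2 (η q.2))).symm
  have h4 : Summable fun q : ℤ × ℤ => φ q.2 (ξ q.2) * φ (q.1 - q.2) (η (q.1 - q.2)) :=
    (shearEquiv.summable_iff (f := fun q : ℤ × ℤ => φ q.1 (ξ q.1) * φ q.2 (η q.2))).2 h3
  have e2 := h4.tsum_prod
  rw [e0, e1, e2]
  refine tsum_congr fun n => ?_
  have e3 := (φ n).map_tsum (ξ.summable_conv η n)
  rw [Loop.mul_coeff, e3]
  refine tsum_congr fun k => ?_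
  rw [hmul, add_sub_cancel]

/-! ### Values of loops on the unit circle. -/

def complexify : M2 →L[ℝ] C2 :=
  LinearMap.toContinuousLinearMap
    { toFun := fun X => X.map (fun a : ℝ => (a : ℂ))
      map_add' := fun X Y => by ext i j; simp
      map_smul' := fun c X => by ext i j; simp }

theorem complexify_apply (X : M2) : complexify X = X.map (fun a : ℝ => (a : ℂ)) := rfl

theorem complexify_mul (X Y : M2) : complexify (X * Y) = complexify X * complexify Y := by
  ext i j; simp [complexify_apply, Matrix.mul_apply]

theorem complexify_one : complexify 1 = 1 := by
  rw [complexify_apply, Matrix.map_one _ (by simp) (by simp)]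

def laurentTerm (z : ℂ) (k : ℤ) : M2 →L[ℝ] C2 := z ^ k • complexify

theorem laurentTerm_apply (z : ℂ) (k : ℤ) (X : M2) : laurentTerm z k X = z ^ k • complexify X := rfl

theorem norm_laurentTerm_le {z : ℂ} (hz : ‖z‖ = 1) (k : ℤ) (X : M2) :
    ‖laurentTerm z k X‖ ≤ ‖complexify‖ * ‖X‖ := by
  rw [laurentTerm_apply, norm_smul, norm_zpow, hz, one_zpow, one_mul]
  exact complexify.le_opNorm X

theorem laurentTerm_mul {z : ℂ} (hz : z ≠ 0) (k l : ℤ) (X Y : M2) :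
    laurentTerm z k X * laurentTerm z l Y = laurentTerm z (k + l) (X * Y) := by
  simp only [laurentTerm_apply, complexify_mul, zpow_add₀ hz, smul_mul_smul_comm]

theorem Loop.eval_eq (ξ : Loop) (z : ℂ) : ξ.eval z = ∑' k, laurentTerm z k (ξ k) := rfl

theorem Loop.summable_eval (ξ : Loop) {z : ℂ} (hz : ‖z‖ = 1) :
    Summable fun k => laurentTerm z k (ξ k) :=
  (Loop.summable_graded _ _ (norm_laurentTerm_le hz) ξ).of_norm

theorem ne_zero_of_norm_eq_one {z : ℂ} (hz : ‖z‖ = 1) : z ≠ 0 := by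
  rintro rfl; simp at hz

theorem Loop.eval_mul (ξ η : Loop) {z : ℂ} (hz : ‖z‖ = 1) :
    (ξ.mul η).eval z = ξ.eval z * η.eval z :=
  Loop.tsum_graded_mul _ _ (norm_laurentTerm_le hz) (laurentTerm_mul (ne_zero_of_norm_eq_one hz)) ξ η

theorem Loop.eval_add (ξ η : Loop) {z : ℂ} (hz : ‖z‖ = 1) :
    (ξ + η).eval z = ξ.eval z + η.eval z := by
  rw [Loop.eval_eq, Loop.eval_eq, Loop.eval_eq,
    ← (ξ.summable_eval hz).tsum_add (η.summable_eval hz)]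
  simp

theorem Loop.eval_smul (c : ℝ) (ξ : Loop) {z : ℂ} (hz : ‖z‖ = 1) :
    (c • ξ).eval z = c • ξ.eval z := by
  rw [Loop.eval_eq, Loop.eval_eq, ← (ξ.summable_eval hz).tsum_const_smul]
  simp

theorem Loop.monomial_coeff (k n : ℤ) (X : M2) :
    (Loop.monomial k X) n = if n = k then X else 0 := by
  unfold Loop.monomial
  split_ifs with h
  · subst h; simp
  · simp [lp.single_apply, h]

theorem Loop.one_coeff (n : ℤ) : Loop.one n = if n = 0 then 1 else 0 := Loop.monomial_coeff 0 n 1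

theorem Loop.eval_monomial (k : ℤ) (X : M2) (z : ℂ) :
    (Loop.monomial k X).eval z = z ^ k • complexify X := by
  rw [Loop.eval_eq, tsum_eq_single k]
  · simp [Loop.monomial_coeff, laurentTerm_apply]
  · intro n hn
    simp [Loop.monomial_coeff, hn]

theorem Loop.eval_one (z : ℂ) : Loop.one.eval z = 1 := by
  simp [Loop.one, Loop.eval_monomial, complexify_one]

/-! ### Fourier coefficients of loops. -/

theorem circleIntegral_zpow (n : ℤ) (R : ℝ) (hR : R ≠ 0) :
    (∮ z in C(0, R), z ^ n) = if n = -1 then 2 * Real.pi * Complex.I else 0 := by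
  split_ifs with h
  · subst h
    simpa using circleIntegral.integral_sub_center_inv 0 hR
  · simpa using circleIntegral.integral_sub_zpow_of_ne h 0 0 R

/-- The Cauchy formula for the coefficients of an absolutely convergent Laurent series. -/
theorem circleIntegral_laurent {c : ℤ → ℂ} (hc : Summable fun k => ‖c k‖) (n : ℤ) :
    (∮ z in C(0, 1), z ^ (-n - 1) * ∑' k, z ^ k * c k) = 2 * Real.pi * Complex.I * c n := by
  have key : HasSum (fun k => ∮ z in C(0, 1), z ^ (-n - 1) * (z ^ k * c k))
      (∮ z in C(0, 1), z ^ (-n - 1) * ∑' k, z ^ k * c k) := by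
    -- Termwise integration: on the unit circle the k-th term is bounded by ‖c k‖.
    refine intervalIntegral.hasSum_integral_of_dominated_convergence (fun k _ => ‖c k‖)
      (fun k => ?_) (fun k => ?_) ?_ ?_ ?_
    · refine Continuous.aestronglyMeasurable ?_
      simp only [deriv_circleMap]
      have h0 : ∀ θ : ℝ, circleMap 0 1 θ ≠ 0 := fun θ => circleMap_ne_center one_ne_zero
      have h1 : ∀ m : ℤ, Continuous fun θ : ℝ => circleMap 0 1 θ ^ m := fun m =>
        (continuous_circleMap 0 1).zpow₀ m (fun θ => Or.inl (h0 θ))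
      have h2 := continuous_circleMap 0 1
      simp only [smul_eq_mul]
      exact (h2.mul continuous_const).mul ((h1 _).mul ((h1 _).mul continuous_const))
    · refine Filter.Eventually.of_forall fun θ _ => ?_
      simp
    · exact Filter.Eventually.of_forall fun θ _ => hc
    · exact intervalIntegrable_const
    · refine Filter.Eventually.of_forall fun θ _ => ?_
      have : Summable fun k => circleMap 0 1 θ ^ k * c k :=
        (hc.congr (fun k => by simp)).of_norm
      exact (this.hasSum.mul_left _).const_smul _
  have h2 : ∀ k, (∮ z in C(0, 1), z ^ (-n - 1) * (z ^ k * c k))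
      = if k = n then 2 * Real.pi * Complex.I * c n else 0 := by
    intro k
    have h3 : (∮ z in C(0, 1), z ^ (-n - 1) * (z ^ k * c k))
        = ∮ z in C(0, 1), c k * z ^ (-n - 1 + k) := by
      refine circleIntegral.integral_congr zero_le_one fun z hz => ?_
      have hz' : z ≠ 0 := ne_zero_of_norm_eq_one (by simpa using hz)
      simp only [zpow_add₀ hz']
      ring
    rw [h3, circleIntegral.integral_const_mul, circleIntegral_zpow _ _ one_ne_zero]
    by_cases h : k = n
    · subst h
      rw [if_pos (by omega), if_pos rfl, mul_comm]
    · rw [if_neg (by omega), if_neg h, mul_zero]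
  rw [← key.tsum_eq]
  simp only [h2]
  exact tsum_ite_eq n _

theorem Loop.eval_apply (ξ : Loop) {z : ℂ} (hz : ‖z‖ = 1) (i j : Fin 2) :
    ξ.eval z i j = ∑' k, z ^ k * ((ξ k i j : ℝ) : ℂ) := by
  have h := (ξ.summable_eval hz).hasSum
  rw [← Loop.eval_eq] at h
  have h2 := (Pi.hasSum.1 (Pi.hasSum.1 h i)) j
  rw [← h2.tsum_eq]
  refine tsum_congr fun k => ?_
  simp [laurentTerm_apply, complexify_apply]

theorem norm_entry_le (X : M2) (i j : Fin 2) : ‖X i j‖ ≤ ‖X‖ := by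
  rw [Matrix.linfty_opNorm_def]
  have h1 : ‖X i j‖₊ ≤ ∑ j, ‖X i j‖₊ :=
    Finset.single_le_sum (f := fun j => ‖X i j‖₊) (fun _ _ => zero_le) (Finset.mem_univ j)
  have h2 : ∑ j, ‖X i j‖₊ ≤ Finset.univ.sup fun i => ∑ j, ‖X i j‖₊ :=
    Finset.le_sup (f := fun i => ∑ j, ‖X i j‖₊) (Finset.mem_univ i)
  exact_mod_cast h1.trans h2

theorem Loop.summable_entry (ξ : Loop) (i j : Fin 2) :
    Summable fun k => ‖((ξ k i j : ℝ) : ℂ)‖ :=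
  ξ.summable_norm.of_nonneg_of_le (fun _ => norm_nonneg _) fun k => by
    rw [Complex.norm_real]; exact norm_entry_le _ i j

/-- The coefficients of a loop are the Fourier coefficients of its values on the circle. -/
theorem Loop.circleIntegral_eval (ξ : Loop) (i j : Fin 2) (n : ℤ) :
    (∮ z in C(0, 1), z ^ (-n - 1) * ξ.eval z i j) = 2 * Real.pi * Complex.I * (ξ n i j : ℝ) := by
  rw [← circleIntegral_laurent (ξ.summable_entry i j) n]
  refine circleIntegral.integral_congr zero_le_one fun z hz => ?_
  simp only [ξ.eval_apply (by simpa using hz) i j]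

/-- The Fourier coefficients are determined by the values on the circle. Identities between loops,
the ring axioms among them, can therefore be checked pointwise on complex matrices. -/
theorem Loop.ext_eval {ξ η : Loop} (h : ∀ z : ℂ, ‖z‖ = 1 → ξ.eval z = η.eval z) : ξ = η := by
  ext n i j
  have h1 := ξ.circleIntegral_eval i j n
  have h2 := η.circleIntegral_eval i j n
  have h3 : (∮ z in C(0, 1), z ^ (-n - 1) * ξ.eval z i j)
      = ∮ z in C(0, 1), z ^ (-n - 1) * η.eval z i j := by
    refine circleIntegral.integral_congr zero_le_one fun z hz => ?_
    simp only [h z (by simpa using hz)]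
  rw [h1, h2] at h3
  have h4 : (2 * Real.pi * Complex.I : ℂ) ≠ 0 := by simp [Real.pi_ne_zero]
  exact_mod_cast mul_left_cancel₀ h4 h3

/-! ### Submultiplicativity of the norm and the ring structure. -/

theorem tsum_shear {f g : ℤ → ℝ} (hf : Summable f) (hg : Summable g) (hf0 : ∀ k, 0 ≤ f k)
    (hg0 : ∀ k, 0 ≤ g k) :
    ∑' q : ℤ × ℤ, f q.2 * g (q.1 - q.2) = (∑' k, f k) * ∑' k, g k := by
  rw [hf.tsum_mul_tsum hg (hf.mul_of_nonneg hg hf0 hg0)]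
  exact shearEquiv.tsum_eq (fun q : ℤ × ℤ => f q.1 * g q.2)

theorem tsum_norm_rows_le {f : ℤ × ℤ → M2} (h : Summable fun q => ‖f q‖) :
    ∑' n : ℤ, ‖∑' k : ℤ, f (n, k)‖ ≤ ∑' q, ‖f q‖ := by
  have h4 : Summable fun n : ℤ => ∑' k : ℤ, ‖f (n, k)‖ := h.prod
  have h5 : ∀ n, ‖∑' k : ℤ, f (n, k)‖ ≤ ∑' k : ℤ, ‖f (n, k)‖ := fun n => by
    have h6 := h.prod_factor n
    exact norm_tsum_le_tsum_norm h6
  have h7 : Summable fun n : ℤ => ‖∑' k : ℤ, f (n, k)‖ :=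
    h4.of_nonneg_of_le (fun _ => norm_nonneg _) h5
  rw [h.tsum_prod]
  exact h7.tsum_le_tsum h5 h4

theorem Loop.norm_mul_le' (ξ η : Loop) : ‖ξ.mul η‖ ≤ ‖ξ‖ * ‖η‖ := by
  have h1 := tsum_norm_rows_le (ξ.summable_norm_conv η)
  have h2 := summable_shear ξ.summable_norm η.summable_norm (fun _ => norm_nonneg _)
      (fun _ => norm_nonneg _)
  have h3 : ∑' q : ℤ × ℤ, ‖ξ q.2 * η (q.1 - q.2)‖ ≤ ∑' q : ℤ × ℤ, ‖ξ q.2‖ * ‖η (q.1 - q.2)‖ :=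
    (ξ.summable_norm_conv η).tsum_le_tsum (fun q => norm_mul_le (ξ q.2) (η (q.1 - q.2))) h2
  have h4 := tsum_shear ξ.summable_norm η.summable_norm (fun _ => norm_nonneg _)
      (fun _ => norm_nonneg _)
  rw [Loop.norm_eq_tsum, ξ.norm_eq_tsum, η.norm_eq_tsum, ← h4]
  exact h1.trans h3

theorem Loop.eval_zero (z : ℂ) : (0 : Loop).eval z = 0 := by
  rw [Loop.eval_eq]; simp

-- The product is `Loop.mul` itself, so equations stated with `Loop.mul` are definitionally
-- equations in the ring.
scoped instance : NormedRing Loop :=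
  { (inferInstance : NormedAddCommGroup Loop) with
    mul := Loop.mul
    one := Loop.one
    left_distrib := fun a b c => Loop.ext_eval fun z hz =>
      show (a.mul (b + c)).eval z = (a.mul b + a.mul c).eval z by
        rw [Loop.eval_add _ _ hz, Loop.eval_mul _ _ hz, Loop.eval_mul _ _ hz,
          Loop.eval_mul _ _ hz, Loop.eval_add _ _ hz, mul_add]
    right_distrib := fun a b c => Loop.ext_eval fun z hz =>
      show ((a + b).mul c).eval z = (a.mul c + b.mul c).eval z by
        rw [Loop.eval_add _ _ hz, Loop.eval_mul _ _ hz, Loop.eval_mul _ _ hz,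
          Loop.eval_mul _ _ hz, Loop.eval_add _ _ hz, add_mul]
    zero_mul := fun a => Loop.ext_eval fun z hz =>
      show (Loop.mul 0 a).eval z = (0 : Loop).eval z by
        rw [Loop.eval_mul _ _ hz, Loop.eval_zero, zero_mul]
    mul_zero := fun a => Loop.ext_eval fun z hz =>
      show (Loop.mul a 0).eval z = (0 : Loop).eval z by
        rw [Loop.eval_mul _ _ hz, Loop.eval_zero, mul_zero]
    mul_assoc := fun a b c => Loop.ext_eval fun z hz =>
      show ((a.mul b).mul c).eval z = (a.mul (b.mul c)).eval z by
        simp only [Loop.eval_mul _ _ hz, mul_assoc]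
    one_mul := fun a => Loop.ext_eval fun z hz =>
      show (Loop.one.mul a).eval z = a.eval z by
        rw [Loop.eval_mul _ _ hz, Loop.eval_one, one_mul]
    mul_one := fun a => Loop.ext_eval fun z hz =>
      show (a.mul Loop.one).eval z = a.eval z by
        rw [Loop.eval_mul _ _ hz, Loop.eval_one, mul_one]
    norm_mul_le := Loop.norm_mul_le' }

theorem Loop.eval_mul_of_norm (ξ η : Loop) {z : ℂ} (hz : ‖z‖ = 1) :
    (ξ * η).eval z = ξ.eval z * η.eval z := Loop.eval_mul ξ η hz

scoped instance : Algebra ℝ Loop :=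
  Algebra.ofModule
    (fun c a b => Loop.ext_eval fun z hz => by
      rw [Loop.eval_smul _ _ hz, Loop.eval_mul_of_norm _ _ hz, Loop.eval_mul_of_norm _ _ hz,
        Loop.eval_smul _ _ hz, smul_mul_assoc])
    (fun c a b => Loop.ext_eval fun z hz => by
      rw [Loop.eval_smul _ _ hz, Loop.eval_mul_of_norm _ _ hz, Loop.eval_mul_of_norm _ _ hz,
        Loop.eval_smul _ _ hz, mul_smul_comm])

scoped instance : NormedAlgebra ℝ Loop where
  norm_smul_le := norm_smul_le

/-! ### Coefficientwise maps of loops -/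

def coeffCLM (k : ℤ) : Loop →L[ℝ] M2 := lp.evalCLM ℝ (fun _ : ℤ => M2) 1 k

theorem coeffCLM_apply (k : ℤ) (ξ : Loop) : coeffCLM k ξ = ξ k := rfl

def monomialCLM (k : ℤ) : M2 →L[ℝ] Loop := lp.singleContinuousLinearMap ℝ (fun _ : ℤ => M2) 1 k

theorem Loop.ext_coeff {ξ η : Loop} (h : ∀ k : ℤ, ξ k = η k) : ξ = η := lp.ext (funext h)

theorem Loop.add_coeff (ξ η : Loop) (k : ℤ) : (ξ + η) k = ξ k + η k := rfl

theorem Loop.sub_coeff (ξ η : Loop) (k : ℤ) : (ξ - η) k = ξ k - η k := rfl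

theorem Loop.neg_coeff (ξ : Loop) (k : ℤ) : (-ξ) k = -ξ k := rfl

theorem Loop.zero_coeff (k : ℤ) : (0 : Loop) k = 0 := rfl

theorem Loop.one_coeff' (k : ℤ) : (1 : Loop) k = if k = 0 then 1 else 0 := Loop.one_coeff k

theorem Loop.mul_coeff' (ξ η : Loop) (n : ℤ) : (ξ * η) n = ∑' k : ℤ, ξ k * η (n - k) := rfl

/-- The bounded operator `∑ ξ_k λ^k ↦ ∑ w_k T(ξ_k) λ^k`. -/
def coeffMap (w : ℤ → ℝ) (B : ℝ) (hw : ∀ k, |w k| ≤ B) (T : M2 →ₗ[ℝ] M2) : Loop →L[ℝ] Loop :=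
  have hb : ∀ (ξ : Loop) (k : ℤ), ‖w k • T (ξ k)‖ ≤
      B * ‖LinearMap.toContinuousLinearMap T‖ * ‖ξ k‖ := fun ξ k => by
    have h1 := (LinearMap.toContinuousLinearMap T).le_opNorm (ξ k)
    have h2 : 0 ≤ B := (abs_nonneg _).trans (hw 0)
    rw [norm_smul, Real.norm_eq_abs, mul_assoc]
    exact mul_le_mul (hw k) h1 (norm_nonneg _) h2
  have hs : ∀ ξ : Loop, Summable fun k => ‖w k • T (ξ k)‖ := fun ξ =>
    (ξ.summable_norm.mul_left _).of_nonneg_of_le (fun _ => norm_nonneg _) (hb ξ)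
  LinearMap.mkContinuous
    { toFun := fun ξ => ⟨fun k => w k • T (ξ k), memℓp_gen (by simpa using hs ξ)⟩
      map_add' := fun ξ η => Loop.ext_coeff fun k => by
        show w k • T (ξ k + η k) = w k • T (ξ k) + w k • T (η k)
        rw [map_add, smul_add]
      map_smul' := fun c ξ => Loop.ext_coeff fun k => by
        show w k • T (c • ξ k) = c • (w k • T (ξ k))
        rw [map_smul, smul_comm] }
    (B * ‖LinearMap.toContinuousLinearMap T‖)
    (fun ξ => by
      rw [Loop.norm_eq_tsum, ξ.norm_eq_tsum, ← tsum_mul_left]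
      exact (hs ξ).tsum_le_tsum (hb ξ) (ξ.summable_norm.mul_left _))

theorem coeffMap_coeff (w : ℤ → ℝ) (B : ℝ) (hw : ∀ k, |w k| ≤ B) (T : M2 →ₗ[ℝ] M2) (ξ : Loop)
    (k : ℤ) : (coeffMap w B hw T ξ) k = w k • T (ξ k) := rfl

theorem coeffMap_mul {w : ℤ → ℝ} {B : ℝ} {hw : ∀ k, |w k| ≤ B} {T : M2 →ₗ[ℝ] M2}
    (h1 : ∀ k l, w (k + l) = w k * w l) (h2 : ∀ X Y, T (X * Y) = T X * T Y) (ξ η : Loop) :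
    coeffMap w B hw T (ξ * η) = coeffMap w B hw T ξ * coeffMap w B hw T η := by
  refine Loop.ext_coeff fun n => ?_
  have h3 : T (∑' k : ℤ, ξ k * η (n - k)) = ∑' k : ℤ, T (ξ k * η (n - k)) :=
    (LinearMap.toContinuousLinearMap T).map_tsum (ξ.summable_conv η n)
  have h4 : Summable fun k : ℤ => T (ξ k * η (n - k)) :=
    (ξ.summable_conv η n).map (LinearMap.toContinuousLinearMap T)
      (LinearMap.toContinuousLinearMap T).continuous
  rw [coeffMap_coeff, Loop.mul_coeff', Loop.mul_coeff', h3, ← h4.tsum_const_smul]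
  refine tsum_congr fun k => ?_
  rw [coeffMap_coeff, coeffMap_coeff, h2, smul_mul_smul_comm, ← h1, add_sub_cancel]

theorem norm_coeffMap_id_le {w : ℤ → ℝ} {B : ℝ} (hw : ∀ k, |w k| ≤ B) (ξ : Loop) :
    ‖coeffMap w B hw LinearMap.id ξ‖ ≤ B * ‖ξ‖ := by
  have hb : ∀ k, ‖(coeffMap w B hw LinearMap.id ξ) k‖ ≤ B * ‖ξ k‖ := fun k => by
    rw [coeffMap_coeff, norm_smul, Real.norm_eq_abs]
    exact mul_le_mul_of_nonneg_right (hw k) (norm_nonneg _)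
  rw [Loop.norm_eq_tsum, ξ.norm_eq_tsum, ← tsum_mul_left]
  exact (Loop.summable_norm _).tsum_le_tsum hb (ξ.summable_norm.mul_left _)

/-! ### The adjugate and the determinant -/

/-- In size two the adjugate is linear, which makes inversion of loops of determinant 1 the
restriction of a bounded linear operator. -/
def adjLin : M2 →ₗ[ℝ] M2 where
  toFun := Matrix.adjugate
  map_add' X Y := by
    ext i j; fin_cases i <;> fin_cases j <;> simp [Matrix.adjugate_fin_two] <;> ring
  map_smul' c X := by
    ext i j; fin_cases i <;> fin_cases j <;> simp [Matrix.adjugate_fin_two]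

theorem adjLin_apply (X : M2) : adjLin X = X.adjugate := rfl

theorem trace_eq_zero_iff_adjugate (X : M2) : X.trace = 0 ↔ X.adjugate = -X := by
  rw [Matrix.trace_fin_two]
  constructor
  · intro h
    ext i j; fin_cases i <;> fin_cases j <;> simp [Matrix.adjugate_fin_two] <;> linarith
  · intro h
    have := congrFun (congrFun h 0) 0
    simp [Matrix.adjugate_fin_two] at this
    linarith

/-- The coefficientwise, and hence pointwise, adjugate of a loop. -/
def Loop.adj : Loop →L[ℝ] Loop := coeffMap (fun _ => 1) 1 (fun _ => by simp) adjLin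

theorem Loop.adj_coeff (ξ : Loop) (k : ℤ) : (Loop.adj ξ) k = (ξ k).adjugate := by
  rw [Loop.adj, coeffMap_coeff, one_smul, adjLin_apply]

theorem Loop.eval_adj (ξ : Loop) {z : ℂ} (hz : ‖z‖ = 1) :
    (Loop.adj ξ).eval z = (ξ.eval z).adjugate := by
  ext i j
  rw [Matrix.adjugate_fin_two, Loop.eval_apply _ hz]
  fin_cases i <;> fin_cases j <;>
    simp [Loop.eval_apply _ hz, Loop.adj_coeff, Matrix.adjugate_fin_two, tsum_neg]

theorem Loop.adj_mul (ξ η : Loop) : Loop.adj (ξ * η) = Loop.adj η * Loop.adj ξ :=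
  Loop.ext_eval fun z hz => by
    rw [Loop.eval_adj _ hz, Loop.eval_mul_of_norm _ _ hz, Loop.eval_mul_of_norm _ _ hz,
      Loop.eval_adj _ hz, Loop.eval_adj _ hz, Matrix.adjugate_mul_distrib]

theorem Loop.adj_adj (ξ : Loop) : Loop.adj (Loop.adj ξ) = ξ := by
  refine Loop.ext_coeff fun k => ?_
  rw [Loop.adj_coeff, Loop.adj_coeff]
  exact Matrix.adjugate_adjugate' _ |>.trans (by simp)

theorem Loop.adj_one : Loop.adj 1 = 1 :=
  Loop.ext_coeff fun k => by
    rw [Loop.adj_coeff, Loop.one_coeff']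
    split_ifs <;> simp

/-- Since X adj(X) = det(X) 1, the determinant condition on the circle becomes one equation in the
Banach algebra, which can be differentiated. -/
theorem Loop.det_eval_eq_one_iff (ξ : Loop) :
    (∀ z : ℂ, ‖z‖ = 1 → (ξ.eval z).det = 1) ↔ ξ * Loop.adj ξ = 1 := by
  constructor
  · intro h
    refine Loop.ext_eval fun z hz => ?_
    rw [Loop.eval_mul_of_norm _ _ hz, Loop.eval_adj _ hz, Matrix.mul_adjugate, h z hz, one_smul]
    exact (Loop.eval_one z).symm
  · intro h z hz
    have h1 : (ξ * Loop.adj ξ).eval z = 1 := by rw [h]; exact Loop.eval_one z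
    rw [Loop.eval_mul_of_norm _ _ hz, Loop.eval_adj _ hz, Matrix.mul_adjugate] at h1
    simpa using congrFun (congrFun h1 0) 0

theorem Loop.adj_mul_self {ξ : Loop} (h : ξ * Loop.adj ξ = 1) : Loop.adj ξ * ξ = 1 := by
  refine Loop.ext_eval fun z hz => ?_
  rw [Loop.eval_mul_of_norm _ _ hz, Loop.eval_adj _ hz, Matrix.adjugate_mul,
    (Loop.det_eval_eq_one_iff ξ).2 h z hz, one_smul]
  exact (Loop.eval_one z).symm

theorem Loop.adj_eq_neg_iff (ξ : Loop) : Loop.adj ξ = -ξ ↔ ∀ k : ℤ, (ξ k).trace = 0 := by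
  constructor
  · intro h k
    rw [trace_eq_zero_iff_adjugate, ← Loop.adj_coeff, h, Loop.neg_coeff]
  · intro h
    refine Loop.ext_coeff fun k => ?_
    rw [Loop.adj_coeff, (trace_eq_zero_iff_adjugate _).1 (h k), Loop.neg_coeff]

/-! ### The twist -/

theorem matK_mul_matK : matK * matK = 1 := by
  ext i j; fin_cases i <;> fin_cases j <;> simp [matK, Matrix.mul_apply]

theorem matK_inv : matK⁻¹ = matK := Matrix.inv_eq_right_inv matK_mul_matK

theorem sigma_eq (X : M2) : sigma X = matK * X * matK := by rw [sigma, Ad, matK_inv]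

theorem sigma_entries (X : M2) : sigma X = !![X 0 0, -X 0 1; -X 1 0, X 1 1] := by
  rw [sigma_eq, matK]
  conv_lhs => rw [Matrix.eta_fin_two X]
  rw [Matrix.mul_fin_two, Matrix.mul_fin_two]
  simp

def sigmaLin : M2 →ₗ[ℝ] M2 where
  toFun := sigma
  map_add' X Y := by simp only [sigma_eq, mul_add, add_mul]
  map_smul' c X := by simp [sigma_eq]

theorem sigmaLin_mul (X Y : M2) : sigmaLin (X * Y) = sigmaLin X * sigmaLin Y := by
  show sigma _ = sigma _ * sigma _
  simp only [sigma_eq]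
  calc matK * (X * Y) * matK = matK * X * 1 * Y * matK := by noncomm_ring
    _ = _ := by rw [← matK_mul_matK]; noncomm_ring

/-- The automorphism `ξ ↦ σ(ξ(-λ))`. -/
def Loop.twist : Loop →L[ℝ] Loop :=
  coeffMap (fun k => (-1) ^ k) 1 (fun k => by rw [abs_zpow]; simp) sigmaLin

theorem Loop.twist_coeff (ξ : Loop) (k : ℤ) : (Loop.twist ξ) k = (-1 : ℝ) ^ k • sigma (ξ k) := rfl

theorem Loop.twist_mul (ξ η : Loop) : Loop.twist (ξ * η) = Loop.twist ξ * Loop.twist η :=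
  coeffMap_mul (fun k l => zpow_add₀ (by norm_num) k l) sigmaLin_mul ξ η

theorem isTwisted_iff (ξ : Loop) : IsTwisted ξ ↔ Loop.twist ξ = ξ := by
  have h1 : ∀ k : ℤ, (-1 : ℝ) ^ k * (-1) ^ k = 1 := fun k => by
    rw [← mul_zpow]; simp
  constructor
  · intro h
    refine Loop.ext_coeff fun k => ?_
    rw [Loop.twist_coeff, h k, smul_smul, h1, one_smul]
  · intro h k
    nth_rw 2 [← h]
    rw [Loop.twist_coeff, smul_smul, h1, one_smul]

theorem Loop.twist_one : Loop.twist 1 = 1 := by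
  refine Loop.ext_coeff fun k => ?_
  rw [Loop.twist_coeff, Loop.one_coeff']
  split_ifs with h
  · rw [h, sigma_eq, mul_one, matK_mul_matK, zpow_zero, one_smul]
  · rw [sigma_eq, mul_zero, zero_mul, smul_zero]

theorem Loop.twist_adj (ξ : Loop) : Loop.twist (Loop.adj ξ) = Loop.adj (Loop.twist ξ) := by
  refine Loop.ext_coeff fun k => ?_
  rw [Loop.twist_coeff, Loop.adj_coeff, Loop.adj_coeff, Loop.twist_coeff, ← adjLin_apply,
    ← adjLin_apply, map_smul, adjLin_apply, adjLin_apply]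
  congr 1
  rw [sigma_entries, sigma_entries]
  ext i j; fin_cases i <;> fin_cases j <;> simp [Matrix.adjugate_fin_two]

/-! ### The loop group -/

theorem mem_loopGroup_iff (γ : Loop) :
    γ ∈ loopGroup ↔ γ * Loop.adj γ = 1 ∧ Loop.twist γ = γ := by
  rw [← isTwisted_iff, ← Loop.det_eval_eq_one_iff]; rfl

theorem mem_loopAlg_iff (ξ : Loop) :
    ξ ∈ loopAlg ↔ Loop.adj ξ = -ξ ∧ Loop.twist ξ = ξ := by
  rw [← isTwisted_iff, Loop.adj_eq_neg_iff]; rfl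

theorem one_mem_loopGroup : (1 : Loop) ∈ loopGroup := by
  rw [mem_loopGroup_iff, Loop.adj_one, Loop.twist_one, mul_one]; exact ⟨rfl, rfl⟩

theorem mul_adj_self {γ : Loop} (h : γ ∈ loopGroup) : γ * Loop.adj γ = 1 :=
  ((mem_loopGroup_iff γ).1 h).1

theorem adj_mul_self {γ : Loop} (h : γ ∈ loopGroup) : Loop.adj γ * γ = 1 :=
  Loop.adj_mul_self (mul_adj_self h)

theorem mul_mem_loopGroup {γ δ : Loop} (h : γ ∈ loopGroup) (h' : δ ∈ loopGroup) :
    γ * δ ∈ loopGroup := by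
  rw [mem_loopGroup_iff] at *
  refine ⟨?_, by rw [Loop.twist_mul, h.2, h'.2]⟩
  rw [Loop.adj_mul, mul_assoc, ← mul_assoc δ, h'.1, one_mul, h.1]

theorem adj_mem_loopGroup {γ : Loop} (h : γ ∈ loopGroup) : Loop.adj γ ∈ loopGroup := by
  have h1 := adj_mul_self h
  rw [mem_loopGroup_iff] at *
  rw [Loop.adj_adj, Loop.twist_adj, h.2]
  exact ⟨h1, rfl⟩

/-! ### Loops with powers in a half line -/

def PowLE (n : ℤ) (ξ : Loop) : Prop := ∀ k : ℤ, n < k → ξ k = 0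

def PowGE (n : ℤ) (ξ : Loop) : Prop := ∀ k : ℤ, k < n → ξ k = 0

theorem PowLE.mul {m n : ℤ} {ξ η : Loop} (hξ : PowLE m ξ) (hη : PowLE n η) :
    PowLE (m + n) (ξ * η) := fun l hl => by
  rw [Loop.mul_coeff']
  refine (tsum_congr fun k => ?_).trans tsum_zero
  by_cases h : m < k
  · rw [hξ k h, zero_mul]
  · rw [hη (l - k) (by omega), mul_zero]

theorem PowGE.mul {m n : ℤ} {ξ η : Loop} (hξ : PowGE m ξ) (hη : PowGE n η) :
    PowGE (m + n) (ξ * η) := fun l hl => by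
  rw [Loop.mul_coeff']
  refine (tsum_congr fun k => ?_).trans tsum_zero
  by_cases h : k < m
  · rw [hξ k h, zero_mul]
  · rw [hη (l - k) (by omega), mul_zero]

/-- In the convolution sum the first factor vanishes for k > m and the second for k < m, so only the
product of the top coefficients survives. -/
theorem PowLE.mul_coeff {m n : ℤ} {ξ η : Loop} (hξ : PowLE m ξ) (hη : PowLE n η) :
    (ξ * η) (m + n) = ξ m * η n := by
  rw [Loop.mul_coeff', tsum_eq_single m, add_sub_cancel_left]
  intro k hk
  by_cases h : m < k
  · rw [hξ k h, zero_mul]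
  · rw [hη (m + n - k) (by omega), mul_zero]

theorem PowLE.mono {m n : ℤ} {ξ : Loop} (h : PowLE m ξ) (hmn : m ≤ n) : PowLE n ξ :=
  fun k hk => h k (by omega)

theorem PowGE.mono {m n : ℤ} {ξ : Loop} (h : PowGE m ξ) (hmn : n ≤ m) : PowGE n ξ :=
  fun k hk => h k (by omega)

theorem PowLE.adj {n : ℤ} {ξ : Loop} (hξ : PowLE n ξ) : PowLE n (Loop.adj ξ) :=
  fun k hk => by rw [Loop.adj_coeff, hξ k hk, Matrix.adjugate_zero]

theorem PowGE.adj {n : ℤ} {ξ : Loop} (hξ : PowGE n ξ) : PowGE n (Loop.adj ξ) :=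
  fun k hk => by rw [Loop.adj_coeff, hξ k hk, Matrix.adjugate_zero]

theorem powLE_one : PowLE 0 (1 : Loop) := fun k hk => by
  rw [Loop.one_coeff', if_neg (by omega)]

theorem powGE_one : PowGE 0 (1 : Loop) := fun k hk => by
  rw [Loop.one_coeff', if_neg (by omega)]

/-- An algebraic form of Liouville's theorem. It yields the uniqueness of the splitting and the
determinant of the minus factor. -/
theorem Loop.eq_one_of_pow {ξ : Loop} (h1 : PowLE 0 ξ) (h2 : PowGE 0 ξ) (h3 : ξ 0 = 1) :
    ξ = 1 := by
  refine Loop.ext_coeff fun k => ?_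
  rw [Loop.one_coeff']
  split_ifs with h
  · rw [h, h3]
  · rcases lt_or_gt_of_ne h with h | h
    · exact h2 k h
    · exact h1 k h

theorem adj_mem_minus {γ : Loop} (h : γ ∈ loopGroupMinusStar) :
    Loop.adj γ ∈ loopGroupMinusStar :=
  ⟨adj_mem_loopGroup h.1, PowLE.adj h.2.1, by rw [Loop.adj_coeff, h.2.2, Matrix.adjugate_one]⟩

theorem adj_mem_plus {γ : Loop} (h : γ ∈ loopGroupPlus) : Loop.adj γ ∈ loopGroupPlus :=
  ⟨adj_mem_loopGroup h.1, PowGE.adj h.2⟩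

theorem mul_mem_minus {γ δ : Loop} (h : γ ∈ loopGroupMinusStar) (h' : δ ∈ loopGroupMinusStar) :
    γ * δ ∈ loopGroupMinusStar :=
  ⟨mul_mem_loopGroup h.1 h'.1, PowLE.mul h.2.1 h'.2.1, by
    have := PowLE.mul_coeff h.2.1 h'.2.1
    rw [add_zero] at this
    rw [this, h.2.2, h'.2.2, one_mul]⟩

theorem mul_mem_plus {γ δ : Loop} (h : γ ∈ loopGroupPlus) (h' : δ ∈ loopGroupPlus) :
    γ * δ ∈ loopGroupPlus :=
  ⟨mul_mem_loopGroup h.1 h'.1, PowGE.mul h.2 h'.2⟩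

theorem one_mem_minus : (1 : Loop) ∈ loopGroupMinusStar :=
  ⟨one_mem_loopGroup, powLE_one, by rw [Loop.one_coeff', if_pos rfl]⟩

theorem one_mem_plus : (1 : Loop) ∈ loopGroupPlus := ⟨one_mem_loopGroup, powGE_one⟩

/-! ### Trivial cocycles on simply connected spaces -/

/-- On a simply connected space, group-valued functions on an open cover which differ by locally
constant left factors come from a single function. -/
theorem exists_global_of_locally_const {X G : Type*} [TopologicalSpace X] [SimplyConnectedSpace X]
    [LocallyPathConnectedSpace X] [Group G] (V : X → Set X) (hV : ∀ i, IsOpen (V i))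
    (hmem : ∀ i, i ∈ V i) (f : X → X → G)
    (hf : ∀ i j, ∀ x ∈ V i ∩ V j, ∀ᶠ y in nhds x, f i y * (f j y)⁻¹ = f i x * (f j x)⁻¹)
    (x₀ : X) (g₀ : G) :
    ∃ F : X → G, F x₀ = g₀ ∧
      ∀ i, ∀ x ∈ V i, ∀ᶠ y in nhds x, F y * (f i y)⁻¹ = F x * (f i x)⁻¹ := by
  -- With discrete fibres, locally constant transition functions are continuous and the bundle is a
  -- covering.
  let _ : TopologicalSpace G := ⊥
  have : DiscreteTopology G := ⟨rfl⟩
  let Z : FiberBundleCore X X G :=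
    { baseSet := V
      isOpen_baseSet := hV
      indexAt := id
      mem_baseSet_at := hmem
      -- The chart i represents a value F by v = F (f i)⁻¹, which dictates the change of chart.
      coordChange := fun i j x v => v * f i x * (f j x)⁻¹
      coordChange_self := fun i x _ v => by simp
      continuousOn_coordChange := fun i j => by
        intro p hp
        have h1 := hf i j p.1 hp.1
        have h2 : ∀ᶠ q : X × G in nhds p, q.2 * f i q.1 * (f j q.1)⁻¹
            = p.2 * f i p.1 * (f j p.1)⁻¹ := by
          have h3 : ∀ᶠ q : X × G in nhds p, q.2 = p.2 :=
            continuous_snd.continuousAt.eventually_mem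
              ((isOpen_discrete ({p.2} : Set G)).mem_nhds rfl)
          have h4 : ∀ᶠ q : X × G in nhds p,
              f i q.1 * (f j q.1)⁻¹ = f i p.1 * (f j p.1)⁻¹ :=
            continuous_fst.continuousAt.eventually h1
          filter_upwards [h3, h4] with q h5 h6
          rw [h5, mul_assoc, h6, mul_assoc]
        refine ContinuousAt.continuousWithinAt ?_
        exact (continuousAt_const (y := p.2 * f i p.1 * (f j p.1)⁻¹)).congr
          (h2.mono fun q hq => hq.symm)
      coordChange_comp := fun i j k x _ v => by group }
  have cov : IsCoveringMap (Bundle.TotalSpace.proj : Z.TotalSpace → X) :=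
    FiberBundle.isCoveringMap
  -- Simple connectedness lifts the identity map to the covering, which gives a global section; its
  -- starting point encodes F x₀ = g₀.
  obtain ⟨s, ⟨hs0, hs1⟩, -⟩ := cov.existsUnique_continuousMap_lifts (ContinuousMap.id X) x₀
    (⟨x₀, g₀ * (f x₀ x₀)⁻¹⟩ : Z.TotalSpace) rfl
  have hproj : ∀ x, (s x).proj = x := fun x => congrFun hs1 x
  let v : X → G := fun x => (s x).snd
  let F : X → G := fun x => v x * f (s x).proj (s x).proj
  have hF : ∀ x, F x = v x * f (s x).proj (s x).proj := fun x => rfl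
  refine ⟨F, ?_, fun i x hx => ?_⟩
  · have hv : v x₀ = g₀ * (f x₀ x₀)⁻¹ := by
      show (s x₀).snd = _
      rw [hs0]
    rw [hF, hv, hs0]
    exact inv_mul_cancel_right g₀ (f x₀ x₀)
  · have h1 : ∀ y, (Z.localTriv i (s y)).2 = F y * (f i y)⁻¹ := fun y => by
      show v y * f (s y).proj (s y).proj * (f i (s y).proj)⁻¹ = _
      rw [hF, hproj y]
    have h2 : ContinuousAt (fun y => (Z.localTriv i (s y)).2) x := by
      refine continuous_snd.continuousAt.comp ?_
      refine ContinuousAt.comp ?_ s.continuous.continuousAt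
      refine (Z.localTriv i).continuousAt ?_
      rw [(Z.localTriv i).mem_source]
      show (s x).proj ∈ V i
      rwa [hproj]
    filter_upwards [h2.eventually_mem
      ((isOpen_discrete ({(Z.localTriv i (s x)).2} : Set G)).mem_nhds rfl)] with y hy
    rw [← h1, ← h1]
    exact hy

/-! ### Linear differential equations in a Banach algebra -/

section ODE

variable {A : Type*} [NormedRing A] [NormedAlgebra ℝ A]

/-- Picard-Lindelöf on the closed unit ball about 1, where ‖x‖ ≤ ‖1‖ + 1; the normalization ‖1‖ = 1
is not assumed. The time 1/L keeps the solution in that ball, and the interval is then shrunk to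
stay in the open set of units. -/
theorem exists_local_ode [CompleteSpace A] (a : ℝ → A) (s₀ δ : ℝ) (hδ : 0 < δ)
    (ha : ContinuousOn a (Set.Icc (s₀ - δ) (s₀ + δ))) :
    ∃ ε, 0 < ε ∧ ε ≤ δ ∧ ∃ φ : ℝ → A, ∀ s ∈ Set.Ioo (s₀ - ε) (s₀ + ε),
      HasDerivAt φ (φ s * a s) s ∧ IsUnit (φ s) := by
  obtain ⟨C, hC⟩ := isCompact_Icc.exists_bound_of_continuousOn ha
  have hC0 : 0 ≤ C := (norm_nonneg _).trans (hC s₀ ⟨by linarith, by linarith⟩)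
  set L : ℝ := (‖(1 : A)‖ + 1) * (C + 1) with hL
  have hL0 : 0 < L := by positivity
  set ε : ℝ := min δ (1 / L) with hε
  have hε0 : 0 < ε := lt_min hδ (by positivity)
  have hεδ : ε ≤ δ := min_le_left _ _
  have hsub : Set.Icc (s₀ - ε) (s₀ + ε) ⊆ Set.Icc (s₀ - δ) (s₀ + δ) :=
    Set.Icc_subset_Icc (by linarith) (by linarith)
  have hPL : IsPicardLindelof (fun t x => x * a t)
      (⟨s₀, by constructor <;> linarith⟩ : Set.Icc (s₀ - ε) (s₀ + ε)) (1 : A) 1 0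
      ⟨L, hL0.le⟩ ⟨C, hC0⟩ :=
    { lipschitzOnWith := fun t ht => LipschitzOnWith.of_dist_le_mul fun x _ y _ => by
        rw [dist_eq_norm, dist_eq_norm, ← sub_mul, mul_comm]
        exact (norm_mul_le _ _).trans
          ((mul_le_mul_of_nonneg_left (hC t (hsub ht)) (norm_nonneg _)).trans_eq (mul_comm _ _)
            |>.trans_eq (mul_comm _ _))
      continuousOn := fun x _ => continuousOn_const.mul (ha.mono hsub)
      norm_le := fun t ht x hx => by
        have h1 : ‖x‖ ≤ ‖(1 : A)‖ + 1 := by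
          have h2 : ‖x - 1‖ ≤ 1 := by simpa [dist_eq_norm] using hx
          calc ‖x‖ = ‖1 + (x - 1)‖ := by rw [add_sub_cancel]
            _ ≤ _ := (norm_add_le _ _).trans (by linarith)
        refine (norm_mul_le _ _).trans ?_
        show ‖x‖ * ‖a t‖ ≤ L
        exact mul_le_mul h1 ((hC t (hsub ht)).trans (by linarith)) (norm_nonneg _) (by positivity)
      mul_max_le := by
        show L * max (s₀ + ε - s₀) (s₀ - (s₀ - ε)) ≤ ((1 : NNReal) : ℝ) - ((0 : NNReal) : ℝ)
        have : L * ε ≤ 1 := by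
          calc L * ε ≤ L * (1 / L) := mul_le_mul_of_nonneg_left (min_le_right _ _) hL0.le
            _ = 1 := by field_simp
        simpa using this }
  obtain ⟨φ, hφ0, hφ⟩ := hPL.exists_eq_forall_mem_Icc_hasDerivWithinAt₀
  have hd : ∀ s ∈ Set.Ioo (s₀ - ε) (s₀ + ε), HasDerivAt φ (φ s * a s) s := fun s hs =>
    (hφ s (Set.Ioo_subset_Icc_self hs)).hasDerivAt (Icc_mem_nhds hs.1 hs.2)
  have hφ0' : φ s₀ = 1 := hφ0
  have hcont : ContinuousAt φ s₀ := (hd s₀ ⟨by linarith, by linarith⟩).continuousAt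
  have hunit : ∀ᶠ s in nhds s₀, IsUnit (φ s) := by
    refine hcont.eventually ?_
    rw [hφ0']
    exact Units.isOpen.mem_nhds isUnit_one
  obtain ⟨η, hη0, hη⟩ := Metric.eventually_nhds_iff_ball.1 hunit
  refine ⟨min ε η, lt_min hε0 hη0, (min_le_left _ _).trans hεδ, φ, fun s hs => ⟨hd s ?_, hη s ?_⟩⟩
  · have := min_le_left ε η
    exact ⟨by linarith [hs.1], by linarith [hs.2]⟩
  · have := min_le_right ε η
    rw [Metric.mem_ball, Real.dist_eq, abs_lt]
    exact ⟨by linarith [hs.1], by linarith [hs.2]⟩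

/-- Two solutions of `dΦ = Φ (ξ π)` differ by a constant left factor. -/
theorem mul_inverse_const [CompleteSpace A] {E : Type*} [NormedAddCommGroup E] [NormedSpace ℝ E]
    (π : E →L[ℝ] ℝ) {S : Set E} (hS : IsOpen S) (hS' : IsPreconnected S) {ξ Φ Φ' : E → A}
    (h : ∀ p ∈ S, HasFDerivAt Φ (π.smulRight (Φ p * ξ p)) p)
    (h' : ∀ p ∈ S, HasFDerivAt Φ' (π.smulRight (Φ' p * ξ p)) p)
    (hu : ∀ p ∈ S, IsUnit (Φ' p)) {p q : E} (hp : p ∈ S) (hq : q ∈ S) :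
    Φ p * Ring.inverse (Φ' p) = Φ q * Ring.inverse (Φ' q) := by
  -- The two contributions Φ ξ Φ'⁻¹ and -Φ Φ'⁻¹ (Φ' ξ) Φ'⁻¹ cancel.
  have hd : ∀ p ∈ S, HasFDerivAt (fun p => Φ p * Ring.inverse (Φ' p)) (0 : E →L[ℝ] A) p := by
    intro p hp
    obtain ⟨u, hu⟩ := hu p hp
    have h1 : HasFDerivAt Ring.inverse (-ContinuousLinearMap.mulLeftRight ℝ A ↑u⁻¹ ↑u⁻¹) (Φ' p) :=
      hu ▸ hasFDerivAt_ringInverse u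
    have h2 := (h p hp).mul' (h1.comp p (h' p hp))
    refine h2.congr_fderiv ?_
    ext v
    simp only [Function.comp, add_apply, smul_apply,
      ContinuousLinearMap.comp_apply, neg_apply,
      ContinuousLinearMap.mulLeftRight_apply, ContinuousLinearMap.smulRight_apply,
      zero_apply, smul_eq_mul, MulOpposite.smul_eq_mul_unop,
      MulOpposite.unop_op, ← hu, mul_smul_comm, smul_mul_assoc]
    rw [← mul_assoc (↑u⁻¹ : A), Units.inv_mul, one_mul]
    simp [mul_assoc]
  exact hS.is_const_of_fderiv_eq_zero hS'
    (fun p hp => (hd p hp).differentiableAt.differentiableWithinAt)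
    (fun p hp => (hd p hp).fderiv) hp hq

/-- `ξ` is constant along the segments in `D` on which `π` is constant. -/
def FactorsLocally {E F : Type*} [NormedAddCommGroup E] [NormedSpace ℝ E] (D : Set E)
    (π : E →L[ℝ] ℝ) (ξ : E → F) : Prop :=
  ∀ p q : E, segment ℝ p q ⊆ D → π p = π q → ξ p = ξ q

variable {E : Type*} [NormedAddCommGroup E] [NormedSpace ℝ E]

/-- Inside a ball each point is joined to the point of the line p₀ + ℝe with the same value of π by
a segment in the ball. Hence ξ is a function of π there, and a solution φ along the line gives the
frame φ ∘ π. The bounds on e and π keep the point on the line in the same ball. -/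
theorem exists_local_frame [CompleteSpace A] {D : Set E} (hD : IsOpen D) (π : E →L[ℝ] ℝ) (e : E)
    (he : π e = 1) (he1 : ‖e‖ ≤ 1) (hπ : ∀ v, |π v| ≤ ‖v‖) (ξ : E → A) (hξ : ContinuousOn ξ D)
    (hfac : FactorsLocally D π ξ) {p₀ : E} (hp₀ : p₀ ∈ D) :
    ∃ r, 0 < r ∧ Metric.ball p₀ r ⊆ D ∧ ∃ Φ : E → A, ∀ p ∈ Metric.ball p₀ r,
      HasFDerivAt Φ (π.smulRight (Φ p * ξ p)) p ∧ IsUnit (Φ p) := by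
  obtain ⟨δ', hδ', hball'⟩ := Metric.isOpen_iff.1 hD p₀ hp₀
  set δ := δ' / 2 with hδdef
  have hδ : 0 < δ := by positivity
  set γ : ℝ → E := fun s => p₀ + (s - π p₀) • e with hγ
  have hγc : Continuous γ := by fun_prop
  have hdist : ∀ s, dist (γ s) p₀ ≤ |s - π p₀| := fun s => by
    rw [dist_eq_norm, hγ]
    simp only [add_sub_cancel_left, norm_smul, Real.norm_eq_abs]
    exact mul_le_of_le_one_right (abs_nonneg _) he1
  have hmaps : Set.MapsTo γ (Set.Icc (π p₀ - δ) (π p₀ + δ)) D := fun s hs => by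
    refine hball' ((hdist s).trans_lt ?_)
    rw [abs_lt]
    constructor <;> linarith [hs.1, hs.2]
  obtain ⟨ε, hε, hεδ, φ, hφ⟩ := exists_local_ode (fun s => ξ (γ s)) (π p₀) δ hδ
    (hξ.comp hγc.continuousOn hmaps)
  have hsubD : Metric.ball p₀ ε ⊆ D := (Metric.ball_subset_ball (by linarith)).trans hball'
  refine ⟨ε, hε, hsubD, fun p => φ (π p), fun p hp => ?_⟩
  have h1 : |π p - π p₀| < ε := by
    rw [← map_sub]
    exact (hπ _).trans_lt (by rwa [Metric.mem_ball, dist_eq_norm] at hp)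
  have h2 : γ (π p) ∈ Metric.ball p₀ ε := (hdist _).trans_lt h1
  have h3 : ξ (γ (π p)) = ξ p :=
    hfac _ _ (((convex_ball p₀ ε).segment_subset h2 hp).trans hsubD) (by simp [hγ, he])
  rw [abs_lt] at h1
  have h4 := hφ (π p) ⟨by linarith [h1.1], by linarith [h1.2]⟩
  refine ⟨?_, h4.2⟩
  rw [← h3]
  refine (h4.1.hasFDerivAt.comp p π.hasFDerivAt).congr_fderiv ?_
  ext v
  simp

/-- The level sets of π in D may be disconnected, so ξ need not be a function of π on all of D and
one global ordinary differential equation does not suffice. Local frames are glued by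
`exists_global_of_locally_const` instead. -/
theorem exists_frame [CompleteSpace A] {D : Set E} (hD : IsOpen D) [SimplyConnectedSpace D]
    (π : E →L[ℝ] ℝ) (e : E) (he : π e = 1) (he1 : ‖e‖ ≤ 1) (hπ : ∀ v, |π v| ≤ ‖v‖) (ξ : E → A)
    (hξ : ContinuousOn ξ D) (hfac : FactorsLocally D π ξ) {p₀ : E} (hp₀ : p₀ ∈ D) :
    ∃ Ψ : E → A, Ψ p₀ = 1 ∧ ∀ p ∈ D,
      HasFDerivAt Ψ (π.smulRight (Ψ p * ξ p)) p ∧ IsUnit (Ψ p) := by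
  classical
  have hloc := fun i : D => exists_local_frame hD π e he he1 hπ ξ hξ hfac i.2
  choose r hr hrD Φ hΦ using hloc
  have : LocallyPathConnectedSpace D := hD.locallyPathConnectedSpace
  let V : D → Set D := fun i => Subtype.val ⁻¹' Metric.ball (i : E) (r i)
  have hV : ∀ i, IsOpen (V i) := fun i => Metric.isOpen_ball.preimage continuous_subtype_val
  -- The default value 1 plays no role: on `V i` the frame `Φ i` takes values in the units.
  let f : D → D → Aˣ := fun i x => if h : IsUnit (Φ i x) then h.unit else 1
  have hfV : ∀ i x, x ∈ V i → (f i x : A) = Φ i x := fun i x hx => by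
    have h : IsUnit (Φ i x) := (hΦ i x hx).2
    simp only [f, dif_pos h, IsUnit.unit_spec]
  have hfinv : ∀ i x, x ∈ V i → ((f i x)⁻¹ : Aˣ) = Ring.inverse (Φ i x) := fun i x hx => by
    rw [← hfV i x hx, Ring.inverse_unit]
  obtain ⟨F, hF0, hF⟩ := exists_global_of_locally_const V hV (fun i => Metric.mem_ball_self (hr i)) f
    (fun i j x hx => by
      filter_upwards [(hV i).mem_nhds hx.1, (hV j).mem_nhds hx.2] with y hyi hyj
      ext
      rw [Units.val_mul, Units.val_mul, hfV i y hyi, hfV i x hx.1, hfinv j y hyj, hfinv j x hx.2]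
      -- The intersection of two balls is convex, hence connected.
      exact mul_inverse_const π (Metric.isOpen_ball.inter Metric.isOpen_ball)
        ((convex_ball (i : E) (r i)).inter (convex_ball (j : E) (r j))).isPreconnected
        (fun p hp => (hΦ i p hp.1).1) (fun p hp => (hΦ j p hp.2).1)
        (fun p hp => (hΦ j p hp.2).2) ⟨hyi, hyj⟩ hx) ⟨p₀, hp₀⟩ 1
  let Ψ : E → A := fun p => if h : p ∈ D then (F ⟨p, h⟩ : A) else 0
  have hΨ : ∀ x : D, Ψ x = F x := fun x => by simp only [Ψ, dif_pos x.2, Subtype.coe_eta]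
  refine ⟨Ψ, ?_, fun p hp => ⟨?_, ?_⟩⟩
  · rw [hΨ ⟨p₀, hp₀⟩, hF0, Units.val_one]
  · set i : D := ⟨p, hp⟩ with hi
    have hpV : i ∈ V i := Metric.mem_ball_self (hr i)
    set c : A := ↑(F i * (f i i)⁻¹) with hc
    have h1 : ∀ᶠ y : D in nhds i, Ψ y = c * Φ i y := by
      filter_upwards [hF i i hpV, (hV i).mem_nhds hpV] with y hy hyV
      rw [hΨ, hc, ← hy, ← hfV i y hyV, ← Units.val_mul, inv_mul_cancel_right]
    have h2 : ∀ᶠ y : E in nhds p, Ψ y = c * Φ i y := by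
      have := hD.isOpenEmbedding_subtypeVal.map_nhds_eq i
      rw [hi] at this
      rw [← this, Filter.eventually_map]
      exact h1
    have h3 := ((hΦ i p hpV).1.const_mul c).congr_of_eventuallyEq h2
    refine h3.congr_fderiv ?_
    ext v
    have h4 : Ψ p = c * Φ i p := h2.self_of_nhds
    simp [h4, mul_assoc]
  · rw [hΨ ⟨p, hp⟩]; exact (F _).isUnit

theorem frame_unique [CompleteSpace A] {D : Set E} (hD : IsOpen D) (hD' : IsPreconnected D)
    (π : E →L[ℝ] ℝ) {ξ Φ Ψ : E → A}
    (hΦ : ∀ p ∈ D, HasFDerivAt Φ (π.smulRight (Φ p * ξ p)) p)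
    (hΨ : ∀ p ∈ D, HasFDerivAt Ψ (π.smulRight (Ψ p * ξ p)) p)
    (hu : ∀ p ∈ D, IsUnit (Ψ p)) {p₀ : E} (hp₀ : p₀ ∈ D) (h0 : Φ p₀ = Ψ p₀) :
    Set.EqOn Φ Ψ D := fun p hp => by
  have h1 := mul_inverse_const π hD hD' hΦ hΨ hu hp hp₀
  rw [h0, Ring.mul_inverse_cancel _ (hu _ hp₀)] at h1
  calc Φ p = Φ p * (Ring.inverse (Ψ p) * Ψ p) := by rw [Ring.inverse_mul_cancel _ (hu _ hp), mul_one]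
    _ = Ψ p := by rw [← mul_assoc, h1, one_mul]

/-- Bootstrapping: by the equation, the derivative of Ψ is as regular as Ψ itself. -/
theorem frame_contDiffOn {D : Set E} (hD : IsOpen D) (π : E →L[ℝ] ℝ) {ξ Ψ : E → A}
    (hξ : ContDiffOn ℝ ∞ ξ D) (hΨ : ∀ p ∈ D, HasFDerivAt Ψ (π.smulRight (Ψ p * ξ p)) p) :
    ContDiffOn ℝ ∞ Ψ D := by
  rw [contDiffOn_infty]
  intro n
  induction n with
  | zero =>
    exact contDiffOn_zero.2 fun p hp => (hΨ p hp).continuousAt.continuousWithinAt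
  | succ n ih =>
    rw [Nat.cast_add, Nat.cast_one, contDiffOn_succ_iff_fderiv_of_isOpen hD]
    refine ⟨fun p hp => (hΨ p hp).differentiableAt.differentiableWithinAt, by simp, ?_⟩
    have h1 : ContDiffOn ℝ n (fun p => Ψ p * ξ p) D := ih.mul (hξ.of_le (by exact_mod_cast le_top))
    have h2 : ContDiffOn ℝ n
        (fun p => ContinuousLinearMap.smulRightL ℝ E A π (Ψ p * ξ p)) D :=
      (ContinuousLinearMap.contDiff _).comp_contDiffOn h1
    exact h2.congr fun p hp => (hΨ p hp).fderiv

end ODE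

/-! ### Splitting of loops near the identity -/

def negPart : Loop →L[ℝ] Loop :=
  coeffMap (fun k => if k < 0 then 1 else 0) 1 (fun k => by split_ifs <;> simp) LinearMap.id

theorem negPart_coeff (ξ : Loop) (k : ℤ) : (negPart ξ) k = if k < 0 then ξ k else 0 := by
  rw [negPart, coeffMap_coeff]
  split_ifs <;> simp

theorem norm_negPart_le (ξ : Loop) : ‖negPart ξ‖ ≤ ‖ξ‖ := by
  exact (norm_coeffMap_id_le (w := fun k : ℤ => if k < 0 then (1 : ℝ) else 0) (B := 1)
    (fun k => by split_ifs <;> simp) ξ).trans_eq (one_mul _)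

theorem negPart_eq_zero_iff (ξ : Loop) : negPart ξ = 0 ↔ PowGE 0 ξ := by
  constructor
  · intro h k hk
    have h1 := negPart_coeff ξ k
    rw [h, if_pos hk] at h1
    exact h1.symm
  · intro h
    refine Loop.ext_coeff fun k => ?_
    rw [negPart_coeff, Loop.zero_coeff]
    split_ifs with hk
    · exact h k hk
    · rfl

theorem negPart_eq_self {ξ : Loop} (h : PowLE (-1) ξ) : negPart ξ = ξ := by
  refine Loop.ext_coeff fun k => ?_
  rw [negPart_coeff]
  split_ifs with hk
  · rfl
  · exact (h k (by omega)).symm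

theorem powLE_negPart (ξ : Loop) : PowLE (-1) (negPart ξ) := fun k hk => by
  rw [negPart_coeff, if_neg (by omega)]

/-- The operator `q ↦ q + (g - 1) q` followed by the projection of the second summand to negative
powers. -/
def toeplitz (g : Loop) : Loop →L[ℝ] Loop :=
  1 + negPart ∘L ContinuousLinearMap.mul ℝ Loop (g - 1)

theorem toeplitz_apply (g q : Loop) : toeplitz g q = q + negPart ((g - 1) * q) := rfl

/-- Neumann series: the projection `negPart` has norm at most 1, so the perturbation of the identity
has norm at most ‖g - 1‖. -/
theorem isUnit_toeplitz {g : Loop} (hg : ‖g - 1‖ < 1) : IsUnit (toeplitz g) := by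
  have h1 : ‖-(negPart ∘L ContinuousLinearMap.mul ℝ Loop (g - 1))‖ < 1 := by
    rw [norm_neg]
    refine lt_of_le_of_lt (ContinuousLinearMap.opNorm_le_bound _ (norm_nonneg (g - 1)) fun q => ?_) hg
    exact (norm_negPart_le _).trans (norm_mul_le (g - 1) q)
  have h2 := isUnit_one_sub_of_norm_lt_one h1
  rwa [sub_neg_eq_add] at h2

/-- The factor `Q` with negative powers and constant term `1` for which `g Q` has powers `k ≥ 0`
only. -/
def minusFactor (g : Loop) : Loop := 1 - Ring.inverse (toeplitz g) (negPart (g - 1))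

theorem toeplitz_minusFactor {g : Loop} (hg : ‖g - 1‖ < 1) :
    toeplitz g (minusFactor g - 1) = -negPart (g - 1) := by
  have h1 := Ring.mul_inverse_cancel _ (isUnit_toeplitz hg)
  rw [minusFactor, sub_sub_cancel_left, map_neg, neg_inj]
  exact congrArg (fun T : Loop →L[ℝ] Loop => T (negPart (g - 1))) h1

/-- The negative part of g(1 + q) = 1 + (g - 1) + q + (g - 1)q is affine in q, so Birkhoff
factorization becomes a linear equation. -/
theorem toeplitz_eq_iff {g q : Loop} (hq : PowLE (-1) q) :
    toeplitz g q = -negPart (g - 1) ↔ PowGE 0 (g * (1 + q)) := by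
  have h1 : g * (1 + q) = 1 + (g - 1) + q + (g - 1) * q := by noncomm_ring
  rw [← negPart_eq_zero_iff, h1, map_add, map_add, map_add, negPart_eq_self hq,
    (negPart_eq_zero_iff 1).2 powGE_one, toeplitz_apply, zero_add, add_assoc,
    add_comm (negPart (g - 1)), eq_neg_iff_add_eq_zero]

/-- The operator is inverted on all loops, yet the solution has negative powers only, because the
equation exhibits it as a value of `negPart`. -/
theorem powLE_minusFactor_sub {g : Loop} (hg : ‖g - 1‖ < 1) : PowLE (-1) (minusFactor g - 1) := by
  have h1 := toeplitz_minusFactor hg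
  rw [toeplitz_apply] at h1
  have h2 : minusFactor g - 1
      = negPart (-(g - 1) - (g - 1) * (minusFactor g - 1)) := by
    rw [map_sub, map_neg, ← h1, add_sub_cancel_right]
  rw [h2]
  exact powLE_negPart _

theorem powGE_mul_minusFactor {g : Loop} (hg : ‖g - 1‖ < 1) : PowGE 0 (g * minusFactor g) := by
  have h1 := (toeplitz_eq_iff (powLE_minusFactor_sub hg)).1 (toeplitz_minusFactor hg)
  rwa [add_sub_cancel] at h1

theorem minusFactor_unique {g q : Loop} (hg : ‖g - 1‖ < 1) (hq : PowLE (-1) q)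
    (h : PowGE 0 (g * (1 + q))) : minusFactor g = 1 + q := by
  have h1 : toeplitz g (minusFactor g - 1) = toeplitz g q :=
    (toeplitz_minusFactor hg).trans ((toeplitz_eq_iff hq).2 h).symm
  have h2 := Ring.inverse_mul_cancel _ (isUnit_toeplitz hg)
  have h3 := congrArg (fun x => (Ring.inverse (toeplitz g) : Loop →L[ℝ] Loop) x) h1
  have h4 : ∀ x, Ring.inverse (toeplitz g) (toeplitz g x) = x := fun x =>
    congrArg (fun T : Loop →L[ℝ] Loop => T x) h2
  rw [h4, h4] at h3
  rw [← h3, add_sub_cancel]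

theorem powLE_minusFactor {g : Loop} (hg : ‖g - 1‖ < 1) :
    PowLE 0 (minusFactor g) ∧ (minusFactor g) 0 = 1 := by
  have h1 : ∀ k : ℤ, (minusFactor g) k = (minusFactor g - 1) k + (1 : Loop) k := fun k => by
    rw [← Loop.add_coeff, sub_add_cancel]
  have h2 := powLE_minusFactor_sub hg
  constructor
  · intro k hk
    rw [h1, h2 k (by omega), powLE_one k hk, add_zero]
  · rw [h1, h2 0 (by omega), Loop.one_coeff', if_pos rfl, zero_add]

theorem mul_adj_of_mul {g Q : Loop} (hg : g * Loop.adj g = 1) :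
    (g * Q) * Loop.adj (g * Q) = Q * Loop.adj Q := by
  refine Loop.ext_eval fun z hz => ?_
  have h1 := (Loop.det_eval_eq_one_iff g).2 hg z hz
  simp only [Loop.eval_mul_of_norm _ _ hz, Loop.eval_adj _ hz, Matrix.mul_adjugate,
    Matrix.det_mul, h1, one_mul]

/-- Let Q be the factor. Its determinant has powers ≤ 0 and constant term 1, and it equals det(gQ),
which has powers ≥ 0; so it is 1. The twist of Q solves the same factorization problem, because g is
twisted, and uniqueness gives that Q is twisted. -/
theorem minusFactor_mem {g : Loop} (hg : g ∈ loopGroup) (hg1 : ‖g - 1‖ < 1) :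
    minusFactor g ∈ loopGroupMinusStar ∧ g * minusFactor g ∈ loopGroupPlus := by
  obtain ⟨h1, h2⟩ := powLE_minusFactor hg1
  have h3 := powGE_mul_minusFactor hg1
  have h4 : minusFactor g * Loop.adj (minusFactor g) = 1 := by
    refine Loop.eq_one_of_pow ?_ ?_ ?_
    · simpa using h1.mul h1.adj
    · rw [← mul_adj_of_mul (mul_adj_self hg)]
      simpa using h3.mul h3.adj
    · have := h1.mul_coeff h1.adj
      rw [add_zero] at this
      rw [this, Loop.adj_coeff, h2, Matrix.adjugate_one, one_mul]
  have ht := ((mem_loopGroup_iff g).1 hg).2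
  have h5 : Loop.twist (minusFactor g) = minusFactor g := by
    have h6 : minusFactor g = 1 + Loop.twist (minusFactor g - 1) := by
      refine minusFactor_unique hg1 ?_ ?_
      · intro k hk
        rw [Loop.twist_coeff, powLE_minusFactor_sub hg1 k hk, sigma_eq, mul_zero, zero_mul,
          smul_zero]
      · rw [map_sub, Loop.twist_one, add_sub_cancel]
        nth_rw 1 [← ht]
        rw [← Loop.twist_mul]
        intro k hk
        rw [Loop.twist_coeff, h3 k hk, sigma_eq, mul_zero, zero_mul, smul_zero]
    nth_rw 2 [h6]
    rw [map_sub, Loop.twist_one, add_sub_cancel]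
  have h6 : minusFactor g ∈ loopGroup := (mem_loopGroup_iff _).2 ⟨h4, h5⟩
  exact ⟨⟨h6, h1, h2⟩, mul_mem_loopGroup hg h6, h3⟩

/-- `toeplitz` is affine in g, and inversion is smooth on the units of the algebra of bounded
operators. -/
theorem contDiffAt_minusFactor {g : Loop} (hg : ‖g - 1‖ < 1) :
    ContDiffAt ℝ ∞ minusFactor g := by
  have h1 : ContDiff ℝ ∞ toeplitz := by
    have h2 : ContDiff ℝ ∞ fun g : Loop =>
        ContinuousLinearMap.compL ℝ Loop Loop Loop negPart
          (ContinuousLinearMap.mul ℝ Loop (g - 1)) :=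
      (ContinuousLinearMap.contDiff _).comp
        ((ContinuousLinearMap.contDiff _).comp (contDiff_id.sub contDiff_const))
    exact contDiff_const.add h2
  obtain ⟨u, hu⟩ := isUnit_toeplitz hg
  have h3 : ContDiffAt ℝ ∞ (fun g => Ring.inverse (toeplitz g)) g :=
    ContDiffAt.comp (g := Ring.inverse) g (by rw [← hu]; exact contDiffAt_ringInverse ℝ u)
      h1.contDiffAt
  have h4 : ContDiffAt ℝ ∞ (fun g : Loop => negPart (g - 1)) g :=
    (ContinuousLinearMap.contDiff _).contDiffAt.comp g (contDiffAt_id.sub contDiffAt_const)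
  exact contDiffAt_const.sub (h3.clm_apply h4)

/-! ### Iwasawa splittings -/

/-- The loop Ψ'⁻¹Ψ equals both M'M⁻¹ and N'N⁻¹. It therefore lies in the normalized minus group and
in the plus group, and so it is 1. -/
theorem IsIwasawa.unique {g h Ψ M N Ψ' M' N' : Loop} (H : IsIwasawa g h Ψ M N)
    (H' : IsIwasawa g h Ψ' M' N') : Ψ = Ψ' ∧ M = M' ∧ N = N' := by
  have e1 : Ψ * M = Ψ' * M' := H.fst_eq.symm.trans H'.fst_eq
  have e2 : Ψ * N = Ψ' * N' := H.snd_eq.symm.trans H'.snd_eq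
  have key : ∀ {X X' : Loop}, X ∈ loopGroup → Ψ * X = Ψ' * X' →
      X' * Loop.adj X = Loop.adj Ψ' * Ψ := fun {X X'} hX h => by
    calc X' * Loop.adj X = (Loop.adj Ψ' * Ψ') * X' * Loop.adj X := by
          rw [adj_mul_self H'.mem, one_mul]
      _ = Loop.adj Ψ' * (Ψ * X) * Loop.adj X := by rw [h]; noncomm_ring
      _ = Loop.adj Ψ' * Ψ * (X * Loop.adj X) := by noncomm_ring
      _ = Loop.adj Ψ' * Ψ := by rw [mul_adj_self hX, mul_one]
  have k1 := key H.minus.1 e1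
  have k2 := key H.plus.1 e2
  have m1 := mul_mem_minus H'.minus (adj_mem_minus H.minus)
  have m2 := mul_mem_plus H'.plus (adj_mem_plus H.plus)
  rw [k1] at m1
  rw [k2] at m2
  have h1 : Loop.adj Ψ' * Ψ = 1 := Loop.eq_one_of_pow m1.2.1 m2.2 m1.2.2
  have cancel : ∀ {X X' : Loop}, Loop.adj X * X = 1 → X' * Loop.adj X = 1 → X = X' :=
    fun {X X'} ha hb => by
      calc X = X' * Loop.adj X * X := by rw [hb, one_mul]
        _ = X' := by rw [mul_assoc, ha, mul_one]
  refine ⟨?_, cancel (adj_mul_self H.minus.1) (k1.trans h1),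
    cancel (adj_mul_self H.plus.1) (k2.trans h1)⟩
  calc Ψ = Ψ' * Loop.adj Ψ' * Ψ := by rw [mul_adj_self H'.mem, one_mul]
    _ = Ψ' := by rw [mul_assoc, h1, mul_one]

theorem isIwasawa_one : IsIwasawa 1 1 1 1 1 :=
  ⟨one_mem_loopGroup, one_mem_minus, one_mem_plus, (mul_one (1 : Loop)).symm,
    (mul_one (1 : Loop)).symm⟩

/-- Pairs near a pair that splits split as well. -/
theorem IsIwasawa.near {g₀ h₀ Ψ₀ M₀ N₀ g h : Loop} (H : IsIwasawa g₀ h₀ Ψ₀ M₀ N₀)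
    (hg : g ∈ loopGroup) (hh : h ∈ loopGroup) (K : Loop)
    (hK : K = N₀ * Loop.adj h * g * Loop.adj M₀) (hK1 : ‖K - 1‖ < 1) :
    IsIwasawa g h (g * Loop.adj M₀ * minusFactor K) (Loop.adj (minusFactor K) * M₀)
      (Loop.adj (K * minusFactor K) * N₀) := by
  have hKm : K ∈ loopGroup := by
    rw [hK]
    exact mul_mem_loopGroup (mul_mem_loopGroup (mul_mem_loopGroup H.plus.1 (adj_mem_loopGroup hh))
      hg) (adj_mem_loopGroup H.minus.1)
  -- With Q = `minusFactor K` and P = KQ, the relation N₀h⁻¹gM₀⁻¹Q = P says that gM₀⁻¹Q = hN₀⁻¹P.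
  -- This common loop is the new Ψ; the new factors are Q⁻¹M₀ and P⁻¹N₀.
  obtain ⟨h1, h2⟩ := minusFactor_mem hKm hK1
  have hcl : ∀ {γ : Loop}, γ ∈ loopGroup → ∀ x, γ * (Loop.adj γ * x) = x := fun hγ x => by
    rw [← mul_assoc, mul_adj_self hγ, one_mul]
  have hcl' : ∀ {γ : Loop}, γ ∈ loopGroup → ∀ x, Loop.adj γ * (γ * x) = x := fun hγ x => by
    rw [← mul_assoc, adj_mul_self hγ, one_mul]
  refine ⟨mul_mem_loopGroup (mul_mem_loopGroup hg (adj_mem_loopGroup H.minus.1)) h1.1,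
    mul_mem_minus (adj_mem_minus h1) H.minus, mul_mem_plus (adj_mem_plus h2) H.plus, ?_, ?_⟩
  · show g = g * Loop.adj M₀ * minusFactor K * (Loop.adj (minusFactor K) * M₀)
    rw [mul_assoc (g * Loop.adj M₀), hcl h1.1, mul_assoc, adj_mul_self H.minus.1, mul_one]
  · show h = g * Loop.adj M₀ * minusFactor K * (Loop.adj (K * minusFactor K) * N₀)
    rw [Loop.adj_mul, mul_assoc (g * Loop.adj M₀), mul_assoc (Loop.adj (minusFactor K)),
      hcl h1.1, hK]
    simp only [Loop.adj_mul, Loop.adj_adj, mul_assoc]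
    rw [hcl' H.minus.1, hcl hg, adj_mul_self H.plus.1, mul_one]

theorem IsIwasawa.coefficient_eq_one {g₀ h₀ Ψ₀ M₀ N₀ : Loop} (H : IsIwasawa g₀ h₀ Ψ₀ M₀ N₀) :
    N₀ * Loop.adj h₀ * g₀ * Loop.adj M₀ = 1 := by
  have e1 : g₀ = Ψ₀ * M₀ := H.fst_eq
  have e2 : h₀ = Ψ₀ * N₀ := H.snd_eq
  rw [e1, e2, Loop.adj_mul]
  calc N₀ * (Loop.adj N₀ * Loop.adj Ψ₀) * (Ψ₀ * M₀) * Loop.adj M₀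
      = (N₀ * Loop.adj N₀) * (Loop.adj Ψ₀ * Ψ₀) * (M₀ * Loop.adj M₀) := by noncomm_ring
    _ = 1 := by
      rw [mul_adj_self H.plus.1, adj_mul_self H.mem, mul_adj_self H.minus.1, one_mul, one_mul]

/-- No regularity of Ψ, M, N is presupposed. Near p₀, uniqueness identifies M and N with the factors
built in `IsIwasawa.near`, which are smooth in K; and K = 1 at p₀. -/
theorem IsIwasawa.contDiffOn {E : Type*} [NormedAddCommGroup E] [NormedSpace ℝ E] {U : Set E}
    (hU : IsOpen U) {g h Ψ M N : E → Loop} (hg : ContDiffOn ℝ ∞ g U) (hh : ContDiffOn ℝ ∞ h U)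
    (hgm : ∀ p ∈ U, g p ∈ loopGroup) (hhm : ∀ p ∈ U, h p ∈ loopGroup)
    (H : ∀ p ∈ U, IsIwasawa (g p) (h p) (Ψ p) (M p) (N p)) :
    ContDiffOn ℝ ∞ M U ∧ ContDiffOn ℝ ∞ N U := by
  have key : ∀ p₀ ∈ U, ContDiffAt ℝ ∞ M p₀ ∧ ContDiffAt ℝ ∞ N p₀ := by
    intro p₀ hp₀
    set K : E → Loop := fun p => N p₀ * Loop.adj (h p) * g p * Loop.adj (M p₀) with hKdef
    have hKd : ContDiffAt ℝ ∞ K p₀ := by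
      have h1 := hg.contDiffAt (hU.mem_nhds hp₀)
      have h2 := hh.contDiffAt (hU.mem_nhds hp₀)
      have h3 : ContDiffAt ℝ ∞ (fun p => Loop.adj (h p)) p₀ :=
        (ContinuousLinearMap.contDiff Loop.adj).contDiffAt.comp p₀ h2
      exact ((contDiffAt_const.mul h3).mul h1).mul contDiffAt_const
    have hK0 : K p₀ = 1 := (H p₀ hp₀).coefficient_eq_one
    have hnear : ∀ᶠ p in nhds p₀, ‖K p - 1‖ < 1 := by
      have h1 : ContinuousAt (fun p => ‖K p - 1‖) p₀ :=
        (hKd.continuousAt.sub continuousAt_const).norm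
      refine h1.eventually_lt continuousAt_const ?_
      simp [hK0]
    have hev : ∀ᶠ p in nhds p₀, M p = Loop.adj (minusFactor (K p)) * M p₀ ∧
        N p = Loop.adj (K p * minusFactor (K p)) * N p₀ := by
      filter_upwards [hnear, hU.mem_nhds hp₀] with p hp hpU
      exact ((H p hpU).unique ((H p₀ hp₀).near (hgm p hpU) (hhm p hpU) (K p) rfl hp)).2
    have hQ : ContDiffAt ℝ ∞ (fun p => minusFactor (K p)) p₀ :=
      (contDiffAt_minusFactor (by simp [hK0])).comp p₀ hKd
    have hadj : ∀ {f : E → Loop}, ContDiffAt ℝ ∞ f p₀ →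
        ContDiffAt ℝ ∞ (fun p => Loop.adj (f p)) p₀ := fun hf =>
      (ContinuousLinearMap.contDiff Loop.adj).contDiffAt.comp p₀ hf
    exact ⟨((hadj hQ).mul contDiffAt_const).congr_of_eventuallyEq (hev.mono fun p hp => hp.1),
      ((hadj (hKd.mul hQ)).mul contDiffAt_const).congr_of_eventuallyEq
        (hev.mono fun p hp => hp.2)⟩
  exact ⟨fun p hp => (key p hp).1.contDiffWithinAt, fun p hp => (key p hp).2.contDiffWithinAt⟩

/-! ### Dilations of loops -/

/-- `η` is the loop `λ ↦ ξ(sλ)`. -/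
def IsDil (s : ℝ) (ξ η : Loop) : Prop := ∀ k : ℤ, η k = s ^ k • ξ k

theorem IsDil.unique {s : ℝ} {ξ η η' : Loop} (h : IsDil s ξ η) (h' : IsDil s ξ η') : η = η' :=
  Loop.ext_coeff fun k => (h k).trans (h' k).symm

theorem IsDil.mul {s : ℝ} (hs : s ≠ 0) {ξ η ξ' η' : Loop} (h : IsDil s ξ η) (h' : IsDil s ξ' η') :
    IsDil s (ξ * ξ') (η * η') := fun n => by
  rw [Loop.mul_coeff', Loop.mul_coeff', ← (ξ.summable_conv ξ' n).tsum_const_smul]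
  refine tsum_congr fun k => ?_
  rw [h, h', smul_mul_smul_comm, ← zpow_add₀ hs, add_sub_cancel]

theorem isDil_one (s : ℝ) : IsDil s 1 1 := fun k => by
  rw [Loop.one_coeff']
  split_ifs with h
  · rw [h, zpow_zero, one_smul]
  · rw [smul_zero]

theorem IsDil.adj {s : ℝ} {ξ η : Loop} (h : IsDil s ξ η) : IsDil s (Loop.adj ξ) (Loop.adj η) :=
  fun k => by rw [Loop.adj_coeff, Loop.adj_coeff, h k, ← adjLin_apply, map_smul, adjLin_apply]

theorem IsDil.add {s : ℝ} {ξ η ξ' η' : Loop} (h : IsDil s ξ η) (h' : IsDil s ξ' η') :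
    IsDil s (ξ + ξ') (η + η') := fun k => by
  rw [Loop.add_coeff, Loop.add_coeff, h k, h' k, smul_add]

theorem isDil_monomial (s : ℝ) (k : ℤ) (X : M2) :
    IsDil s (Loop.monomial k X) (Loop.monomial k (s ^ k • X)) := fun n => by
  rw [Loop.monomial_coeff, Loop.monomial_coeff]
  split_ifs with h
  · rw [h]
  · rw [smul_zero]

/-- The graph of the dilation by `s`, a closed subalgebra of `Loop × Loop`. -/
def dilAlgebra (s : ℝ) (hs : s ≠ 0) : Subalgebra ℝ (Loop × Loop) where
  carrier := {q | IsDil s q.1 q.2}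
  mul_mem' h h' := IsDil.mul hs h h'
  add_mem' h h' := IsDil.add h h'
  algebraMap_mem' c := fun k => by
    rw [Algebra.algebraMap_eq_smul_one]
    show c • (1 : Loop) k = s ^ k • (c • (1 : Loop) k)
    rw [smul_comm, ← isDil_one s k]

theorem isClosed_dilAlgebra (s : ℝ) (hs : s ≠ 0) :
    IsClosed (dilAlgebra s hs : Set (Loop × Loop)) := by
  have h : (dilAlgebra s hs : Set (Loop × Loop)) = ⋂ k : ℤ,
      {q : Loop × Loop | coeffCLM k q.2 = s ^ k • coeffCLM k q.1} := by
    ext q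
    simp only [Set.mem_iInter]
    exact Iff.rfl
  rw [h]
  refine isClosed_iInter fun k => isClosed_eq ?_ ?_
  · exact (coeffCLM k).continuous.comp continuous_snd
  · exact ((coeffCLM k).continuous.comp continuous_fst).const_smul (s ^ k)

section DilFrame

variable {E : Type*} [NormedAddCommGroup E] [NormedSpace ℝ E]

theorem FactorsLocally.dil {D : Set E} {π : E →L[ℝ] ℝ} {s : ℝ} {ξ ξ' : E → Loop}
    (h : FactorsLocally D π ξ) (hd : ∀ p ∈ D, IsDil s (ξ p) (ξ' p)) : FactorsLocally D π ξ' :=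
  fun p q hpq hπ => Loop.ext_coeff fun k => by
    rw [hd p (hpq (left_mem_segment ℝ p q)) k, hd q (hpq (right_mem_segment ℝ p q)) k,
      h p q hpq hπ]

/-- The frame of a potential with values in a closed subalgebra has values in it. -/
theorem exists_frame_mem {A : Type*} [NormedRing A] [NormedAlgebra ℝ A] [CompleteSpace A]
    (S : Subalgebra ℝ A) (hS : IsClosed (S : Set A)) {D : Set E} (hD : IsOpen D)
    [SimplyConnectedSpace D] (π : E →L[ℝ] ℝ) (e : E) (he : π e = 1) (he1 : ‖e‖ ≤ 1)
    (hπ : ∀ v, |π v| ≤ ‖v‖) (ξ : E → A) (hξ : ContinuousOn ξ D) (hfac : FactorsLocally D π ξ)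
    (hmem : ∀ p ∈ D, ξ p ∈ S) {p₀ : E} (hp₀ : p₀ ∈ D) :
    ∃ Ψ : E → A, Ψ p₀ = 1 ∧ ∀ p ∈ D,
      HasFDerivAt Ψ (π.smulRight (Ψ p * ξ p)) p ∧ IsUnit (Ψ p) ∧ Ψ p ∈ S := by
  classical
  -- A closed subalgebra is itself a Banach algebra, so the equation can be solved inside it.
  have : CompleteSpace S := hS.isComplete.completeSpace_coe
  let ζ : E → S := fun p => if h : p ∈ D then ⟨ξ p, hmem p h⟩ else 0
  have hζ : ∀ p (h : p ∈ D), (ζ p : A) = ξ p := fun p h => by simp only [ζ, dif_pos h]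
  have hζc : ContinuousOn ζ D := by
    rw [Topology.IsInducing.subtypeVal.continuousOn_iff]
    exact hξ.congr fun p hp => hζ p hp
  have hζf : FactorsLocally D π ζ := fun p q hpq hpi => by
    refine Subtype.ext ?_
    rw [hζ p (hpq (left_mem_segment ℝ p q)), hζ q (hpq (right_mem_segment ℝ p q)),
      hfac p q hpq hpi]
  obtain ⟨Φ, hΦ0, hΦ⟩ := exists_frame hD π e he he1 hπ ζ hζc hζf hp₀
  refine ⟨fun p => (Φ p : A), congrArg Subtype.val hΦ0, fun p hp => ⟨?_, (hΦ p hp).2.map S.val, (Φ p).2⟩⟩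
  let L : S →L[ℝ] A := S.toSubmodule.subtypeL
  refine (L.hasFDerivAt.comp p (hΦ p hp).1).congr_fderiv ?_
  ext v
  show ((π v • (Φ p * ζ p) : S) : A) = π v • ((Φ p : A) * ξ p)
  rw [← hζ p hp]; rfl

/-- The dilation of the potential integrates to the dilation of the frame. -/
theorem exists_dil_frame {D : Set E} (hD : IsOpen D) [SimplyConnectedSpace D] (π : E →L[ℝ] ℝ)
    (e : E) (he : π e = 1) (he1 : ‖e‖ ≤ 1) (hπ : ∀ v, |π v| ≤ ‖v‖) {s : ℝ} (hs : s ≠ 0)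
    {ξ ξ' Ψ : E → Loop} (hξ : ContinuousOn ξ D) (hξ' : ContinuousOn ξ' D)
    (hfac : FactorsLocally D π ξ) (hd : ∀ p ∈ D, IsDil s (ξ p) (ξ' p)) {p₀ : E} (hp₀ : p₀ ∈ D)
    (hΨ : ∀ p ∈ D, HasFDerivAt Ψ (π.smulRight (Ψ p * ξ p)) p) (h0 : Ψ p₀ = 1) :
    ∃ Ψ' : E → Loop, (∀ p ∈ D, HasFDerivAt Ψ' (π.smulRight (Ψ' p * ξ' p)) p) ∧
      ∀ p ∈ D, IsDil s (Ψ p) (Ψ' p) := by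
  have hconn : IsPreconnected D := isPreconnected_iff_preconnectedSpace.2 inferInstance
  -- Dilation is in general unbounded and cannot be applied to the frame directly. The pair (ξ, ξ')
  -- is integrated in the graph of the dilation instead; by uniqueness the first component is Ψ, so
  -- the second is its dilation.
  obtain ⟨Φ, hΦ0, hΦ⟩ := exists_frame_mem (dilAlgebra s hs) (isClosed_dilAlgebra s hs) hD π e he
    he1 hπ (fun p => (ξ p, ξ' p)) (hξ.prodMk hξ')
    (fun p q hpq hpi => Prod.ext (hfac p q hpq hpi) (hfac.dil hd p q hpq hpi)) hd hp₀
  have h1 : ∀ p ∈ D, HasFDerivAt (fun p => (Φ p).1) (π.smulRight ((Φ p).1 * ξ p)) p :=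
    fun p hp => ((ContinuousLinearMap.fst ℝ Loop Loop).hasFDerivAt.comp p (hΦ p hp).1).congr_fderiv
      (by ext1 v; rfl)
  have h2 : ∀ p ∈ D, HasFDerivAt (fun p => (Φ p).2) (π.smulRight ((Φ p).2 * ξ' p)) p :=
    fun p hp => ((ContinuousLinearMap.snd ℝ Loop Loop).hasFDerivAt.comp p (hΦ p hp).1).congr_fderiv
      (by ext1 v; rfl)
  have hu : ∀ p ∈ D, IsUnit (Φ p).1 := fun p hp =>
    (hΦ p hp).2.1.map (RingHom.fst Loop Loop)
  have heq := frame_unique hD hconn π hΨ h1 hu hp₀ (by rw [h0, hΦ0]; rfl)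
  refine ⟨fun p => (Φ p).2, h2, fun p hp => ?_⟩
  rw [heq hp]
  exact (hΦ p hp).2.2

/-- A segment on which π is constant has its direction in the kernel of π, so ξ has derivative zero
along it. -/
theorem factorsLocally_of_fderiv {F : Type*} [NormedAddCommGroup F] [NormedSpace ℝ F] {D : Set E}
    (hD : IsOpen D) (π : E →L[ℝ] ℝ) {ξ : E → F} (hξ : DifferentiableOn ℝ ξ D)
    (h : ∀ p ∈ D, ∀ v, π v = 0 → fderiv ℝ ξ p v = 0) : FactorsLocally D π ξ := by
  intro p q hpq hπ
  have hseg : ∀ t ∈ Set.Icc (0 : ℝ) 1, p + t • (q - p) ∈ D := fun t ht =>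
    hpq (segment_eq_image' ℝ p q ▸ Set.mem_image_of_mem _ ht)
  have hd : ∀ t ∈ Set.Icc (0 : ℝ) 1, HasDerivAt (fun t : ℝ => ξ (p + t • (q - p))) 0 t := by
    intro t ht
    have h1 : HasDerivAt (fun t : ℝ => p + t • (q - p)) (q - p) t := by
      simpa using ((hasDerivAt_id t).smul_const (q - p)).const_add p
    have h2 := ((hξ _ (hseg t ht)).differentiableAt (hD.mem_nhds (hseg t ht))).hasFDerivAt
    have h3 := h2.comp_hasDerivAt t h1
    rwa [h _ (hseg t ht) _ (by rw [map_sub, hπ, sub_self])] at h3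
  have h1 := constant_of_has_deriv_right_zero
    (fun t ht => (hd t ht).continuousAt.continuousWithinAt)
    (fun t ht => (hd t (Set.Ico_subset_Icc_self ht)).hasDerivWithinAt) 1 ⟨zero_le_one, le_rfl⟩
  simpa using h1.symm

end DilFrame

/-! ### Dilations which are bounded on a half line of powers -/

/-- Cutting off the weights larger than |B| gives an operator bounded on all loops, which is the
true dilation on loops without the affected powers. -/
def boundedDil (s B : ℝ) : Loop →L[ℝ] Loop :=
  coeffMap (fun k : ℤ => if |s ^ k| ≤ |B| then s ^ k else 0) |B|
    (fun k => by split_ifs with h; exacts [h, by simp]) LinearMap.id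

theorem isDil_boundedDil {s B : ℝ} {ξ : Loop} (h : ∀ k : ℤ, ξ k ≠ 0 → |s ^ k| ≤ |B|) :
    IsDil s ξ (boundedDil s B ξ) := fun k => by
  rw [boundedDil, coeffMap_coeff]
  by_cases h0 : ξ k = 0
  · rw [h0]; simp
  · rw [if_pos (h k h0)]; rfl

theorem isDil_boundedDil_of_powLE {s : ℝ} (hs : 1 ≤ s) {ξ : Loop} (h : PowLE 1 ξ) :
    IsDil s ξ (boundedDil s s ξ) := isDil_boundedDil fun k hk => by
  have h1 : k ≤ 1 := not_lt.1 fun hlt => hk (h k hlt)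
  have h2 : (0 : ℝ) < s := by linarith
  rw [abs_of_pos (zpow_pos h2 k), abs_of_pos h2]
  simpa using zpow_le_zpow_right₀ hs h1

theorem isDil_boundedDil_of_powGE {s : ℝ} (hs0 : 0 < s) (hs : s ≤ 1) {ξ : Loop}
    (h : PowGE (-1) ξ) : IsDil s ξ (boundedDil s s⁻¹ ξ) := isDil_boundedDil fun k hk => by
  have h1 : -1 ≤ k := not_lt.1 fun hlt => hk (h k hlt)
  rw [abs_of_pos (zpow_pos hs0 k), abs_of_pos (inv_pos.2 hs0), ← zpow_neg_one]
  exact zpow_le_zpow_right_of_le_one₀ hs0 hs h1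

/-! ### Analytic loops -/

/-- A loop whose dilations are all absolutely convergent extends to the punctured plane. -/
theorem extendsAnalytically_of_isDil {γ : Loop} (h : ∀ s : ℝ, 0 < s → ∃ η, IsDil s γ η) :
    ExtendsAnalytically γ := by
  refine ⟨fun z => Matrix.of fun i j => ∑' k : ℤ, z ^ k * ((γ k i j : ℝ) : ℂ), fun i j => ?_,
    fun z hz => ?_⟩
  · have hsum : ∀ s : ℝ, 0 < s → Summable fun k : ℤ => s ^ k * ‖((γ k i j : ℝ) : ℂ)‖ := by
      intro s hs
      obtain ⟨η, hη⟩ := h s hs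
      refine (η.summable_entry i j).congr fun k => ?_
      rw [hη k, Matrix.smul_apply, smul_eq_mul, Complex.ofReal_mul, norm_mul, Complex.norm_real,
        Real.norm_of_nonneg (zpow_pos hs k).le]
    intro z₀ hz₀
    have hz₀' : 0 < ‖z₀‖ := norm_pos_iff.2 hz₀
    set U : Set ℂ := {z | ‖z₀‖ / 2 < ‖z‖ ∧ ‖z‖ < 2 * ‖z₀‖} with hU
    have hUo : IsOpen U :=
      (isOpen_lt continuous_const continuous_norm).inter (isOpen_lt continuous_norm continuous_const)
    have hzU : z₀ ∈ U := ⟨by linarith, by linarith⟩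
    have hdiff : DifferentiableOn ℂ (fun z => ∑' k : ℤ, z ^ k * ((γ k i j : ℝ) : ℂ)) U := by
      -- On the annulus |z|^k is at most (2‖z₀‖)^k for k ≥ 0 and at most (‖z₀‖/2)^k for k ≤ 0, so
      -- the sum of the two is a majorant for every k.
      refine Complex.differentiableOn_tsum_of_summable_norm
        ((hsum (2 * ‖z₀‖) (by positivity)).add (hsum (‖z₀‖ / 2) (by positivity)))
        (fun k => ?_) hUo (fun k z hz => ?_)
      · intro z hz
        have hz0 : z ≠ 0 := norm_pos_iff.1 (by linarith [hz.1])
        exact ((differentiableAt_zpow.2 (Or.inl hz0)).mul_const _).differentiableWithinAt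
      · rw [norm_mul, norm_zpow, ← add_mul]
        refine mul_le_mul_of_nonneg_right ?_ (norm_nonneg _)
        have hp : 0 < ‖z‖ := by linarith [hz.1]
        rcases le_total 0 k with hk | hk
        · exact (zpow_le_zpow_left₀ hk hp.le hz.2.le).trans
            (le_add_of_nonneg_right (zpow_pos (by positivity) k).le)
        · refine le_trans ?_ (le_add_of_nonneg_left (zpow_pos (by positivity) k).le)
          have h1 : (‖z₀‖ / 2) ^ (-k) ≤ ‖z‖ ^ (-k) :=
            zpow_le_zpow_left₀ (by omega) (by positivity) hz.1.le
          rw [zpow_neg, zpow_neg] at h1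
          exact (inv_le_inv₀ (zpow_pos (by positivity) k) (zpow_pos hp k)).1 h1
    exact ((hdiff z₀ hzU).differentiableAt (hUo.mem_nhds hzU)).differentiableWithinAt
  · ext i j
    rw [γ.eval_apply hz]
    rfl

theorem ExtendsAnalytically.mul {γ δ : Loop} (h : ExtendsAnalytically γ)
    (h' : ExtendsAnalytically δ) : ExtendsAnalytically (γ * δ) := by
  obtain ⟨F, hF, hF1⟩ := h
  obtain ⟨G, hG, hG1⟩ := h'
  refine ⟨fun z => F z * G z, fun i j => ?_, fun z hz => ?_⟩
  · simp only [Matrix.mul_apply, Fin.sum_univ_two]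
    exact ((hF i 0).mul (hG 0 j)).add ((hF i 1).mul (hG 1 j))
  · show F z * G z = _
    rw [Loop.eval_mul_of_norm _ _ hz, hF1 z hz, hG1 z hz]

theorem ExtendsAnalytically.adj {γ : Loop} (h : ExtendsAnalytically γ) :
    ExtendsAnalytically (Loop.adj γ) := by
  obtain ⟨F, hF, hF1⟩ := h
  refine ⟨fun z => (F z).adjugate, fun i j => ?_, fun z hz => ?_⟩
  · simp only [Matrix.adjugate_fin_two]
    fin_cases i <;> fin_cases j
    · exact hF 1 1
    · exact (hF 0 1).neg
    · exact (hF 1 0).neg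
    · exact hF 0 0
  · show (F z).adjugate = _
    rw [Loop.eval_adj _ hz, hF1 z hz]

/-- The Cauchy estimate for the coefficients of a loop which extends to the punctured plane. -/
theorem norm_coeff_le_of_extension {γ : Loop} {F : ℂ → ℂ} (i j : Fin 2)
    (hF : DifferentiableOn ℂ F {0}ᶜ) (hF1 : ∀ z : ℂ, ‖z‖ = 1 → F z = γ.eval z i j) {ρ C : ℝ}
    (hρ : 0 < ρ) (hC : ∀ z : ℂ, ‖z‖ = ρ → ‖F z‖ ≤ C) (k : ℤ) : ρ ^ k * |γ k i j| ≤ C := by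
  have hdiff : DifferentiableOn ℂ (fun z => z ^ (-k - 1) * F z) {0}ᶜ := fun z hz =>
    ((differentiableAt_zpow.2 (Or.inl hz)).differentiableWithinAt).mul (hF z hz)
  -- The integrand is holomorphic off 0, so the circle of radius ρ can be moved to the unit circle,
  -- where the integral gives the coefficient of γ.
  have hindep : ∀ r R : ℝ, 0 < r → r ≤ R → (∮ z in C(0, R), z ^ (-k - 1) * F z)
      = ∮ z in C(0, r), z ^ (-k - 1) * F z := by
    intro r R hr hrR
    refine Complex.circleIntegral_eq_of_differentiable_on_annulus_off_countable hr hrR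
      Set.countable_empty (hdiff.continuousOn.mono fun z hz => ?_) (fun z hz => ?_)
    · rintro rfl
      exact hz.2 (Metric.mem_ball_self hr)
    · have hz0 : z ∈ ({0}ᶜ : Set ℂ) := by
        rintro rfl
        exact hz.1.2 (Metric.mem_closedBall_self hr.le)
      exact hdiff.differentiableAt (isOpen_compl_singleton.mem_nhds hz0)
  have h1 : (∮ z in C(0, ρ), z ^ (-k - 1) * F z) = ∮ z in C(0, 1), z ^ (-k - 1) * F z := by
    rcases le_total ρ 1 with h | h
    · exact (hindep ρ 1 hρ h).symm
    · exact hindep 1 ρ one_pos h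
  have h2 : (∮ z in C(0, 1), z ^ (-k - 1) * F z) = 2 * Real.pi * Complex.I * (γ k i j : ℝ) := by
    rw [← γ.circleIntegral_eval i j k]
    refine circleIntegral.integral_congr zero_le_one fun z hz => ?_
    simp only [hF1 z (by simpa using hz)]
  have h3 : ‖∮ z in C(0, ρ), z ^ (-k - 1) * F z‖ ≤ 2 * Real.pi * ρ * (ρ ^ (-k - 1) * C) := by
    refine circleIntegral.norm_integral_le_of_norm_le_const hρ.le fun z hz => ?_
    have hz' : ‖z‖ = ρ := by simpa using hz
    rw [norm_mul, norm_zpow, hz']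
    exact mul_le_mul_of_nonneg_left (hC z hz') (zpow_pos hρ _).le
  rw [h1, h2] at h3
  have h4 : ‖(2 * Real.pi * Complex.I * (γ k i j : ℝ) : ℂ)‖ = 2 * Real.pi * |γ k i j| := by
    simp [abs_of_pos Real.pi_pos]
  rw [h4, mul_assoc (2 * Real.pi), mul_le_mul_iff_right₀ (by positivity)] at h3
  calc ρ ^ k * |γ k i j| ≤ ρ ^ k * (ρ * (ρ ^ (-k - 1) * C)) :=
        mul_le_mul_of_nonneg_left h3 (zpow_pos hρ k).le
    _ = C := by
      rw [← mul_assoc, ← mul_assoc, ← zpow_add_one₀ hρ.ne', ← zpow_add₀ hρ.ne']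
      simp

/-! ### Dilations of analytic potentials. -/

theorem norm_le_sum_entries (X : M2) : ‖X‖ ≤ ∑ i, ∑ j, |X i j| := by
  rw [Matrix.linfty_opNorm_def]
  have h1 : (Finset.univ.sup fun i => ∑ j, ‖X i j‖₊) ≤ ∑ i, ∑ j, ‖X i j‖₊ :=
    Finset.sup_le fun i _ =>
      Finset.single_le_sum (f := fun i => ∑ j, ‖X i j‖₊) (fun _ _ => zero_le) (Finset.mem_univ i)
  have h2 : ((∑ i, ∑ j, ‖X i j‖₊ : NNReal) : ℝ) = ∑ i, ∑ j, |X i j| := by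
    push_cast
    simp
  rw [← h2]
  exact_mod_cast h1

/-- By joint continuity the extension is bounded on the compact product of a closed ball and the
circle of radius ρ, so the Cauchy estimate is uniform in p and k. -/
theorem AnalyticLoops.coeff_bound {D : Set (ℝ × ℝ)} (hD : IsOpen D) {ξ : ℝ × ℝ → Loop}
    (h : AnalyticLoops D ξ) {ρ : ℝ} (hρ : 0 < ρ) {p₀ : ℝ × ℝ} (hp₀ : p₀ ∈ D) :
    ∃ C, ∀ᶠ p in nhds p₀, ∀ k : ℤ, ρ ^ k * ‖ξ p k‖ ≤ C := by
  obtain ⟨F, hFc, hFd, hF1⟩ := h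
  obtain ⟨δ, hδ, hball⟩ := Metric.nhds_basis_closedBall.mem_iff.1 (hD.mem_nhds hp₀)
  have hcomp : IsCompact (Metric.closedBall p₀ δ ×ˢ Metric.sphere (0 : ℂ) ρ) :=
    (isCompact_closedBall p₀ δ).prod (isCompact_sphere 0 ρ)
  have hsub : Metric.closedBall p₀ δ ×ˢ Metric.sphere (0 : ℂ) ρ ⊆ D ×ˢ {0}ᶜ := by
    rintro ⟨p, z⟩ ⟨hp, hz⟩
    refine ⟨hball hp, ?_⟩
    rintro rfl
    simp [hρ.ne] at hz
  have hb : ∀ i j, ∃ C, ∀ q ∈ Metric.closedBall p₀ δ ×ˢ Metric.sphere (0 : ℂ) ρ,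
      ‖F q.1 q.2 i j‖ ≤ C := fun i j => by
    have hij : ContinuousOn (fun q : (ℝ × ℝ) × ℂ => F q.1 q.2 i j) (D ×ˢ {0}ᶜ) :=
      continuousOn_pi.1 (continuousOn_pi.1 hFc i) j
    exact hcomp.exists_bound_of_continuousOn (hij.mono hsub)
  choose C hC using hb
  refine ⟨∑ i, ∑ j, C i j, ?_⟩
  filter_upwards [Metric.closedBall_mem_nhds p₀ hδ] with p hp k
  calc ρ ^ k * ‖ξ p k‖ ≤ ρ ^ k * ∑ i, ∑ j, |ξ p k i j| :=
        mul_le_mul_of_nonneg_left (norm_le_sum_entries _) (zpow_pos hρ k).le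
    _ = ∑ i, ∑ j, ρ ^ k * |ξ p k i j| := by simp only [Finset.mul_sum]
    _ ≤ ∑ i, ∑ j, C i j := Finset.sum_le_sum fun i _ => Finset.sum_le_sum fun j _ =>
        norm_coeff_le_of_extension i j (hFd p (hball hp) i j)
          (fun z hz => by rw [hF1 p (hball hp) z hz]) hρ
          (fun z hz => hC i j (p, z) ⟨hp, by simpa using hz⟩) k

theorem summable_half_pow_natAbs : Summable fun k : ℤ => (1 / 2 : ℝ) ^ k.natAbs := by
  have h := summable_geometric_of_lt_one (r := (1 / 2 : ℝ)) (by norm_num) (by norm_num)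
  refine Summable.of_nat_of_neg ?_ ?_
  · simpa using h
  · simpa using h

/-- The Cauchy estimates at radius 2s for k ≥ 0 and s/2 for k ≤ 0 leave a geometric factor, which is
a summable majorant uniform near p₀. -/
theorem AnalyticLoops.dil_bound {D : Set (ℝ × ℝ)} (hD : IsOpen D) {ξ : ℝ × ℝ → Loop}
    (h : AnalyticLoops D ξ) {s : ℝ} (hs : 0 < s) {p₀ : ℝ × ℝ} (hp₀ : p₀ ∈ D) :
    ∃ C, ∀ᶠ p in nhds p₀, ∀ k : ℤ, ‖s ^ k • ξ p k‖ ≤ C * (1 / 2 : ℝ) ^ k.natAbs := by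
  obtain ⟨C₁, h₁⟩ := h.coeff_bound hD (ρ := 2 * s) (by positivity) hp₀
  obtain ⟨C₂, h₂⟩ := h.coeff_bound hD (ρ := s / 2) (by positivity) hp₀
  refine ⟨max C₁ C₂, ?_⟩
  filter_upwards [h₁, h₂] with p hp₁ hp₂ k
  rw [norm_smul, Real.norm_of_nonneg (zpow_pos hs k).le]
  rcases le_total 0 k with hk | hk
  · obtain ⟨n, rfl⟩ := Int.eq_ofNat_of_zero_le hk
    have h1 := (hp₁ n).trans (le_max_left C₁ C₂)
    calc s ^ (n : ℤ) * ‖ξ p n‖ = ((2 * s) ^ (n : ℤ) * ‖ξ p n‖) * (1 / 2) ^ n := by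
          rw [zpow_natCast, zpow_natCast, mul_pow, one_div, inv_pow]
          field_simp
      _ ≤ _ := by
          rw [Int.natAbs_natCast]
          exact mul_le_mul_of_nonneg_right h1 (by positivity)
  · obtain ⟨n, hn⟩ := Int.eq_ofNat_of_zero_le (neg_nonneg.2 hk)
    obtain rfl : k = -(n : ℤ) := by omega
    have h1 := (hp₂ (-(n : ℤ))).trans (le_max_right C₁ C₂)
    calc s ^ (-(n : ℤ)) * ‖ξ p (-(n : ℤ))‖
        = ((s / 2) ^ (-(n : ℤ)) * ‖ξ p (-(n : ℤ))‖) * (1 / 2) ^ n := by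
          rw [zpow_neg, zpow_neg, zpow_natCast, zpow_natCast, div_pow, one_div, inv_pow]
          field_simp
      _ ≤ _ := by
          rw [Int.natAbs_neg, Int.natAbs_natCast]
          exact mul_le_mul_of_nonneg_right h1 (by positivity)

/-- The coefficients are continuous in p, and dominated convergence lifts this to the loop norm.
Continuity is all that `exists_dil_frame` requires. -/
theorem AnalyticLoops.exists_dil {D : Set (ℝ × ℝ)} (hD : IsOpen D) {ξ : ℝ × ℝ → Loop}
    (h : AnalyticLoops D ξ) (hξ : ContinuousOn ξ D) {s : ℝ} (hs : 0 < s) :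
    ∃ ξ' : ℝ × ℝ → Loop, ContinuousOn ξ' D ∧ ∀ p ∈ D, IsDil s (ξ p) (ξ' p) := by
  classical
  have hsum : ∀ p ∈ D, Summable fun k : ℤ => ‖s ^ k • ξ p k‖ := fun p hp => by
    obtain ⟨C, hC⟩ := h.dil_bound hD hs hp
    exact (summable_half_pow_natAbs.mul_left C).of_nonneg_of_le (fun _ => norm_nonneg _)
      hC.self_of_nhds
  let ξ' : ℝ × ℝ → Loop := fun p =>
    if hp : p ∈ D then ⟨fun k => s ^ k • ξ p k, memℓp_gen (by simpa using hsum p hp)⟩ else 0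
  have hξ' : ∀ p ∈ D, IsDil s (ξ p) (ξ' p) := fun p hp k => by
    simp only [ξ', dif_pos hp]
  refine ⟨ξ', fun p₀ hp₀ => ContinuousAt.continuousWithinAt ?_, hξ'⟩
  obtain ⟨C, hC⟩ := h.dil_bound hD hs hp₀
  have hlim : Filter.Tendsto (fun p => ∑' k : ℤ, ‖(ξ' p - ξ' p₀) k‖) (nhds p₀)
      (nhds (∑' _ : ℤ, (0 : ℝ))) := by
    refine tendsto_tsum_of_dominated_convergence
      (bound := fun k : ℤ => 2 * (C * (1 / 2 : ℝ) ^ k.natAbs))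
      ((summable_half_pow_natAbs.mul_left C).mul_left 2) (fun k => ?_) ?_
    · have h1 : ContinuousAt (fun p => ‖s ^ k • (coeffCLM k (ξ p) - coeffCLM k (ξ p₀))‖) p₀ := by
        have h2 := (coeffCLM k).continuous.continuousAt.comp (hξ.continuousAt (hD.mem_nhds hp₀))
        exact ((h2.sub continuousAt_const).const_smul (s ^ k)).norm
      have h2 : Filter.Tendsto (fun p => ‖s ^ k • (coeffCLM k (ξ p) - coeffCLM k (ξ p₀))‖)
          (nhds p₀) (nhds 0) := by
        have := h1.tendsto
        simpa using this
      refine h2.congr' ?_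
      filter_upwards [hD.mem_nhds hp₀] with p hp
      rw [Loop.sub_coeff, hξ' p hp, hξ' p₀ hp₀, coeffCLM_apply, coeffCLM_apply, smul_sub]
    · filter_upwards [hC, hD.mem_nhds hp₀] with p hp hpD k
      rw [Real.norm_of_nonneg (norm_nonneg _), Loop.sub_coeff, hξ' p hpD, hξ' p₀ hp₀, two_mul]
      exact (norm_sub_le _ _).trans (add_le_add (hp k) (hC.self_of_nhds k))
  rw [tsum_zero] at hlim
  rw [ContinuousAt, tendsto_iff_norm_sub_tendsto_zero]
  exact hlim.congr fun p => (Loop.norm_eq_tsum _).symm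

/-! ### Harmonic maps from frames -/

theorem adjugate_of_mem_kPart {X : M2} (h : X ∈ kPart) : X.adjugate = -X := by
  obtain ⟨a, rfl⟩ := Submodule.mem_span_singleton.1 h
  rw [← trace_eq_zero_iff_adjugate, Matrix.trace_fin_two]
  simp [matK]

theorem adjugate_of_mem_mPart {X : M2} (h : X ∈ mPart) : X.adjugate = -X := by
  obtain ⟨a, b, rfl⟩ := Submodule.mem_span_pair.1 h
  rw [← trace_eq_zero_iff_adjugate, Matrix.trace_fin_two]
  simp [matI, matJ]

theorem commute_matK_of_mem_kPart {X : M2} (h : X ∈ kPart) : X * matK = matK * X := by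
  obtain ⟨a, rfl⟩ := Submodule.mem_span_singleton.1 h
  rw [smul_mul_assoc, mul_smul_comm]

theorem mem_kPart_of_sigma {X : M2} (h0 : X.trace = 0) (h : sigma X = X) : X ∈ kPart := by
  refine Submodule.mem_span_singleton.2 ⟨X 1 1, ?_⟩
  rw [Matrix.trace_fin_two] at h0
  rw [sigma_entries] at h
  have h1 : -X 0 1 = X 0 1 := congrFun (congrFun h 0) 1
  have h2 : -X 1 0 = X 1 0 := congrFun (congrFun h 1) 0
  ext i j; fin_cases i <;> fin_cases j <;> simp [matK] <;> linarith

theorem mem_mPart_of_sigma {X : M2} (h : sigma X = -X) : X ∈ mPart := by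
  refine Submodule.mem_span_pair.2 ⟨(X 1 0 - X 0 1) / 2, (X 1 0 + X 0 1) / 2, ?_⟩
  rw [sigma_entries] at h
  have h1 : X 0 0 = -X 0 0 := congrFun (congrFun h 0) 0
  have h2 : X 1 1 = -X 1 1 := congrFun (congrFun h 1) 1
  ext i j; fin_cases i <;> fin_cases j <;> simp [matI, matJ] <;> linarith

/-- `[𝔪, [𝔪, matK]] ⊆ 𝔨`. -/
theorem bracket_mPart {B E : M2} (hB : B ∈ mPart) (hE : E ∈ mPart) :
    ∃ c : ℝ, E * (B * matK - matK * B) - (B * matK - matK * B) * E = c • matK := by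
  obtain ⟨a, b, rfl⟩ := Submodule.mem_span_pair.1 hB
  obtain ⟨a', b', rfl⟩ := Submodule.mem_span_pair.1 hE
  refine ⟨4 * (b * b' - a * a'), ?_⟩
  ext i j
  fin_cases i <;> fin_cases j <;>
    simp [matI, matJ, matK] <;> ring

theorem scal_smul_left (c : ℝ) (X Y : M2) : scal (c • X) Y = c * scal X Y := by
  simp [scal]; ring

theorem tangential_smul_self {N : M2} (h : scal N N = 1) (c : ℝ) : tangential N (c • N) = 0 := by
  rw [tangential, scal_smul_left, h, mul_one, sub_self]

def adjCLM : M2 →L[ℝ] M2 := LinearMap.toContinuousLinearMap adjLin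

theorem adjCLM_apply (X : M2) : adjCLM X = X.adjugate := rfl

/-- The linear adjugate stands for the inverse. Its derivative along v is adj(Θ a) = -a adj(Θ),
which produces the commutator with a. -/
theorem fderiv_conj {Θ X : ℝ × ℝ → M2} {p v : ℝ × ℝ} {a : M2} (hΘ : DifferentiableAt ℝ Θ p)
    (hX : DifferentiableAt ℝ X p) (ha : fderiv ℝ Θ p v = Θ p * a) (ha' : a.adjugate = -a) :
    fderiv ℝ (fun q => Θ q * X q * (Θ q).adjugate) p v
      = Θ p * (a * X p - X p * a + fderiv ℝ X p v) * (Θ p).adjugate := by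
  have h1 : HasFDerivAt (fun q => adjCLM (Θ q)) (adjCLM ∘L fderiv ℝ Θ p) p :=
    adjCLM.hasFDerivAt.comp p hΘ.hasFDerivAt
  have h2 := ((hΘ.hasFDerivAt.mul' hX.hasFDerivAt).mul' h1).fderiv
  have h3 : fderiv ℝ (fun q => Θ q * X q * (Θ q).adjugate) p v
      = Θ p * X p * adjCLM (fderiv ℝ Θ p v)
        + (Θ p * fderiv ℝ X p v + fderiv ℝ Θ p v * X p) * adjCLM (Θ p) :=
    congrArg (fun T : ℝ × ℝ →L[ℝ] M2 => T v) h2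
  rw [h3, ha, adjCLM_apply, adjCLM_apply, Matrix.adjugate_mul_distrib, ha']
  noncomm_ring

theorem Ad_eq_of_det {Θ : M2} (h : Θ.det = 1) (X : M2) : Ad Θ X = Θ * X * Θ.adjugate := by
  rw [Ad, Matrix.inv_def, h, Ring.inverse_one, one_smul]

theorem Ad_matK_mem_S21 {Θ : M2} (h : Θ.det = 1) : Ad Θ matK ∈ S21 := by
  have h1 : Θ.adjugate * Θ = 1 := by rw [Matrix.adjugate_mul, h, one_smul]
  rw [Ad_eq_of_det h]
  constructor
  · rw [Matrix.trace_mul_comm, ← mul_assoc, h1, one_mul, Matrix.trace_fin_two]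
    simp [matK]
  · have h2 : Θ * matK * Θ.adjugate * (Θ * matK * Θ.adjugate) = Θ * Θ.adjugate := by
      calc _ = Θ * matK * (Θ.adjugate * Θ) * matK * Θ.adjugate := by noncomm_ring
        _ = Θ * (matK * matK) * Θ.adjugate := by rw [h1]; noncomm_ring
        _ = _ := by rw [matK_mul_matK, mul_one]
    rw [scal, h2, Matrix.mul_adjugate, h, one_smul, Matrix.trace_one]
    norm_num

theorem planeMetric_inv : planeMetric⁻¹ = !![0, 2; 2, 0] := by
  refine Matrix.inv_eq_right_inv ?_
  ext i j
  fin_cases i <;> fin_cases j <;> simp [planeMetric, Matrix.mul_apply, Fin.sum_univ_two]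

theorem hessian_def (ψ : ℝ × ℝ → M2) (p v w : ℝ × ℝ) : hessian ψ p v w =
    tangential (ψ p) (fderiv ℝ (fun q => fderiv ℝ ψ q w) p v) := rfl

theorem tension_eq (ψ : ℝ × ℝ → M2) (p : ℝ × ℝ) :
    tension ψ p = (2 : ℝ) • hessian ψ p (1, 0) (0, 1) + (2 : ℝ) • hessian ψ p (0, 1) (1, 0) := by
  rw [tension, planeMetric_inv]
  simp [Fin.sum_univ_two, coordVec]

/-- As A commutes with `matK`, the x-derivative of ψ is Θ[B, k']Θ⁻¹. As ∂B/∂y = 0, its y-derivative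
is Θ[E, [B, k']]Θ⁻¹, a multiple of ψ with no tangential part. The trace for dx dy involves the mixed
derivatives only. -/
theorem isHarmonicMap_of_frame {U : Set (ℝ × ℝ)} (hU : IsOpen U) {Θ A B E : ℝ × ℝ → M2}
    (hΘ : ContDiffOn ℝ ∞ Θ U) (hdet : ∀ p ∈ U, (Θ p).det = 1)
    (hx : ∀ p ∈ U, fderiv ℝ Θ p (1, 0) = Θ p * (A p + B p))
    (hy : ∀ p ∈ U, fderiv ℝ Θ p (0, 1) = Θ p * E p) (hA : ∀ p ∈ U, A p ∈ kPart)
    (hB : ∀ p ∈ U, B p ∈ mPart) (hE : ∀ p ∈ U, E p ∈ mPart) (hBd : DifferentiableOn ℝ B U)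
    (hBy : ∀ p ∈ U, fderiv ℝ B p (0, 1) = 0) :
    IsHarmonicMap U (fun p => Ad (Θ p) matK) := by
  set ψ : ℝ × ℝ → M2 := fun p => Ad (Θ p) matK with hψ
  have hψeq : ∀ p ∈ U, ψ p = Θ p * matK * (Θ p).adjugate := fun p hp => Ad_eq_of_det (hdet p hp) _
  have hΘd : ∀ p ∈ U, DifferentiableAt ℝ Θ p := fun p hp =>
    (hΘ.contDiffAt (hU.mem_nhds hp)).differentiableAt (by simp)
  have hsm : ContDiffOn ℝ ∞ ψ U := by
    have h1 : ContDiffOn ℝ ∞ (fun p => adjCLM (Θ p)) U := adjCLM.contDiff.comp_contDiffOn hΘ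
    exact ((hΘ.mul contDiffOn_const).mul h1).congr hψeq
  have hmem : ∀ p ∈ U, ψ p ∈ S21 := fun p hp => Ad_matK_mem_S21 (hdet p hp)
  refine ⟨hsm, hmem, fun p hp => ?_⟩
  have hψx : ∀ q ∈ U, fderiv ℝ ψ q (1, 0)
      = Θ q * (B q * matK - matK * B q) * (Θ q).adjugate := fun q hq => by
    have h1 : ψ =ᶠ[nhds q] fun q => Θ q * matK * (Θ q).adjugate :=
      Filter.eventuallyEq_of_mem (hU.mem_nhds hq) hψeq
    rw [h1.fderiv_eq, fderiv_conj (hΘd q hq) (differentiableAt_const _) (hx q hq)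
      (by rw [← adjCLM_apply, map_add, adjCLM_apply, adjCLM_apply,
        adjugate_of_mem_kPart (hA q hq), adjugate_of_mem_mPart (hB q hq), neg_add])]
    congr 2
    rw [fderiv_const_apply, add_mul, mul_add, commute_matK_of_mem_kPart (hA q hq)]
    show _ + (0 : M2) = _
    abel
  have hyx : fderiv ℝ (fun q => fderiv ℝ ψ q (1, 0)) p (0, 1)
      = Θ p * (E p * (B p * matK - matK * B p) - (B p * matK - matK * B p) * E p)
        * (Θ p).adjugate := by
    have h1 : (fun q => fderiv ℝ ψ q (1, 0)) =ᶠ[nhds p]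
        fun q => Θ q * (B q * matK - matK * B q) * (Θ q).adjugate :=
      Filter.eventuallyEq_of_mem (hU.mem_nhds hp) hψx
    have hBp : DifferentiableAt ℝ B p := (hBd p hp).differentiableAt (hU.mem_nhds hp)
    have h2 := (hBp.hasFDerivAt.mul_const' matK).sub (hBp.hasFDerivAt.const_mul matK)
    have h2d : DifferentiableAt ℝ (fun q => B q * matK - matK * B q) p := h2.differentiableAt
    have h3 : fderiv ℝ (fun q => B q * matK - matK * B q) p (0, 1) = 0 := by
      have h4 : fderiv ℝ (fun q => B q * matK - matK * B q) p (0, 1)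
          = fderiv ℝ B p (0, 1) * matK - matK * fderiv ℝ B p (0, 1) :=
        congrArg (fun T : ℝ × ℝ →L[ℝ] M2 => T (0, 1)) h2.fderiv
      rw [h4, hBy p hp, zero_mul, mul_zero, sub_zero]
    rw [h1.fderiv_eq, fderiv_conj (hΘd p hp) h2d (hy p hp)
      (adjugate_of_mem_mPart (hE p hp)), h3, add_zero]
  obtain ⟨c, hc⟩ := bracket_mPart (hB p hp) (hE p hp)
  have hyx' : fderiv ℝ (fun q => fderiv ℝ ψ q (1, 0)) p (0, 1) = c • ψ p := by
    rw [hyx, hc, hψeq p hp, mul_smul_comm, smul_mul_assoc]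
  have hxy : fderiv ℝ (fun q => fderiv ℝ ψ q (0, 1)) p (1, 0)
      = fderiv ℝ (fun q => fderiv ℝ ψ q (1, 0)) p (0, 1) := by
    have h1 : ContDiffAt ℝ ∞ ψ p := hsm.contDiffAt (hU.mem_nhds hp)
    have h2 : IsSymmSndFDerivAt ℝ ψ p := h1.isSymmSndFDerivAt (by
      rw [minSmoothness_of_isRCLikeNormedField]
      exact WithTop.coe_le_coe.2 (le_top : (2 : ℕ∞) ≤ ⊤))
    have h3 : DifferentiableAt ℝ (fderiv ℝ ψ) p :=
      (h1.fderiv_right (m := ∞) (by simp)).differentiableAt (by simp)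
    have h4 : ∀ v w : ℝ × ℝ, fderiv ℝ (fun q => fderiv ℝ ψ q w) p v
        = fderiv ℝ (fderiv ℝ ψ) p v w := fun v w => by
      have h5 := (h3.hasFDerivAt.clm_apply (hasFDerivAt_const w p)).fderiv
      have h6 : fderiv ℝ (fun q => fderiv ℝ ψ q w) p v
          = fderiv ℝ ψ p 0 + fderiv ℝ (fderiv ℝ ψ) p v w :=
        congrArg (fun T : ℝ × ℝ →L[ℝ] M2 => T v) h5
      rw [h6, map_zero, zero_add]
    rw [h4, h4]
    exact h2 (1, 0) (0, 1)
  have h0 : tangential (ψ p) (c • ψ p) = 0 := tangential_smul_self (hmem p hp).2 c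
  have e1 : hessian ψ p (0, 1) (1, 0) = 0 := by rw [hessian_def, hyx', h0]
  have e2 : hessian ψ p (1, 0) (0, 1) = 0 := by rw [hessian_def, hxy, hyx', h0]
  rw [tension_eq, e1, e2, smul_zero, add_zero]

/-! ### Frames in the loop group -/

section Frames

variable {E : Type*} [NormedAddCommGroup E] [NormedSpace ℝ E]

/-- The twist of Ψ solves the same initial value problem, so it equals Ψ. The derivative of Ψ adj(Ψ)
vanishes because adj(ξ) = -ξ. -/
theorem frame_mem_loopGroup {D : Set E} (hD : IsOpen D) (hD' : IsPreconnected D) (π : E →L[ℝ] ℝ)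
    {ξ Ψ : E → Loop} (hξ : ∀ p ∈ D, ξ p ∈ loopAlg)
    (hΨ : ∀ p ∈ D, HasFDerivAt Ψ (π.smulRight (Ψ p * ξ p)) p) (hu : ∀ p ∈ D, IsUnit (Ψ p))
    {p₀ : E} (hp₀ : p₀ ∈ D) (h0 : Ψ p₀ = 1) : ∀ p ∈ D, Ψ p ∈ loopGroup := by
  have hadj : ∀ p ∈ D, Loop.adj (ξ p) = -ξ p := fun p hp => ((mem_loopAlg_iff _).1 (hξ p hp)).1
  have htw : ∀ p ∈ D, Loop.twist (ξ p) = ξ p := fun p hp => ((mem_loopAlg_iff _).1 (hξ p hp)).2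
  have h1 : ∀ p ∈ D, HasFDerivAt (fun p => Loop.twist (Ψ p))
      (π.smulRight (Loop.twist (Ψ p) * ξ p)) p := fun p hp => by
    refine (Loop.twist.hasFDerivAt.comp p (hΨ p hp)).congr_fderiv ?_
    refine ContinuousLinearMap.ext fun v => ?_
    show Loop.twist (π v • (Ψ p * ξ p)) = π v • (Loop.twist (Ψ p) * ξ p)
    rw [map_smul, Loop.twist_mul, htw p hp]
  have h2 := frame_unique hD hD' π h1 hΨ hu hp₀ (by rw [h0, Loop.twist_one])
  have h3 : ∀ p ∈ D, HasFDerivAt (fun p => Ψ p * Loop.adj (Ψ p)) (0 : E →L[ℝ] Loop) p :=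
    fun p hp => by
      have h4 : HasFDerivAt (fun p => Loop.adj (Ψ p))
          (Loop.adj ∘L π.smulRight (Ψ p * ξ p)) p := Loop.adj.hasFDerivAt.comp p (hΨ p hp)
      refine ((hΨ p hp).mul' h4).congr_fderiv ?_
      refine ContinuousLinearMap.ext fun v => ?_
      show Ψ p * Loop.adj (π v • (Ψ p * ξ p)) + (π v • (Ψ p * ξ p)) * Loop.adj (Ψ p) = 0
      rw [map_smul, Loop.adj_mul, hadj p hp, mul_smul_comm, smul_mul_assoc, ← smul_add]
      rw [mul_assoc, neg_mul, mul_neg, ← mul_assoc, neg_add_cancel, smul_zero]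
  intro p hp
  refine (mem_loopGroup_iff _).2 ⟨?_, h2 hp⟩
  have h4 := hD.is_const_of_fderiv_eq_zero hD'
    (fun p hp => (h3 p hp).differentiableAt.differentiableWithinAt)
    (fun p hp => (h3 p hp).fderiv) hp hp₀
  have h5 : Ψ p * Loop.adj (Ψ p) = Ψ p₀ * Loop.adj (Ψ p₀) := h4
  rw [h5, h0, Loop.adj_one, mul_one]

/-- The data of a potential which depends on the coordinate `π` only. -/
structure IsChiralPotential (D : Set E) (π : E →L[ℝ] ℝ) (ξ : E → Loop) : Prop where
  smooth : ContDiffOn ℝ ∞ ξ D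
  mem : ∀ p ∈ D, ξ p ∈ loopAlg
  factors : FactorsLocally D π ξ

/-- The data of a frame integrating a potential. -/
structure IsChiralFrame (D : Set E) (π : E →L[ℝ] ℝ) (ξ Ψ : E → Loop) : Prop where
  hasFDerivAt : ∀ p ∈ D, HasFDerivAt Ψ (π.smulRight (Ψ p * ξ p)) p
  mem : ∀ p ∈ D, Ψ p ∈ loopGroup
  smooth : ContDiffOn ℝ ∞ Ψ D

theorem IsChiralPotential.exists_frame {D : Set E} (hD : IsOpen D) [SimplyConnectedSpace D]
    {π : E →L[ℝ] ℝ} (e : E) (he : π e = 1) (he1 : ‖e‖ ≤ 1) (hπ : ∀ v, |π v| ≤ ‖v‖) {ξ : E → Loop}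
    (h : IsChiralPotential D π ξ) {p₀ : E} (hp₀ : p₀ ∈ D) :
    ∃ Ψ : E → Loop, Ψ p₀ = 1 ∧ IsChiralFrame D π ξ Ψ ∧
      ∀ Φ : E → Loop, (∀ p ∈ D, HasFDerivAt Φ (π.smulRight (Φ p * ξ p)) p) → Φ p₀ = 1 →
        Set.EqOn Φ Ψ D := by
  have hconn : IsPreconnected D := isPreconnected_iff_preconnectedSpace.2 inferInstance
  obtain ⟨Ψ, h0, hΨ⟩ := Timelike.exists_frame hD π e he he1 hπ ξ h.smooth.continuousOn h.factors hp₀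
  have h1 : ∀ p ∈ D, HasFDerivAt Ψ (π.smulRight (Ψ p * ξ p)) p := fun p hp => (hΨ p hp).1
  have h2 : ∀ p ∈ D, IsUnit (Ψ p) := fun p hp => (hΨ p hp).2
  exact ⟨Ψ, h0, ⟨h1, frame_mem_loopGroup hD hconn π h.mem h1 h2 hp₀ h0,
    frame_contDiffOn hD π h.smooth h1⟩,
    fun Φ hΦ hΦ0 => frame_unique hD hconn π hΦ h1 h2 hp₀ (hΦ0.trans h0.symm)⟩

/-- A bounded dilation of the potential integrates to a smooth dilation of the frame. -/
theorem IsChiralFrame.exists_smooth_dil {D : Set E} (hD : IsOpen D) [SimplyConnectedSpace D]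
    {π : E →L[ℝ] ℝ} (e : E) (he : π e = 1) (he1 : ‖e‖ ≤ 1) (hπ : ∀ v, |π v| ≤ ‖v‖)
    {ξ Ψ : E → Loop} (h : IsChiralPotential D π ξ) (hΨ : IsChiralFrame D π ξ Ψ) {p₀ : E}
    (hp₀ : p₀ ∈ D) (h0 : Ψ p₀ = 1) {s : ℝ} (hs : s ≠ 0) (L : Loop →L[ℝ] Loop)
    (hL : ∀ p ∈ D, IsDil s (ξ p) (L (ξ p))) :
    ∃ Ψ' : E → Loop, ContDiffOn ℝ ∞ Ψ' D ∧ ∀ p ∈ D, IsDil s (Ψ p) (Ψ' p) := by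
  have h1 : ContDiffOn ℝ ∞ (fun p => L (ξ p)) D := L.contDiff.comp_contDiffOn h.smooth
  obtain ⟨Ψ', h2, h3⟩ := exists_dil_frame hD π e he he1 hπ hs h.smooth.continuousOn
    h1.continuousOn h.factors hL hp₀ hΨ.hasFDerivAt h0
  exact ⟨Ψ', frame_contDiffOn hD π h1 h2, h3⟩

end Frames

/-- The frame of an analytic potential is analytic. -/
theorem IsChiralFrame.extendsAnalytically {D : Set (ℝ × ℝ)} (hD : IsOpen D)
    [SimplyConnectedSpace D] {π : ℝ × ℝ →L[ℝ] ℝ} (e : ℝ × ℝ) (he : π e = 1) (he1 : ‖e‖ ≤ 1)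
    (hπ : ∀ v, |π v| ≤ ‖v‖) {ξ Ψ : ℝ × ℝ → Loop} (h : IsChiralPotential D π ξ)
    (hΨ : IsChiralFrame D π ξ Ψ) {p₀ : ℝ × ℝ} (hp₀ : p₀ ∈ D) (h0 : Ψ p₀ = 1)
    (han : AnalyticLoops D ξ) : ∀ p ∈ D, Ψ p ∈ loopGroupAn := fun p hp =>
  ⟨hΨ.mem p hp, extendsAnalytically_of_isDil fun s hs => by
    obtain ⟨ξ', hξ', hd⟩ := han.exists_dil hD h.smooth.continuousOn hs
    obtain ⟨Ψ', -, h3⟩ := exists_dil_frame hD π e he he1 hπ hs.ne' h.smooth.continuousOn hξ'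
      h.factors hd hp₀ hΨ.hasFDerivAt h0
    exact ⟨Ψ' p, h3 p hp⟩⟩

theorem chiralPotential_of_X {D : Set (ℝ × ℝ)} (hD : IsOpen D) {ξ : ℝ × ℝ → Loop}
    (h : IsPotentialX D ξ) : IsChiralPotential D (ContinuousLinearMap.fst ℝ ℝ ℝ) ξ :=
  ⟨h.smooth, h.mem, factorsLocally_of_fderiv hD _ (h.smooth.differentiableOn (by simp))
    fun p hp v hv => by
      have h1 : v = v.2 • ((0, 1) : ℝ × ℝ) := by
        ext
        · simpa using hv
        · simp
      rw [h1, map_smul, h.holomorphic p hp, smul_zero]⟩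

theorem chiralPotential_of_Y {D : Set (ℝ × ℝ)} (hD : IsOpen D) {ξ : ℝ × ℝ → Loop}
    (h : IsPotentialY D ξ) : IsChiralPotential D (ContinuousLinearMap.snd ℝ ℝ ℝ) ξ :=
  ⟨h.smooth, h.mem, factorsLocally_of_fderiv hD _ (h.smooth.differentiableOn (by simp))
    fun p hp v hv => by
      have h1 : v = v.1 • ((1, 0) : ℝ × ℝ) := by
        ext
        · simp
        · simpa using hv
      rw [h1, map_smul, h.antiholomorphic p hp, smul_zero]⟩

theorem fderiv_eq_of_values {F : Type*} [NormedAddCommGroup F] [NormedSpace ℝ F]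
    (T : ℝ × ℝ →L[ℝ] F) (v : ℝ × ℝ) :
    T v = v.1 • T (1, 0) + v.2 • T (0, 1) := by
  rw [← map_smul, ← map_smul, ← map_add]
  simp

theorem solvesFrame_fst_iff {D : Set (ℝ × ℝ)} (hD : IsOpen D) {Φ ξ : ℝ × ℝ → Loop} :
    SolvesFrame D Φ ξ (fun _ => 0) ↔ ∀ p ∈ D,
      HasFDerivAt Φ ((ContinuousLinearMap.fst ℝ ℝ ℝ).smulRight (Φ p * ξ p)) p := by
  constructor
  · rintro ⟨h1, h2⟩ p hp
    refine ((h1 p hp).differentiableAt (hD.mem_nhds hp)).hasFDerivAt.congr_fderiv ?_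
    refine ContinuousLinearMap.ext fun v => ?_
    have h3 : fderiv ℝ Φ p (0, 1) = Φ p * 0 := (h2 p hp).2
    rw [fderiv_eq_of_values, (h2 p hp).1, h3, mul_zero, smul_zero, add_zero]
    rfl
  · intro h
    refine ⟨fun p hp => (h p hp).differentiableAt.differentiableWithinAt, fun p hp => ?_⟩
    rw [(h p hp).fderiv]
    constructor
    · show (1 : ℝ) • (Φ p * ξ p) = _
      rw [one_smul]; rfl
    · show (0 : ℝ) • (Φ p * ξ p) = Φ p * 0
      rw [zero_smul, mul_zero]

theorem solvesFrame_snd_iff {D : Set (ℝ × ℝ)} (hD : IsOpen D) {Φ ξ : ℝ × ℝ → Loop} :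
    SolvesFrame D Φ (fun _ => 0) ξ ↔ ∀ p ∈ D,
      HasFDerivAt Φ ((ContinuousLinearMap.snd ℝ ℝ ℝ).smulRight (Φ p * ξ p)) p := by
  constructor
  · rintro ⟨h1, h2⟩ p hp
    refine ((h1 p hp).differentiableAt (hD.mem_nhds hp)).hasFDerivAt.congr_fderiv ?_
    refine ContinuousLinearMap.ext fun v => ?_
    have h3 : fderiv ℝ Φ p (1, 0) = Φ p * 0 := (h2 p hp).1
    rw [fderiv_eq_of_values, (h2 p hp).2, h3, mul_zero, smul_zero, zero_add]
    rfl
  · intro h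
    refine ⟨fun p hp => (h p hp).differentiableAt.differentiableWithinAt, fun p hp => ?_⟩
    rw [(h p hp).fderiv]
    constructor
    · show (0 : ℝ) • (Φ p * ξ p) = Φ p * 0
      rw [zero_smul, mul_zero]
    · show (1 : ℝ) • (Φ p * ξ p) = _
      rw [one_smul]; rfl

theorem fst_unit : ContinuousLinearMap.fst ℝ ℝ ℝ (1, 0) = 1 ∧ ‖((1, 0) : ℝ × ℝ)‖ ≤ 1 ∧
    ∀ v : ℝ × ℝ, |ContinuousLinearMap.fst ℝ ℝ ℝ v| ≤ ‖v‖ :=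
  ⟨rfl, by simp [Prod.norm_def], fun v => norm_fst_le v⟩

theorem snd_unit : ContinuousLinearMap.snd ℝ ℝ ℝ (0, 1) = 1 ∧ ‖((0, 1) : ℝ × ℝ)‖ ≤ 1 ∧
    ∀ v : ℝ × ℝ, |ContinuousLinearMap.snd ℝ ℝ ℝ v| ≤ ‖v‖ :=
  ⟨rfl, by simp [Prod.norm_def], fun v => norm_snd_le v⟩

/-! ### Derivatives of constrained loop-valued maps -/

section Constrained

variable {E : Type*} [NormedAddCommGroup E] [NormedSpace ℝ E] {U : Set E}

/-- Bounded linear constraints on values pass to derivatives; this serves coefficients, twists,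
dilations and values at 1. -/
theorem fderiv_of_clm_eq {F G : Type*} [NormedAddCommGroup F] [NormedSpace ℝ F]
    [NormedAddCommGroup G] [NormedSpace ℝ G] (hU : IsOpen U) {f : E → F} {f' : E → G}
    (L : F →L[ℝ] G) {p : E} (hp : p ∈ U) (hf : DifferentiableAt ℝ f p)
    (h : ∀ q ∈ U, L (f q) = f' q) (v : E) : L (fderiv ℝ f p v) = fderiv ℝ f' p v := by
  have h1 : f' =ᶠ[nhds p] fun q => L (f q) :=
    Filter.eventuallyEq_of_mem (hU.mem_nhds hp) fun q hq => (h q hq).symm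
  rw [h1.fderiv_eq]
  have h2 := (L.hasFDerivAt.comp p hf.hasFDerivAt).fderiv
  exact (congrArg (fun T : E →L[ℝ] G => T v) h2).symm

theorem fderiv_coeff_eq_zero (hU : IsOpen U) {f : E → Loop} {p : E} (hp : p ∈ U)
    (hf : DifferentiableAt ℝ f p) {k : ℤ} {X : M2} (h : ∀ q ∈ U, f q k = X) (v : E) :
    (fderiv ℝ f p v) k = 0 := by
  have h1 := fderiv_of_clm_eq hU (coeffCLM k) hp hf (f' := fun _ => X) h v
  rw [coeffCLM_apply] at h1
  rw [h1, fderiv_const_apply]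
  rfl

theorem IsDil.fderiv {s : ℝ} (hU : IsOpen U) {f f' : E → Loop} {p : E} (hp : p ∈ U)
    (hf : DifferentiableAt ℝ f p) (hf' : DifferentiableAt ℝ f' p)
    (h : ∀ q ∈ U, IsDil s (f q) (f' q)) (v : E) :
    IsDil s (fderiv ℝ f p v) (fderiv ℝ f' p v) := fun k => by
  have h1 := fderiv_of_clm_eq hU (coeffCLM k) hp hf' (f' := fun q => f' q k) (fun _ _ => rfl) v
  have h2 := fderiv_of_clm_eq hU (s ^ k • coeffCLM k) hp hf (f' := fun q => f' q k)
    (fun q hq => (h q hq k).symm) v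
  rw [coeffCLM_apply] at h1
  rw [h1, ← h2]
  rfl

/-- The Maurer-Cartan form of a map into the loop group takes values in the loop algebra. -/
theorem maurerCartan_mem (hU : IsOpen U) {Ψ : E → Loop} (hΨ : ∀ q ∈ U, Ψ q ∈ loopGroup) {p : E}
    (hp : p ∈ U) (hd : DifferentiableAt ℝ Ψ p) (v : E) :
    Loop.adj (Ψ p) * fderiv ℝ Ψ p v ∈ loopAlg := by
  rw [mem_loopAlg_iff]
  have htw : ∀ q ∈ U, Loop.twist (Ψ q) = Ψ q := fun q hq => ((mem_loopGroup_iff _).1 (hΨ q hq)).2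
  constructor
  · have h1 : HasFDerivAt (fun q => Loop.adj (Ψ q)) (Loop.adj ∘L fderiv ℝ Ψ p) p :=
      Loop.adj.hasFDerivAt.comp p hd.hasFDerivAt
    have h2 : (fun q => Loop.adj (Ψ q) * Ψ q) =ᶠ[nhds p] fun _ => (1 : Loop) :=
      Filter.eventuallyEq_of_mem (hU.mem_nhds hp) fun q hq => adj_mul_self (hΨ q hq)
    have h3 : HasFDerivAt (fun q => Loop.adj (Ψ q) * Ψ q) (0 : E →L[ℝ] Loop) p :=
      (hasFDerivAt_const (1 : Loop) p).congr_of_eventuallyEq h2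
    have h4 := (h1.mul' hd.hasFDerivAt).unique h3
    have h5 : Loop.adj (Ψ p) * fderiv ℝ Ψ p v + Loop.adj (fderiv ℝ Ψ p v) * Ψ p = 0 :=
      congrArg (fun T : E →L[ℝ] Loop => T v) h4
    rw [Loop.adj_mul, Loop.adj_adj, eq_neg_iff_add_eq_zero, add_comm, h5]
  · rw [Loop.twist_mul, Loop.twist_adj, htw p hp,
      fderiv_of_clm_eq hU Loop.twist hp hd (f' := Ψ) htw v]

/-- The Maurer-Cartan form of a product `Φ M⁻¹`. -/
theorem maurerCartan_of_mul (hU : IsOpen U) {Ψ Φ M : E → Loop} (hΨ : ∀ q ∈ U, Ψ q ∈ loopGroup)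
    (hM : ∀ q ∈ U, M q ∈ loopGroup) (h : ∀ q ∈ U, Φ q = Ψ q * M q) {p : E}
    (hp : p ∈ U) (hΦd : DifferentiableAt ℝ Φ p) (hMd : DifferentiableAt ℝ M p) (v : E) :
    Loop.adj (Ψ p) * fderiv ℝ Ψ p v
      = Loop.adj (Ψ p) * fderiv ℝ Φ p v * Loop.adj (M p) + M p * Loop.adj (fderiv ℝ M p v) := by
  have h1 : ∀ q ∈ U, Ψ q = Φ q * Loop.adj (M q) := fun q hq => by
    rw [h q hq, mul_assoc, mul_adj_self (hM q hq), mul_one]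
  have h2 : Ψ =ᶠ[nhds p] fun q => Φ q * Loop.adj (M q) :=
    Filter.eventuallyEq_of_mem (hU.mem_nhds hp) h1
  have h3 : HasFDerivAt (fun q => Loop.adj (M q)) (Loop.adj ∘L fderiv ℝ M p) p :=
    Loop.adj.hasFDerivAt.comp p hMd.hasFDerivAt
  have h4 := (hΦd.hasFDerivAt.mul' h3).fderiv
  have h5 : fderiv ℝ (fun q => Φ q * Loop.adj (M q)) p v
      = Φ p * Loop.adj (fderiv ℝ M p v) + fderiv ℝ Φ p v * Loop.adj (M p) :=
    congrArg (fun T : E →L[ℝ] Loop => T v) h4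
  have h6 : Loop.adj (Ψ p) * Φ p = M p := by
    rw [h p hp, ← mul_assoc, adj_mul_self (hΨ p hp), one_mul]
  rw [h2.fderiv_eq, h5, mul_add, ← mul_assoc, ← mul_assoc, h6, add_comm]

end Constrained

/-! ### Values at one -/

/-- The value of a loop at `λ = 1`. -/
def Loop.total : Loop →L[ℝ] M2 := lp.tsumCLM ℝ ℤ M2

theorem Loop.total_eq (ξ : Loop) : Loop.total ξ = ∑' k : ℤ, ξ k := rfl

theorem Loop.total_mul (ξ η : Loop) : Loop.total (ξ * η) = Loop.total ξ * Loop.total η :=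
  Loop.tsum_graded_mul (fun _ => ContinuousLinearMap.id ℝ M2) 1
    (fun _ X => (one_mul ‖X‖).ge) (fun _ _ _ _ => rfl) ξ η

theorem Loop.total_monomial (k : ℤ) (X : M2) : Loop.total (Loop.monomial k X) = X := by
  rw [Loop.total_eq, tsum_eq_single k, Loop.monomial_coeff, if_pos rfl]
  intro n hn
  rw [Loop.monomial_coeff, if_neg hn]

theorem Loop.total_one : Loop.total 1 = 1 := Loop.total_monomial 0 1

theorem Loop.total_adj (ξ : Loop) : Loop.total (Loop.adj ξ) = (Loop.total ξ).adjugate := by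
  have h1 : Summable fun k : ℤ => ξ k := ξ.summable_norm.of_norm
  have h2 := adjCLM.map_tsum h1
  rw [← adjCLM_apply, Loop.total_eq, Loop.total_eq, h2]
  exact tsum_congr fun k => Loop.adj_coeff ξ k

/-- Evaluation at s is not bounded on loops in general; after a dilation it becomes the bounded map
`Loop.total`, through which derivatives can be taken. -/
theorem IsDil.evalReal_eq {s : ℝ} {ξ η : Loop} (h : IsDil s ξ η) :
    ξ.evalReal s = Loop.total η := (tsum_congr fun k => (h k).symm)

/-- Group membership controls the determinant on the unit circle only. Dilation is multiplicative,
so the equation γ adj(γ) = 1 carries over to radius s. -/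
theorem IsDil.det_total {s : ℝ} (hs : s ≠ 0) {ξ η : Loop} (h : IsDil s ξ η)
    (hξ : ξ ∈ loopGroup) : (Loop.total η).det = 1 := by
  have h1 : IsDil s 1 (η * Loop.adj η) := by
    have := h.mul hs h.adj
    rwa [mul_adj_self hξ] at this
  have h2 := congrArg Loop.total ((isDil_one s).unique h1)
  rw [Loop.total_one, Loop.total_mul, Loop.total_adj, Matrix.mul_adjugate] at h2
  have h3 := congrFun (congrFun h2 0) 0
  simpa using h3.symm

theorem Loop.eq_of_powGE_zero_powLE_one {ξ : Loop} (h1 : PowGE 0 ξ) (h2 : PowLE 1 ξ) :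
    ξ = Loop.monomial 0 (ξ 0) + Loop.monomial 1 (ξ 1) := by
  refine Loop.ext_coeff fun k => ?_
  rw [Loop.add_coeff, Loop.monomial_coeff, Loop.monomial_coeff]
  by_cases hk0 : k = 0
  · subst hk0; simp
  by_cases hk1 : k = 1
  · subst hk1; simp
  rw [if_neg hk0, if_neg hk1, add_zero]
  rcases lt_or_gt_of_ne hk0 with h | h
  · exact h1 k h
  · exact h2 k (by omega)

theorem Loop.eq_of_powGE_powLE {n : ℤ} {ξ : Loop} (h1 : PowGE n ξ) (h2 : PowLE n ξ) :
    ξ = Loop.monomial n (ξ n) := by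
  refine Loop.ext_coeff fun k => ?_
  rw [Loop.monomial_coeff]
  split_ifs with h
  · rw [h]
  · rcases lt_or_gt_of_ne h with h | h
    · exact h1 k h
    · exact h2 k h

/-! ### Split frames -/

theorem IsIwasawa.mul_adj_fst {g h Ψ M N : Loop} (H : IsIwasawa g h Ψ M N) :
    Ψ = g * Loop.adj M := by
  have e : g = Ψ * M := H.fst_eq
  rw [e, mul_assoc, mul_adj_self H.minus.1, mul_one]

theorem IsIwasawa.mul_adj_snd {g h Ψ M N : Loop} (H : IsIwasawa g h Ψ M N) :
    Ψ = h * Loop.adj N := by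
  have e : h = Ψ * N := H.snd_eq
  rw [e, mul_assoc, mul_adj_self H.plus.1, mul_one]

theorem loopGroupAn_of_eq_mul {g Ψ M : Loop} (hΨ : Ψ ∈ loopGroupAn) (hM : M ∈ loopGroup)
    (h : g = Ψ * M) (hg : g ∈ loopGroupAn) : M ∈ loopGroupAn := by
  have h1 : M = Loop.adj Ψ * g := by rw [h, ← mul_assoc, adj_mul_self hΨ.1, one_mul]
  refine ⟨hM, ?_⟩
  rw [h1]
  exact hΨ.2.adj.mul hg.2

/-- The Maurer-Cartan form of `Φ M⁻¹` for a frame `Φ`. -/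
theorem IsChiralFrame.maurerCartan {E : Type*} [NormedAddCommGroup E] [NormedSpace ℝ E]
    {U D : Set E} (hU : IsOpen U) (hUD : U ⊆ D) {π : E →L[ℝ] ℝ} {ξ Φ Ψ M : E → Loop}
    (hΦ : IsChiralFrame D π ξ Φ) (hΨ : ∀ q ∈ U, Ψ q ∈ loopGroup) (hM : ∀ q ∈ U, M q ∈ loopGroup)
    (h : ∀ q ∈ U, Φ q = Ψ q * M q) {p : E} (hp : p ∈ U) (hMd : DifferentiableAt ℝ M p) (v : E) :
    Loop.adj (Ψ p) * fderiv ℝ Ψ p v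
      = π v • (M p * ξ p * Loop.adj (M p)) + M p * Loop.adj (fderiv ℝ M p v) := by
  have h1 := hΦ.hasFDerivAt p (hUD hp)
  have h2 : fderiv ℝ Φ p v = π v • (Φ p * ξ p) :=
    congrArg (fun T : E →L[ℝ] Loop => T v) h1.fderiv
  have h3 : Loop.adj (Ψ p) * (Φ p * ξ p) = M p * ξ p := by
    rw [h p hp, ← mul_assoc, ← mul_assoc, adj_mul_self (hΨ p hp), one_mul]
  rw [maurerCartan_of_mul hU hΨ hM h hp h1.differentiableAt hMd v, h2, mul_smul_comm,
    smul_mul_assoc, h3]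

/-- The normalization of the constant term removes the power 0 as well, which is what excludes a λ⁰
term in the dy-part of the framing. -/
theorem powLE_fderiv_minus {E : Type*} [NormedAddCommGroup E] [NormedSpace ℝ E] {U : Set E}
    (hU : IsOpen U) {M : E → Loop} (hM : ∀ q ∈ U, M q ∈ loopGroupMinusStar) {p : E} (hp : p ∈ U)
    (hMd : DifferentiableAt ℝ M p) (v : E) : PowLE (-1) (fderiv ℝ M p v) := fun k hk => by
  rcases (show 0 ≤ k by omega).eq_or_lt with h | h
  · subst h
    exact fderiv_coeff_eq_zero hU hp hMd (fun q hq => (hM q hq).2.2) v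
  · exact fderiv_coeff_eq_zero hU hp hMd (fun q hq => (hM q hq).2.1 k h) v

theorem powGE_fderiv_plus {E : Type*} [NormedAddCommGroup E] [NormedSpace ℝ E] {U : Set E}
    (hU : IsOpen U) {N : E → Loop} (hN : ∀ q ∈ U, N q ∈ loopGroupPlus) {p : E} (hp : p ∈ U)
    (hNd : DifferentiableAt ℝ N p) (v : E) : PowGE 0 (fderiv ℝ N p v) := fun k hk =>
  fderiv_coeff_eq_zero hU hp hNd (fun q hq => (hN q hq).2 k hk) v

/-- Frames of two potentials which split over an open set. -/
structure IsSplitPair (D U : Set (ℝ × ℝ)) (ξ₁ ξ₂ Ψ₁ Ψ₂ Ψ M N : ℝ × ℝ → Loop) : Prop where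
  isOpen : IsOpen U
  subset : U ⊆ D
  potentialX : IsPotentialX D ξ₁
  potentialY : IsPotentialY D ξ₂
  frameX : IsChiralFrame D (ContinuousLinearMap.fst ℝ ℝ ℝ) ξ₁ Ψ₁
  frameY : IsChiralFrame D (ContinuousLinearMap.snd ℝ ℝ ℝ) ξ₂ Ψ₂
  split : ∀ p ∈ U, IsIwasawa (Ψ₁ p) (Ψ₂ p) (Ψ p) (M p) (N p)

namespace IsSplitPair

variable {D U : Set (ℝ × ℝ)} {ξ₁ ξ₂ Ψ₁ Ψ₂ Ψ M N : ℝ × ℝ → Loop}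

theorem smooth_factors (S : IsSplitPair D U ξ₁ ξ₂ Ψ₁ Ψ₂ Ψ M N) :
    ContDiffOn ℝ ∞ M U ∧ ContDiffOn ℝ ∞ N U :=
  IsIwasawa.contDiffOn S.isOpen (S.frameX.smooth.mono S.subset) (S.frameY.smooth.mono S.subset)
    (fun p hp => S.frameX.mem p (S.subset hp)) (fun p hp => S.frameY.mem p (S.subset hp)) S.split

theorem smooth_adj {M : ℝ × ℝ → Loop} (h : ContDiffOn ℝ ∞ M U) :
    ContDiffOn ℝ ∞ (fun p => Loop.adj (M p)) U :=
  (ContinuousLinearMap.contDiff Loop.adj).comp_contDiffOn h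

theorem smooth (S : IsSplitPair D U ξ₁ ξ₂ Ψ₁ Ψ₂ Ψ M N) : ContDiffOn ℝ ∞ Ψ U :=
  ((S.frameX.smooth.mono S.subset).mul (smooth_adj S.smooth_factors.1)).congr
    fun p hp => (S.split p hp).mul_adj_fst

theorem differentiableAt (S : IsSplitPair D U ξ₁ ξ₂ Ψ₁ Ψ₂ Ψ M N) {p : ℝ × ℝ} (hp : p ∈ U) :
    DifferentiableAt ℝ Ψ p ∧ DifferentiableAt ℝ M p ∧ DifferentiableAt ℝ N p :=
  ⟨(S.smooth.contDiffAt (S.isOpen.mem_nhds hp)).differentiableAt (by simp),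
    (S.smooth_factors.1.contDiffAt (S.isOpen.mem_nhds hp)).differentiableAt (by simp),
    (S.smooth_factors.2.contDiffAt (S.isOpen.mem_nhds hp)).differentiableAt (by simp)⟩

theorem maurerCartan_fst (S : IsSplitPair D U ξ₁ ξ₂ Ψ₁ Ψ₂ Ψ M N) {p : ℝ × ℝ} (hp : p ∈ U)
    (v : ℝ × ℝ) : Loop.adj (Ψ p) * fderiv ℝ Ψ p v
      = v.1 • (M p * ξ₁ p * Loop.adj (M p)) + M p * Loop.adj (fderiv ℝ M p v) :=
  S.frameX.maurerCartan S.isOpen S.subset (fun q hq => (S.split q hq).mem)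
    (fun q hq => (S.split q hq).minus.1) (fun q hq => (S.split q hq).fst_eq) hp
    (S.differentiableAt hp).2.1 v

theorem maurerCartan_snd (S : IsSplitPair D U ξ₁ ξ₂ Ψ₁ Ψ₂ Ψ M N) {p : ℝ × ℝ} (hp : p ∈ U)
    (v : ℝ × ℝ) : Loop.adj (Ψ p) * fderiv ℝ Ψ p v
      = v.2 • (N p * ξ₂ p * Loop.adj (N p)) + N p * Loop.adj (fderiv ℝ N p v) :=
  S.frameY.maurerCartan S.isOpen S.subset (fun q hq => (S.split q hq).mem)
    (fun q hq => (S.split q hq).plus.1) (fun q hq => (S.split q hq).snd_eq) hp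
    (S.differentiableAt hp).2.2 v

theorem powLE_minus_term (S : IsSplitPair D U ξ₁ ξ₂ Ψ₁ Ψ₂ Ψ M N) {p : ℝ × ℝ} (hp : p ∈ U)
    (v : ℝ × ℝ) : PowLE (-1) (M p * Loop.adj (fderiv ℝ M p v)) := by
  have h1 : PowLE 0 (M p) := (S.split p hp).minus.2.1
  have h2 := powLE_fderiv_minus S.isOpen (fun q hq => (S.split q hq).minus) hp
    (S.differentiableAt hp).2.1 v
  exact h1.mul h2.adj

theorem powGE_plus_term (S : IsSplitPair D U ξ₁ ξ₂ Ψ₁ Ψ₂ Ψ M N) {p : ℝ × ℝ} (hp : p ∈ U)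
    (v : ℝ × ℝ) : PowGE 0 (N p * Loop.adj (fderiv ℝ N p v)) := by
  have h1 : PowGE 0 (N p) := (S.split p hp).plus.2
  have h2 := powGE_fderiv_plus S.isOpen (fun q hq => (S.split q hq).plus) hp
    (S.differentiableAt hp).2.2 v
  exact h1.mul h2.adj

theorem powLE_conj (S : IsSplitPair D U ξ₁ ξ₂ Ψ₁ Ψ₂ Ψ M N) {p : ℝ × ℝ} (hp : p ∈ U) :
    PowLE 1 (M p * ξ₁ p * Loop.adj (M p)) ∧ (M p * ξ₁ p * Loop.adj (M p)) 1 = ξ₁ p 1 := by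
  have h1 : PowLE 0 (M p) := (S.split p hp).minus.2.1
  have h2 : PowLE 1 (ξ₁ p) := S.potentialX.powers p (S.subset hp)
  have h3 : M p 0 = 1 := (S.split p hp).minus.2.2
  have h4 := h1.mul_coeff h2
  have h5 := (h1.mul h2).mul_coeff h1.adj
  rw [h4, Loop.adj_coeff, h3, Matrix.adjugate_one, one_mul, mul_one] at h5
  exact ⟨(h1.mul h2).mul h1.adj, h5⟩

theorem powGE_conj (S : IsSplitPair D U ξ₁ ξ₂ Ψ₁ Ψ₂ Ψ M N) {p : ℝ × ℝ} (hp : p ∈ U) :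
    PowGE (-1) (N p * ξ₂ p * Loop.adj (N p)) := by
  have h1 : PowGE 0 (N p) := (S.split p hp).plus.2
  have h2 : PowGE (-1) (ξ₂ p) := S.potentialY.powers p (S.subset hp)
  exact (h1.mul h2).mul h1.adj

/-- The `k`-th coefficient of `Ψ⁻¹ ∂_v Ψ`. -/
def coefficient (Ψ : ℝ × ℝ → Loop) (v : ℝ × ℝ) (k : ℤ) (p : ℝ × ℝ) : M2 :=
  (Loop.adj (Ψ p) * fderiv ℝ Ψ p v) k

theorem smooth_coefficient (S : IsSplitPair D U ξ₁ ξ₂ Ψ₁ Ψ₂ Ψ M N) (v : ℝ × ℝ) (k : ℤ) :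
    ContDiffOn ℝ ∞ (coefficient Ψ v k) U := by
  have h1 : ContDiffOn ℝ ∞ (fun p => fderiv ℝ Ψ p v) U :=
    (S.smooth.fderiv_of_isOpen S.isOpen (by simp)).clm_apply contDiffOn_const
  exact (coeffCLM k).contDiff.comp_contDiffOn ((smooth_adj S.smooth).mul h1)

/-- Through M there are no powers above 1, and the λ-coefficient is that of ξ' because M has
constant term 1. Through N there are no negative powers, since ξ'' has no dx-part. -/
theorem maurerCartan_x (S : IsSplitPair D U ξ₁ ξ₂ Ψ₁ Ψ₂ Ψ M N) {p : ℝ × ℝ} (hp : p ∈ U) :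
    Loop.adj (Ψ p) * fderiv ℝ Ψ p (1, 0)
      = Loop.monomial 0 (coefficient Ψ (1, 0) 0 p) + Loop.monomial 1 (ξ₁ p 1) := by
  have h1 := S.maurerCartan_fst hp (1, 0)
  have h2 := S.maurerCartan_snd hp (1, 0)
  rw [one_smul] at h1
  rw [zero_smul, zero_add] at h2
  have hle : PowLE 1 (Loop.adj (Ψ p) * fderiv ℝ Ψ p (1, 0)) := by
    rw [h1]
    intro k hk
    rw [Loop.add_coeff, (S.powLE_conj hp).1 k hk, S.powLE_minus_term hp _ k (by omega), add_zero]
  have hge : PowGE 0 (Loop.adj (Ψ p) * fderiv ℝ Ψ p (1, 0)) := by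
    rw [h2]
    exact S.powGE_plus_term hp _
  have h3 : (Loop.adj (Ψ p) * fderiv ℝ Ψ p (1, 0)) 1 = ξ₁ p 1 := by
    rw [h1, Loop.add_coeff, (S.powLE_conj hp).2, S.powLE_minus_term hp _ 1 (by omega), add_zero]
  have h4 := Loop.eq_of_powGE_zero_powLE_one hge hle
  rw [h3] at h4
  exact h4

/-- Through M only powers ≤ -1 occur, since ξ' has no dy-part; through N only powers ≥ -1. -/
theorem maurerCartan_y (S : IsSplitPair D U ξ₁ ξ₂ Ψ₁ Ψ₂ Ψ M N) {p : ℝ × ℝ} (hp : p ∈ U) :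
    Loop.adj (Ψ p) * fderiv ℝ Ψ p (0, 1)
      = Loop.monomial (-1) (coefficient Ψ (0, 1) (-1) p) := by
  have h1 := S.maurerCartan_fst hp (0, 1)
  have h2 := S.maurerCartan_snd hp (0, 1)
  rw [zero_smul, zero_add] at h1
  rw [one_smul] at h2
  refine Loop.eq_of_powGE_powLE ?_ ?_
  · rw [h2]
    intro k hk
    rw [Loop.add_coeff, S.powGE_conj hp k hk, S.powGE_plus_term hp _ k (by omega), add_zero]
  · rw [h1]
    exact S.powLE_minus_term hp _

theorem coefficient_mem (S : IsSplitPair D U ξ₁ ξ₂ Ψ₁ Ψ₂ Ψ M N) {p : ℝ × ℝ} (hp : p ∈ U) :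
    coefficient Ψ (1, 0) 0 p ∈ kPart ∧ ξ₁ p 1 ∈ mPart ∧ coefficient Ψ (0, 1) (-1) p ∈ mPart := by
  have h := fun v => maurerCartan_mem S.isOpen (fun q hq => (S.split q hq).mem) hp
    (S.differentiableAt hp).1 v
  refine ⟨mem_kPart_of_sigma ((h (1, 0)).1 0) ?_, mem_mPart_of_sigma ?_, mem_mPart_of_sigma ?_⟩
  · have h1 := (h (1, 0)).2 0
    rwa [zpow_zero, one_smul] at h1
  · have h1 := (S.potentialX.mem p (S.subset hp)).2 1
    rwa [zpow_one, neg_smul, one_smul] at h1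
  · have h1 := (h (0, 1)).2 (-1)
    rwa [zpow_neg_one, inv_neg, inv_one, neg_smul, one_smul] at h1

theorem fderiv_eq (S : IsSplitPair D U ξ₁ ξ₂ Ψ₁ Ψ₂ Ψ M N) {p : ℝ × ℝ} (hp : p ∈ U) (v : ℝ × ℝ) :
    fderiv ℝ Ψ p v = Ψ p * (Loop.adj (Ψ p) * fderiv ℝ Ψ p v) := by
  rw [← mul_assoc, mul_adj_self (S.split p hp).mem, one_mul]

/-- For t ≥ 1 the factorization Ψ = Ψ'M⁻¹ is used: the potential has powers ≤ 1 and M⁻¹ has powers ≤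
0, so both dilations are bounded. For t ≤ 1 the factorization Ψ = Ψ''N⁻¹ serves in the same way. -/
theorem exists_smooth_dil (S : IsSplitPair D U ξ₁ ξ₂ Ψ₁ Ψ₂ Ψ M N) (hD : IsOpen D)
    [SimplyConnectedSpace D] {p₀ : ℝ × ℝ} (hp₀ : p₀ ∈ D) (h₁ : Ψ₁ p₀ = 1) (h₂ : Ψ₂ p₀ = 1)
    {t : ℝ} (ht : 0 < t) :
    ∃ Ψ' : ℝ × ℝ → Loop, ContDiffOn ℝ ∞ Ψ' U ∧ ∀ p ∈ U, IsDil t (Ψ p) (Ψ' p) := by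
  rcases le_total 1 t with h | h
  · obtain ⟨Φ, hΦ, hd⟩ := S.frameX.exists_smooth_dil hD (1, 0) fst_unit.1 fst_unit.2.1
      fst_unit.2.2 (chiralPotential_of_X hD S.potentialX) hp₀ h₁ ht.ne' (boundedDil t t)
      (fun p hp => isDil_boundedDil_of_powLE h (S.potentialX.powers p hp))
    refine ⟨fun p => Φ p * boundedDil t t (Loop.adj (M p)), (hΦ.mono S.subset).mul
      ((boundedDil t t).contDiff.comp_contDiffOn (smooth_adj S.smooth_factors.1)),
      fun p hp => ?_⟩
    have h1 : PowLE 0 (M p) := (S.split p hp).minus.2.1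
    rw [(S.split p hp).mul_adj_fst]
    exact (hd p (S.subset hp)).mul ht.ne'
      (isDil_boundedDil_of_powLE h (h1.adj.mono zero_le_one))
  · obtain ⟨Φ, hΦ, hd⟩ := S.frameY.exists_smooth_dil hD (0, 1) snd_unit.1 snd_unit.2.1
      snd_unit.2.2 (chiralPotential_of_Y hD S.potentialY) hp₀ h₂ ht.ne' (boundedDil t t⁻¹)
      (fun p hp => isDil_boundedDil_of_powGE ht h (S.potentialY.powers p hp))
    refine ⟨fun p => Φ p * boundedDil t t⁻¹ (Loop.adj (N p)), (hΦ.mono S.subset).mul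
      ((boundedDil t t⁻¹).contDiff.comp_contDiffOn (smooth_adj S.smooth_factors.2)),
      fun p hp => ?_⟩
    have h1 : PowGE 0 (N p) := (S.split p hp).plus.2
    rw [(S.split p hp).mul_adj_snd]
    exact (hd p (S.subset hp)).mul ht.ne'
      (isDil_boundedDil_of_powGE ht h (h1.adj.mono (by omega)))

theorem mem_loopGroupAn (S : IsSplitPair D U ξ₁ ξ₂ Ψ₁ Ψ₂ Ψ M N) (hD : IsOpen D)
    [SimplyConnectedSpace D] {p₀ : ℝ × ℝ} (hp₀ : p₀ ∈ D) (h₁ : Ψ₁ p₀ = 1) (h₂ : Ψ₂ p₀ = 1)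
    {p : ℝ × ℝ} (hp : p ∈ U) : Ψ p ∈ loopGroupAn :=
  ⟨(S.split p hp).mem, extendsAnalytically_of_isDil fun t ht => by
    obtain ⟨Ψ', -, h⟩ := S.exists_smooth_dil hD hp₀ h₁ h₂ ht
    exact ⟨Ψ' p, h p hp⟩⟩

theorem isExtendedFraming (S : IsSplitPair D U ξ₁ ξ₂ Ψ₁ Ψ₂ Ψ M N) (hD : IsOpen D)
    [SimplyConnectedSpace D] (h0 : (0, 0) ∈ U) (h₁ : Ψ₁ (0, 0) = 1) (h₂ : Ψ₂ (0, 0) = 1) :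
    IsExtendedFraming U Ψ := by
  have hB : ContDiffOn ℝ ∞ (fun p => ξ₁ p 1) U :=
    (coeffCLM 1).contDiff.comp_contDiffOn (S.potentialX.smooth.mono S.subset)
  refine ⟨S.smooth, fun p hp => S.mem_loopGroupAn hD (S.subset h0) h₁ h₂ hp, ?_,
    coefficient Ψ (1, 0) 0, fun p => ξ₁ p 1, fun _ => 0, coefficient Ψ (0, 1) (-1),
    S.smooth_coefficient _ _, hB, contDiffOn_const, S.smooth_coefficient _ _,
    fun p hp => ⟨(S.coefficient_mem hp).1, (S.coefficient_mem hp).2.1, kPart.zero_mem,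
      (S.coefficient_mem hp).2.2⟩,
    fun p hp => (S.differentiableAt hp).1.differentiableWithinAt, fun p hp => ⟨?_, ?_⟩⟩
  -- At the origin the pair (1, 1) splits trivially, and uniqueness gives Ψ = 1.
  · have h := S.split _ h0
    rw [h₁, h₂] at h
    exact (h.unique isIwasawa_one).1
  · rw [S.fderiv_eq hp, S.maurerCartan_x hp]; rfl
  · have h3 : Loop.monomial 0 (0 : M2) = 0 := map_zero (monomialCLM 0)
    rw [S.fderiv_eq hp, S.maurerCartan_y hp]
    show _ = Ψ p * (Loop.monomial 0 0 + Loop.monomial (-1) (coefficient Ψ (0, 1) (-1) p))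
    rw [h3, zero_add]

/-- Ψ at λ = t is `Loop.total` of a smooth dilation, and its Maurer-Cartan form is (A + tB) dx +
t⁻¹E dy. Holomorphy of ξ' supplies ∂B/∂y = 0. -/
theorem isHarmonicMap (S : IsSplitPair D U ξ₁ ξ₂ Ψ₁ Ψ₂ Ψ M N) (hD : IsOpen D)
    [SimplyConnectedSpace D] {p₀ : ℝ × ℝ} (hp₀ : p₀ ∈ D) (h₁ : Ψ₁ p₀ = 1) (h₂ : Ψ₂ p₀ = 1)
    {t : ℝ} (ht : 0 < t) : IsHarmonicMap U (fun p => Ad ((Ψ p).evalReal t) matK) := by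
  obtain ⟨Ψ', hs, hd⟩ := S.exists_smooth_dil hD hp₀ h₁ h₂ ht
  have heq : ∀ p ∈ U, (Ψ p).evalReal t = Loop.total (Ψ' p) := fun p hp => (hd p hp).evalReal_eq
  have hd' : ∀ p ∈ U, DifferentiableAt ℝ Ψ' p := fun p hp =>
    (hs.contDiffAt (S.isOpen.mem_nhds hp)).differentiableAt (by simp)
  have hder : ∀ p ∈ U, ∀ v, ∀ β : Loop, IsDil t (Loop.adj (Ψ p) * fderiv ℝ Ψ p v) β →
      fderiv ℝ (fun p => (Ψ p).evalReal t) p v = (Ψ p).evalReal t * Loop.total β :=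
    fun p hp v β hβ => by
      have e1 := fderiv_of_clm_eq S.isOpen Loop.total hp (hd' p hp)
        (fun q hq => (heq q hq).symm) v
      have e2 := IsDil.fderiv S.isOpen hp (S.differentiableAt hp).1 (hd' p hp) hd v
      rw [S.fderiv_eq hp] at e2
      have e3 := e2.unique ((hd p hp).mul ht.ne' hβ)
      rw [← e1, e3, Loop.total_mul, heq p hp]
  have hBd : ∀ p ∈ U, DifferentiableAt ℝ ξ₁ p := fun p hp =>
    (S.potentialX.smooth.contDiffAt (hD.mem_nhds (S.subset hp))).differentiableAt (by simp)
  refine isHarmonicMap_of_frame S.isOpen (A := coefficient Ψ (1, 0) 0)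
    (B := fun p => t • ξ₁ p 1) (E := fun p => t⁻¹ • coefficient Ψ (0, 1) (-1) p)
    ((Loop.total.contDiff.comp_contDiffOn hs).congr heq) (fun p hp => ?_) (fun p hp => ?_)
    (fun p hp => ?_) (fun p hp => (S.coefficient_mem hp).1)
    (fun p hp => mPart.smul_mem _ (S.coefficient_mem hp).2.1)
    (fun p hp => mPart.smul_mem _ (S.coefficient_mem hp).2.2) (fun p hp => ?_) (fun p hp => ?_)
  · rw [heq p hp]
    exact (hd p hp).det_total ht.ne' (S.split p hp).mem
  · have h := (isDil_monomial t 0 (coefficient Ψ (1, 0) 0 p)).add (isDil_monomial t 1 (ξ₁ p 1))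
    rw [← S.maurerCartan_x hp, zpow_zero, one_smul, zpow_one] at h
    rw [hder p hp _ _ h, map_add, Loop.total_monomial, Loop.total_monomial]
  · have h := isDil_monomial t (-1) (coefficient Ψ (0, 1) (-1) p)
    rw [← S.maurerCartan_y hp, zpow_neg_one] at h
    rw [hder p hp _ _ h, Loop.total_monomial]
  · exact ((t • coeffCLM 1).differentiableAt.comp p (hBd p hp)).differentiableWithinAt
  · have h := fderiv_of_clm_eq hD (t • coeffCLM 1) (S.subset hp) (hBd p hp)
      (f' := fun p => t • ξ₁ p 1) (fun _ _ => rfl) (0, 1)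
    rw [← h, S.potentialX.holomorphic p (S.subset hp), map_zero]

end IsSplitPair

/-- The pair (1, 1) splits trivially, so `IsIwasawa.near` applies on a ball where h⁻¹g is within
distance 1 of the identity. -/
theorem exists_splitting_neighbourhood {D : Set (ℝ × ℝ)} (hD : IsOpen D) {g h : ℝ × ℝ → Loop}
    {p₀ : ℝ × ℝ} (hp₀ : p₀ ∈ D) (hg : ContinuousOn g D) (hh : ContinuousOn h D)
    (hgm : ∀ p ∈ D, g p ∈ loopGroup) (hhm : ∀ p ∈ D, h p ∈ loopGroup) (hg0 : g p₀ = 1)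
    (hh0 : h p₀ = 1) :
    ∃ U : Set (ℝ × ℝ), IsOpen U ∧ IsConnected U ∧ p₀ ∈ U ∧ U ⊆ D ∧
      ∀ p ∈ U, ∃! t : Loop × Loop × Loop, IsIwasawa (g p) (h p) t.1 t.2.1 t.2.2 := by
  set K : ℝ × ℝ → Loop := fun p => 1 * Loop.adj (h p) * g p * Loop.adj 1 with hK
  have hKc : ContinuousAt K p₀ := by
    have h1 := hg.continuousAt (hD.mem_nhds hp₀)
    have h2 := hh.continuousAt (hD.mem_nhds hp₀)
    have h3 : ContinuousAt (fun p => Loop.adj (h p)) p₀ :=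
      Loop.adj.continuous.continuousAt.comp h2
    exact ((continuousAt_const.mul h3).mul h1).mul continuousAt_const
  have hK0 : K p₀ = 1 := by simp only [hK, hg0, hh0, Loop.adj_one, mul_one]
  have hev : ∀ᶠ p in nhds p₀, ‖K p - 1‖ < 1 := by
    have h1 : ContinuousAt (fun p => ‖K p - 1‖) p₀ := (hKc.sub continuousAt_const).norm
    refine h1.eventually_lt continuousAt_const ?_
    simp [hK0]
  obtain ⟨r, hr, hball⟩ := Metric.eventually_nhds_iff_ball.1 (hev.and (hD.mem_nhds hp₀))
  refine ⟨Metric.ball p₀ r, Metric.isOpen_ball,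
    (convex_ball p₀ r).isConnected ⟨p₀, Metric.mem_ball_self hr⟩, Metric.mem_ball_self hr,
    fun p hp => (hball p hp).2, fun p hp => ?_⟩
  obtain ⟨h1, h2⟩ := hball p hp
  have H := isIwasawa_one.near (hgm p h2) (hhm p h2) (K p) rfl h1
  refine ⟨(_, _, _), H, ?_⟩
  rintro ⟨Ψ, M, N⟩ H'
  obtain ⟨e1, e2, e3⟩ := IsIwasawa.unique H' H
  exact Prod.ext e1 (Prod.ext e2 e3)

end Timelike

end

/-! ### The representation theorem. -/

theorem theorem4p3 (D : Set (ℝ × ℝ)) (hD : IsOpen D) (hsc : SimplyConnectedSpace D)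
    (h0 : ((0, 0) : ℝ × ℝ) ∈ D) (ξ₁ ξ₂ : ℝ × ℝ → Timelike.Loop)
    (h₁ : Timelike.IsPotentialX D ξ₁) (h₂ : Timelike.IsPotentialY D ξ₂) :
    ∃ Ψ₁ Ψ₂ : ℝ × ℝ → Timelike.Loop,
      -- the two initial value problems
      Timelike.IsTheSolution D Ψ₁ ξ₁ (fun _ => 0) ∧
      Timelike.IsTheSolution D Ψ₂ (fun _ => 0) ξ₂ ∧
      -- potentials in the analytic loop algebra have solutions in the analytic loop group
      (Timelike.AnalyticLoops D ξ₁ → ∀ p ∈ D, Ψ₁ p ∈ Timelike.loopGroupAn) ∧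
      (Timelike.AnalyticLoops D ξ₂ → ∀ p ∈ D, Ψ₂ p ∈ Timelike.loopGroupAn) ∧
      -- near the origin the pair splits, in a unique way
      (∃ U : Set (ℝ × ℝ), IsOpen U ∧ IsConnected U ∧ ((0, 0) : ℝ × ℝ) ∈ U ∧ U ⊆ D ∧
        ∀ p ∈ U, ∃! t : Timelike.Loop × Timelike.Loop × Timelike.Loop,
          Timelike.IsIwasawa (Ψ₁ p) (Ψ₂ p) t.1 t.2.1 t.2.2) ∧
      -- wherever it splits, the splitting gives an extended framing and a loop of harmonic maps
      ∀ U : Set (ℝ × ℝ), IsOpen U → IsConnected U → ((0, 0) : ℝ × ℝ) ∈ U → U ⊆ D →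
        ∀ Ψ M N : ℝ × ℝ → Timelike.Loop,
          (∀ p ∈ U, Timelike.IsIwasawa (Ψ₁ p) (Ψ₂ p) (Ψ p) (M p) (N p)) →
            ContDiffOn ℝ ∞ M U ∧ ContDiffOn ℝ ∞ N U ∧
            Timelike.IsExtendedFraming U Ψ ∧
            (∀ t : ℝ, 0 < t →
              Timelike.IsHarmonicMap U
                (fun p => Timelike.Ad ((Ψ p).evalReal t) Timelike.matK)) ∧
            (∀ p ∈ U, Ψ₁ p ∈ Timelike.loopGroupAn → M p ∈ Timelike.loopGroupAn) ∧
            (∀ p ∈ U, Ψ₂ p ∈ Timelike.loopGroupAn → N p ∈ Timelike.loopGroupAn) := by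
  open Timelike in
  have := hsc
  obtain ⟨Ψ₁, i₁, f₁, u₁⟩ := (chiralPotential_of_X hD h₁).exists_frame hD (1, 0) fst_unit.1
    fst_unit.2.1 fst_unit.2.2 h0
  obtain ⟨Ψ₂, i₂, f₂, u₂⟩ := (chiralPotential_of_Y hD h₂).exists_frame hD (0, 1) snd_unit.1
    snd_unit.2.1 snd_unit.2.2 h0
  refine ⟨Ψ₁, Ψ₂,
    ⟨f₁.smooth, f₁.mem, (solvesFrame_fst_iff hD).2 f₁.hasFDerivAt, i₁,
      fun Φ hΦ hΦ0 => u₁ Φ ((solvesFrame_fst_iff hD).1 hΦ) hΦ0⟩,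
    ⟨f₂.smooth, f₂.mem, (solvesFrame_snd_iff hD).2 f₂.hasFDerivAt, i₂,
      fun Φ hΦ hΦ0 => u₂ Φ ((solvesFrame_snd_iff hD).1 hΦ) hΦ0⟩,
    f₁.extendsAnalytically hD (1, 0) fst_unit.1 fst_unit.2.1 fst_unit.2.2
      (chiralPotential_of_X hD h₁) h0 i₁,
    f₂.extendsAnalytically hD (0, 1) snd_unit.1 snd_unit.2.1 snd_unit.2.2
      (chiralPotential_of_Y hD h₂) h0 i₂,
    exists_splitting_neighbourhood hD h0 f₁.smooth.continuousOn f₂.smooth.continuousOn f₁.mem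
      f₂.mem i₁ i₂, fun U hU _ h0U hUD Ψ M N hs => ?_⟩
  have S : IsSplitPair D U ξ₁ ξ₂ Ψ₁ Ψ₂ Ψ M N := ⟨hU, hUD, h₁, h₂, f₁, f₂, hs⟩
  -- Ψ is analytic whether or not the frames are; the factors Ψ⁻¹Ψ' and Ψ⁻¹Ψ'' then inherit
  -- analyticity from Ψ' and Ψ'' point by point.
  have han := fun p (hp : p ∈ U) => S.mem_loopGroupAn hD h0 i₁ i₂ hp
  exact ⟨S.smooth_factors.1, S.smooth_factors.2, S.isExtendedFraming hD h0U i₁ i₂,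
    fun t ht => S.isHarmonicMap hD h0 i₁ i₂ ht,
    fun p hp => loopGroupAn_of_eq_mul (han p hp) (hs p hp).minus.1 (hs p hp).fst_eq,
    fun p hp => loopGroupAn_of_eq_mul (han p hp) (hs p hp).plus.1 (hs p hp).snd_eq⟩
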